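/- **Theorem (Feynman–Kac–Itô formula).** Let $(X,b,m)$ be a connected weighted graph: $X$ is a countable set with the discrete topology, $b:X\times X\to[0,\infty)$ is symmetric with $b(x,x)=0$ and $\sum_{y}b(x,y)<\infty$ for all $x$, any two vertices are joined by a path along which $b>0$, and $m:X\to(0,\infty)$. Put $\deg_1(x)=\sum_y b(x,y)$ and $\deg_m(x)=\deg_1(x)/m(x)$. Let $\theta:X\times X\to[-\pi,\pi]$ satisfy $\theta(x,y)=-\theta(y,x)$ (a magnetic potential), and let $v:X\to\mathbb R$. *The operator.* Let $C_c(X)$ be the space of finitely supported functions $X\to\mathbb C$ and let $\ell^2(X,m)$ carry the scalar product $\langle f,g\rangle=\sum_x f(x)\overline{g(x)}m(x)$. For $f,g\in C_c(X)$, $w:X\to\mathbb R$ and a magnetic potential $\vartheta$ put $$Q^{(c)}_{w,\vartheta}(f,g)=\frac12\sum_{x,y}b(x,y)\big(f(x)-e^{i\vartheta(x,y)}f(y)\big)\overline{\big(g(x)-e^{i\vartheta(x,y)}g(y)\big)}+\sum_x w(x)f(x)\overline{g(x)}m(x).$$ Assume $v\in\mathcal A_0$, i.e. with $v_\pm=\max(\pm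 v,0)$ there is $C\ge0$ such that $$\sum_x v_-(x)|f(x)|^2m(x)\le Q^{(c)}_{v_+,0}(f,f)+C\|f\|^2\qquad\text{for all } f\in C_c(X)$$ (equivalently, $Q^{(c)}_{v,0}$ is bounded below on $C_c(X)$). *The process.* Let $(Y_n)_{n\ge0}$ be a Markov chain in $X$ on a probability space $(\Omega,\mathcal F,\mathbb P)$ with transition probabilities $\mathbb P(Y_{n+1}=y\mid Y_n=x)=b(x,y)/\deg_1(x)$ (if $X$ is a single vertex, so that $\deg_1=0$, the chain is constant), and let $(\xi_n)$ be independent exponential random variables of parameter $1$, independent of $(Y_n)$. Put $J_n=\xi_n/\deg_m(Y_{n-1})$ (which is $\infty$ if $\deg_m=0$), $\tau_n=J_1+\dots+J_n$, $\tau_0=0$, $\tau=\sup_n\tau_n$, $N(t)=\sup\{n:\tau_n\le t\}$, and $\mathbb X_t=Y_n$ for $\tau_n\le t<\tau_{n+1}$. On $\{t<\tau\}$ put $$\mathscr S_t(v,\theta|\mathbb X)=i\sum_{n=1}^{N(t)}\theta(\mathbb X_{\tau_{n-1}},\mathbb X_{\tau_n})-\int_0^t v(\mathbb X_s)\,ds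 .$$ For $x$ with $\mathbb P(Y_0=x)>0$ let $\mathbb E_x$ be the expectation with respect to $\mathbb P_x=\mathbb P(\,\cdot\mid Y_0=x)$ (note that $\mathbb X_0=Y_0$ almost surely). *Claim.* The form $Q^{(c)}_{v,\theta}$ is bounded below and closable. The operator $L_{v,\theta}$ corresponding to its closure $Q_{v,\theta}$ ($f\in D(L_{v,\theta})$ and $L_{v,\theta}f=h$ if and only if $f\in D(Q_{v,\theta})$ and $Q_{v,\theta}(f,g)=\langle h,g\rangle$ for all $g\in D(Q_{v,\theta})$) exists and is self-adjoint, and $-L_{v,\theta}$ generates a strongly continuous semigroup $(e^{-tL_{v,\theta}})_{t\ge0}$ on $\ell^2(X,m)$. For all $f\in\ell^2(X,m)$, $t\ge0$ and every such $x\in X$, the random variable $1_{\{t<\tau\}}e^{\mathscr S_t(v,\theta|\mathbb X)}f(\mathbb X_t)$ is $\mathbb P_x$-integrable and $$e^{-tL_{v,\theta}}f(x)=\mathbb E_x\Big[1_{\{t<\tau\}}\,e^{\mathscr S_t(v,\theta|\mathbb X)}f(\mathbb X_t)\Big].$$ -/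

import Mathlib

open MeasureTheory ProbabilityTheory Filter Topology
open scoped ENNReal NNReal ComplexConjugate

/-- A connected weighted graph `(X, b, m)`: symmetric, loopless edge weights `b ≥ 0` with
`∑ y, b x y < ∞` for every `x`, and a strictly positive vertex weight `m`. -/
structure WeightedGraph (X : Type*) where
  b : X → X → ℝ
  m : X → ℝ
  b_nonneg : ∀ x y, 0 ≤ b x y
  b_symm : ∀ x y, b x y = b y x
  b_self : ∀ x, b x x = 0
  b_summable : ∀ x, Summable (b x)
  m_pos : ∀ x, 0 < m x
  connected : ∀ x y, Relation.ReflTransGen (fun z w => 0 < b z w) x y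

/-- A magnetic potential: an antisymmetric function `X × X → [-π, π]`. -/
structure IsMagneticPotential {X : Type*} (θ : X → X → ℝ) : Prop where
  mem_Icc : ∀ x y, θ x y ∈ Set.Icc (-Real.pi) Real.pi
  antisymm : ∀ x y, θ x y = - θ y x

/-! ### One-parameter semigroups on a Hilbert space -/

section Semigroup

variable {H : Type*} [NormedAddCommGroup H] [InnerProductSpace ℂ H]

/-- `T` is a strongly continuous one-parameter semigroup of bounded operators whose infinitesimal
generator (with its full domain) is exactly the operator `A`. -/
structure IsC0SemigroupGeneratedBy (T : ℝ≥0 → H →L[ℂ] H) (A : H →ₗ.[ℂ] H) : Prop where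
  map_zero : T 0 = ContinuousLinearMap.id ℂ H
  map_add : ∀ s t, T (s + t) = (T s).comp (T t)
  continuous : ∀ f, Continuous fun t => T t f
  generator : ∀ f h, (f, h) ∈ A.graph ↔
    Tendsto (fun t : ℝ≥0 => (((t : ℝ)⁻¹ : ℝ) : ℂ) • (T t f - f)) (𝓝[>] 0) (𝓝 h)

open Classical in
/-- `expNeg L t` is `e^{-tL}`: the strongly continuous semigroup with generator `-L`. Such a
semigroup is unique if it exists; if there is none, the value is `0`. -/
noncomputable def expNeg (L : H →ₗ.[ℂ] H) : ℝ≥0 → H →L[ℂ] H :=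
  if h : ∃ T : ℝ≥0 → H →L[ℂ] H, IsC0SemigroupGeneratedBy T (-L) then h.choose else 0

end Semigroup

namespace WeightedGraph

variable {X : Type*} (G : WeightedGraph X)

/-! ### The space `ℓ²(X, m)` and the magnetic Schrödinger operators -/

section Operator

variable [MeasurableSpace X]

/-- The measure on `X` giving mass `m x` to the point `x`. -/
noncomputable def measure : Measure X :=
  Measure.sum fun x => ENNReal.ofReal (G.m x) • Measure.dirac x

/-- `ℓ²(X, m)`. As every point has positive mass, elements have well defined point values. -/
noncomputable abbrev ell2 := Lp ℂ 2 G.measure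

/-- `C_c(X)`, the finitely supported functions, inside `ℓ²(X, m)`. -/
def Cc : Set G.ell2 := {f | (Function.support (f : X → ℂ)).Finite}

/-- `q_w(f, g) = ∑ x, w x * f x * conj (g x) * m x`. -/
noncomputable def potentialForm (w : X → ℝ) (f g : X → ℂ) : ℂ :=
  ∑' x, (w x : ℂ) * f x * conj (g x) * (G.m x : ℂ)

/-- The sesquilinear form `Q_{v,θ}^{(c)}(f, g)` (to be used for finitely supported `f`, `g`). -/
noncomputable def form (v : X → ℝ) (θ : X → X → ℝ) (f g : X → ℂ) : ℂ :=
  1 / 2 * ∑' p : X × X, (G.b p.1 p.2 : ℂ)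
      * (f p.1 - Complex.exp (Complex.I * (θ p.1 p.2 : ℂ)) * f p.2)
      * conj (g p.1 - Complex.exp (Complex.I * (θ p.1 p.2 : ℂ)) * g p.2)
    + G.potentialForm v f g

/-- The class `𝒜_θ` of potentials: there is `C ≥ 0` with
`q_{w₋}(f) ≤ Q_{w₊,θ}^{(c)}(f) + C ‖f‖²` for all `f ∈ C_c(X)`. -/
def admissible (θ : X → X → ℝ) : Set (X → ℝ) :=
  {w | ∃ C : ℝ, 0 ≤ C ∧ ∀ f ∈ G.Cc,
    (G.potentialForm (fun x => max (-w x) 0) f f).re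
      ≤ (G.form (fun x => max (w x) 0) θ f f).re + C * ‖f‖ ^ 2}

/-- `Q_{v,θ}^{(c)}` is bounded below on `C_c(X)`. -/
def IsSemibounded (v : X → ℝ) (θ : X → X → ℝ) : Prop :=
  ∃ C : ℝ, ∀ f ∈ G.Cc, C * ‖f‖ ^ 2 ≤ (G.form v θ f f).re

/-- The sequence `u` in `C_c(X)` converges to `f` in `ℓ²(X, m)` and is Cauchy with respect to
the form `Q_{v,θ}^{(c)}`. -/
structure Approximates (v : X → ℝ) (θ : X → X → ℝ) (u : ℕ → G.ell2) (f : G.ell2) : Prop where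
  mem : ∀ n, u n ∈ G.Cc
  tendsto : Tendsto u atTop (𝓝 f)
  cauchy : Tendsto (fun p : ℕ × ℕ => G.form v θ ⇑(u p.1 - u p.2) ⇑(u p.1 - u p.2)) atTop (𝓝 0)

/-- Closability of `Q_{v,θ}^{(c)}` (for a semi-bounded form). -/
def IsClosable (v : X → ℝ) (θ : X → X → ℝ) : Prop :=
  ∀ u : ℕ → G.ell2, G.Approximates v θ u 0 →
    Tendsto (fun n => G.form v θ (u n) (u n)) atTop (𝓝 0)

/-- The domain `D(Q_{v,θ})` of the closure of `Q_{v,θ}^{(c)}`. -/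
def closureDomain (v : X → ℝ) (θ : X → X → ℝ) : Set G.ell2 :=
  {f | ∃ u, G.Approximates v θ u f}

open Classical in
/-- The closure `Q_{v,θ}` of `Q_{v,θ}^{(c)}`: `Q_{v,θ}(f, g) = lim Q_{v,θ}^{(c)}(uₙ, wₙ)` for
approximating sequences `u` of `f` and `w` of `g`. For a semi-bounded closable form the limit
exists and does not depend on the sequences. Outside the domain the value is `0`. -/
noncomputable def closureForm (v : X → ℝ) (θ : X → X → ℝ) (f g : G.ell2) : ℂ :=
  if h : f ∈ G.closureDomain v θ ∧ g ∈ G.closureDomain v θ then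
    limUnder atTop fun n => G.form v θ (h.1.choose n) (h.2.choose n)
  else 0

/-- `L` is the operator corresponding to the form `Q_{v,θ}`: `f ∈ D(L)` with `L f = h` iff
`f ∈ D(Q_{v,θ})` and `Q_{v,θ}(f, g) = ∑ x, h x * conj (g x) * m x` for all `g ∈ D(Q_{v,θ})`.
(Mathlib's inner product is conjugate linear in its first argument.) -/
def IsFormOperator (v : X → ℝ) (θ : X → X → ℝ) (L : G.ell2 →ₗ.[ℂ] G.ell2) : Prop :=
  ∀ f h, (f, h) ∈ L.graph ↔
    f ∈ G.closureDomain v θ ∧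
      ∀ g ∈ G.closureDomain v θ, G.closureForm v θ f g = inner ℂ g h

open Classical in
/-- The magnetic Schrödinger operator `L_{v,θ}`: the operator corresponding to `Q_{v,θ}`. An
operator is determined by its graph, so there is at most one; if there is none, the value is the
operator with domain `0`. -/
noncomputable def schrodinger (v : X → ℝ) (θ : X → X → ℝ) : G.ell2 →ₗ.[ℂ] G.ell2 :=
  if h : ∃ L, G.IsFormOperator v θ L then h.choose else ⊥

end Operator

/-! ### The jump process -/

section JumpChain

/-- `deg₁ x = ∑ y, b x y`. -/
noncomputable def degOne (x : X) : ℝ := ∑' y, G.b x y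

/-- The weighted vertex degree `deg_m x = deg₁ x / m x`. -/
noncomputable def degM (x : X) : ℝ := 1 / G.m x * ∑' y, G.b x y

open Classical in
/-- The transition probability from `x` to `y`, i.e. `b x y / deg₁ x`. The degree vanishes only if
the graph is a single vertex; the chain then stays at that vertex. -/
noncomputable def transition (x y : X) : ℝ :=
  if G.degOne x = 0 then (if x = y then 1 else 0) else G.b x y / G.degOne x

variable {Ω : Type*}

/-- `Y` is a Markov chain with the transition probabilities of the graph (with arbitrary initial
distribution), and `ξ` is a sequence of independent exponential variables of parameter `1`, which
is independent of `Y`. -/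
structure IsJumpData [MeasurableSpace X] [MeasurableSpace Ω] (P : Measure Ω)
    (Y : ℕ → Ω → X) (ξ : ℕ → Ω → ℝ) : Prop where
  measurable_chain : ∀ n, Measurable (Y n)
  measurable_clock : ∀ n, Measurable (ξ n)
  markov : ∀ (n : ℕ) (z : ℕ → X),
    P {ω | ∀ k ≤ n + 1, Y k ω = z k}
      = P {ω | ∀ k ≤ n, Y k ω = z k} * ENNReal.ofReal (G.transition (z n) (z (n + 1)))
  clock_law : ∀ n, P.map (ξ n) = expMeasure 1
  clock_indep : iIndepFun ξ P
  chain_indep_clock : IndepFun (fun ω n => Y n ω) (fun ω n => ξ n ω) P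

variable (Y : ℕ → Ω → X) (ξ : ℕ → Ω → ℝ)

/-- `τ_n = J_1 + ⋯ + J_n` with `J_k = ξ_k / deg_m Y_{k-1}`. In `[0, ∞]`, so that `J_k = ∞` if the
degree is zero (and `ξ_k > 0`). -/
noncomputable def jumpTime (n : ℕ) (ω : Ω) : ℝ≥0∞ :=
  ∑ k ∈ Finset.Icc 1 n, ENNReal.ofReal (ξ k ω) / ENNReal.ofReal (G.degM (Y (k - 1) ω))

/-- The explosion time `τ = sup τ_n`. -/
noncomputable def explosionTime (ω : Ω) : ℝ≥0∞ := ⨆ n, G.jumpTime Y ξ n ω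

/-- The number of jumps `N(t) = sup {n | τ_n ≤ t}`; only used for `t < τ`, where it is finite. -/
noncomputable def jumpCount (t : ℝ≥0∞) (ω : Ω) : ℕ := sSup {n | G.jumpTime Y ξ n ω ≤ t}

/-- The jump process at a time `t < τ`; it equals `Y_n` for `τ_n ≤ t < τ_{n+1}`. -/
noncomputable def process (t : ℝ≥0∞) (ω : Ω) : X := Y (G.jumpCount Y ξ t ω) ω

theorem process_eq {n : ℕ} {t : ℝ≥0∞} {ω : Ω} (h₁ : G.jumpTime Y ξ n ω ≤ t)
    (h₂ : t < G.jumpTime Y ξ (n + 1) ω) : G.process Y ξ t ω = Y n ω := by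
  have hmono : Monotone fun k => G.jumpTime Y ξ k ω := fun i j hij =>
    Finset.sum_le_sum_of_subset (Finset.Icc_subset_Icc_right hij)
  have hs : {k | G.jumpTime Y ξ k ω ≤ t} = Set.Iic n := by
    ext k
    simp only [Set.mem_ofPred_eq, Set.mem_Iic]
    refine ⟨fun hk => ?_, fun hk => (hmono hk).trans h₁⟩
    by_contra hlt
    exact absurd (((hmono (Nat.succ_le_of_lt (not_le.mp hlt))).trans hk).trans_lt h₂)
      (lt_irrefl _)
  unfold process jumpCount
  rw [hs, csSup_Iic]

/-- The stochastic line integral `∑_{n=1}^{N(t)} θ(𝕏_{τ_{n-1}}, 𝕏_{τ_n})` on `{t < τ}`. -/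
noncomputable def lineIntegral (θ : X → X → ℝ) (t : ℝ≥0) (ω : Ω) : ℝ :=
  ∑ n ∈ Finset.Icc 1 (G.jumpCount Y ξ t ω),
    θ (G.process Y ξ (G.jumpTime Y ξ (n - 1) ω) ω) (G.process Y ξ (G.jumpTime Y ξ n ω) ω)

/-- The Euclidean action `𝒮_t(v, θ | 𝕏) = i ∫₀ᵗ θ(d𝕏_s) - ∫₀ᵗ v(𝕏_s) ds` on `{t < τ}`. -/
noncomputable def action (v : X → ℝ) (θ : X → X → ℝ) (t : ℝ≥0) (ω : Ω) : ℂ :=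
  Complex.I * (G.lineIntegral Y ξ θ t ω : ℂ)
    - ((∫ s in (0 : ℝ)..t, v (G.process Y ξ (ENNReal.ofReal s) ω) : ℝ) : ℂ)

/-- The random variable `1_{t < τ} exp(𝒮_t(v, θ | 𝕏)) f(𝕏_t)`. -/
noncomputable def feynmanKacIto (v : X → ℝ) (θ : X → X → ℝ) (f : X → ℂ) (t : ℝ≥0) : Ω → ℂ :=
  Set.indicator {ω | (t : ℝ≥0∞) < G.explosionTime Y ξ ω}
    fun ω => Complex.exp (G.action Y ξ v θ t ω) * f (G.process Y ξ t ω)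

end JumpChain

end WeightedGraph

namespace WeightedGraph

theorem transition_nonneg {X : Type*} (G : WeightedGraph X) (x y : X) : 0 ≤ G.transition x y := by
  unfold transition
  split_ifs
  · exact zero_le_one
  · exact le_rfl
  · exact div_nonneg (G.b_nonneg x y) (tsum_nonneg (G.b_nonneg x))

theorem hasSum_transition {X : Type*} (G : WeightedGraph X) (x : X) :
    HasSum (G.transition x) 1 := by
  classical
  unfold transition
  by_cases h : G.degOne x = 0
  · simp only [h, if_true]
    simpa [eq_comm] using hasSum_ite_eq x (1 : ℝ)
  · simp only [h, if_false]
    have := (G.b_summable x).hasSum.div_const (G.degOne x)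
    rwa [show (∑' y, G.b x y) = G.degOne x from rfl, div_self h] at this

/-- The process exists: there is a realization started at any given vertex. -/
theorem exists_isJumpData {X : Type*} [Countable X] [MeasurableSpace X] [DiscreteMeasurableSpace X]
    (G : WeightedGraph X) (x₀ : X) :
    ∃ (P : Measure ((ℕ × X → X) × (ℕ → ℝ))) (Y : ℕ → (ℕ × X → X) × (ℕ → ℝ) → X)
      (ξ : ℕ → (ℕ × X → X) × (ℕ → ℝ) → ℝ),
      IsProbabilityMeasure P ∧ G.IsJumpData P Y ξ ∧ ∀ ω, Y 0 ω = x₀ := by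
  classical
  let κ : ℕ × X → Measure X := fun p =>
    Measure.sum fun y => ENNReal.ofReal (G.transition p.2 y) • Measure.dirac y
  have hκs : ∀ p y, κ p {y} = ENNReal.ofReal (G.transition p.2 y) := by
    intro p y
    simp only [κ]
    rw [Measure.sum_apply _ (by measurability), tsum_eq_single y]
    · simp
    · intro z hz; simp [hz]
  have : ∀ p, IsProbabilityMeasure (κ p) := fun p => ⟨by
    simp only [κ]
    rw [Measure.sum_apply _ MeasurableSet.univ]
    simp only [Measure.smul_apply, measure_univ, smul_eq_mul, mul_one]
    rw [← ENNReal.ofReal_tsum_of_nonneg (G.transition_nonneg p.2)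
      (G.hasSum_transition p.2).summable, (G.hasSum_transition p.2).tsum_eq, ENNReal.ofReal_one]⟩
  have : IsProbabilityMeasure (expMeasure 1) := isProbabilityMeasure_expMeasure one_pos
  let μ : Measure (ℕ × X → X) := Measure.infinitePi κ
  let ν : Measure (ℕ → ℝ) := Measure.infinitePi fun _ => expMeasure 1
  let Z : ℕ → (ℕ × X → X) → X := fun n a => Nat.rec x₀ (fun k z => a (k, z)) n
  have hZ0 : ∀ a, Z 0 a = x₀ := fun a => rfl
  have hZs : ∀ n a, Z (n + 1) a = a (n, Z n a) := fun n a => rfl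
  have hset : ∀ (n : ℕ) (z : ℕ → X), z 0 = x₀ → {a | ∀ k ≤ n, Z k a = z k}
      = Set.pi ((Finset.range n).image fun k => (k, z k)) (fun p => {z (p.1 + 1)}) := by
    intro n z hz
    ext a
    simp only [Set.mem_ofPred_eq, Set.mem_pi, Finset.coe_image, Set.mem_image, Finset.coe_range,
      Set.mem_Iio, Set.mem_singleton_iff]
    constructor
    · rintro h _ ⟨k, hk, rfl⟩
      have h1 := h (k + 1) hk
      rw [hZs, h k hk.le] at h1
      exact h1
    · intro h k
      induction k with
      | zero => intro _; rw [hZ0, hz]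
      | succ k ih =>
        intro hk
        rw [hZs, ih (Nat.le_of_succ_le hk)]
        exact h _ ⟨k, hk, rfl⟩
  have hμ : ∀ (n : ℕ) (z : ℕ → X), z 0 = x₀ → μ {a | ∀ k ≤ n, Z k a = z k}
      = ∏ k ∈ Finset.range n, ENNReal.ofReal (G.transition (z k) (z (k + 1))) := by
    intro n z hz
    rw [hset n z hz, Measure.infinitePi_pi _ (fun _ _ => by measurability),
      Finset.prod_image (fun i _ j _ hij => (Prod.ext_iff.mp hij).1)]
    simp only [hκs]
  have hZm : ∀ n, Measurable (Z n) := by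
    intro n
    induction n with
    | zero => exact measurable_const
    | succ n ih =>
      have h : Measurable fun q : X × (ℕ × X → X) => q.2 (n, q.1) :=
        measurable_from_prod_countable_right fun y => measurable_pi_apply (n, y)
      exact h.comp (ih.prodMk measurable_id)
  have hsets : ∀ (n : ℕ) (z : ℕ → X),
      {ω : (ℕ × X → X) × (ℕ → ℝ) | ∀ k ≤ n, Z k ω.1 = z k} = {a | ∀ k ≤ n, Z k a = z k} ×ˢ Set.univ := by
    intro n z; ext ω; simp
  have hlaw : ∀ n : ℕ, (μ.prod ν).map (fun ω => ω.2 n) = expMeasure 1 := by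
    intro n
    rw [show (fun ω : (ℕ × X → X) × (ℕ → ℝ) => ω.2 n) = (fun w => w n) ∘ Prod.snd from rfl,
      ← Measure.map_map (measurable_pi_apply n) measurable_snd, Measure.map_snd_prod,
      measure_univ, one_smul]
    exact Measure.infinitePi_map_eval (μ := fun _ : ℕ => expMeasure 1) n
  refine ⟨μ.prod ν, fun n ω => Z n ω.1, fun n ω => ω.2 n, inferInstance, ?_, fun ω => rfl⟩
  refine ⟨fun n => (hZm n).comp measurable_fst,
    fun n => (measurable_pi_apply n).comp measurable_snd, ?_, ?_, ?_, ?_⟩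
  · intro n z
    rw [hsets, hsets, Measure.prod_prod, Measure.prod_prod, measure_univ, mul_one, mul_one]
    by_cases hz : z 0 = x₀
    · rw [hμ _ _ hz, hμ _ _ hz, Finset.prod_range_succ]
    · have he : ∀ n, {a | ∀ k ≤ n, Z k a = z k} = ∅ := fun n =>
        Set.eq_empty_of_forall_notMem fun a ha => hz (ha 0 (Nat.zero_le n)).symm
      rw [he, he, measure_empty, zero_mul]
  · exact hlaw
  · have hm : ∀ n : ℕ, Measurable fun ω : (ℕ × X → X) × (ℕ → ℝ) => ω.2 n :=
      fun n => (measurable_pi_apply n).comp measurable_snd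
    rw [iIndepFun_iff_map_fun_eq_infinitePi_map hm]
    simp only [hlaw]
    exact (Measure.map_snd_prod (μ := μ) (ν := ν)).trans (by rw [measure_univ, one_smul])
  · exact indepFun_prod (X := fun a n => Z n a) (Y := fun w => w)
      (measurable_pi_lambda _ hZm) measurable_id

end WeightedGraph

/-! The proof replaces the unbounded operator by a bounded resolvent and compares, on finite sets,
the Dyson series of the semigroup with the sum over paths.

Admissibility and the diamagnetic inequality `form_abs_le` provide one constant `l` such that the
form with potential `v + l` dominates the squared norm on finitely supported functions, for every
magnetic potential. Let `V` be the completion in the form norm and `J : V → ℓ²` the induced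
contraction. Then `R = J J*` is positive and bounded, and the form operator is `R⁻¹ - l` as soon as
`J` is injective, which is closability in another guise (`domainInclusion_injective`). For
injectivity, the zero-field resolvent applied to an indicator function gives a strictly positive
superharmonic function `u` (`exists_superharmonic`). Dividing by `u` writes the form, for any `θ`,
as a sum of non-negative terms depending only on point values, so the form is a supremum of
continuous functionals on `ℓ²`. The semigroup is `exp (l t) exp (-t R⁻¹)`, defined by functional
calculus, and `IsC0SemigroupGeneratedBy.eq` identifies it with the one selected by `expNeg`.

For a finite set `S`, put `R_S = J P_S J*`, where `P_S` projects onto the functions supported in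
`S`. At the vertices of `S` the corresponding semigroup solves a finite linear system, so it is the
sum of its Dyson series (`tendsto_sum_dysonTerm`). Conditioning on the first jump shows that the
`n`-th Dyson term is the expectation of the functional on the event that exactly `n` jumps occur up
to time `t`, all into `S` (`integral_meanWeight_eq_dysonTerm`, `setIntegral_pathWeight`). Summing
over `n` gives the formula for the process confined to `S`.

Now let `S` exhaust `X`. The projections `P_S` tend strongly to the identity, hence `R_S → R`
strongly, and so do the semigroups (`tendsto_heatOp_apply`). On the probabilistic side, a path that
has not exploded by time `t` has visited finitely many vertices. Fatou's lemma with zero magnetic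
field and `|f|` in place of `f` gives integrability, and dominated convergence gives the formula. -/

/-! ### Functional calculus for `exp (-t R⁻¹)` with `R` bounded and positive -/

/-- The continuous function on `ℝ` which equals `r ↦ exp (-t / r)` for `r > 0`. -/
noncomputable def heat (t r : ℝ) : ℝ :=
  if 0 < t ∧ r ≤ 0 then 0 else Real.exp (-t / r)

theorem heat_zero (r : ℝ) : heat 0 r = 1 := by simp [heat]

theorem heat_of_pos (t : ℝ) {r : ℝ} (hr : 0 < r) : heat t r = Real.exp (-t / r) := by
  simp [heat, hr]

theorem heat_nonneg (t r : ℝ) : 0 ≤ heat t r := by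
  unfold heat; split_ifs <;> positivity

theorem heat_le_one {t r : ℝ} (ht : 0 ≤ t) (hr : 0 ≤ r) : heat t r ≤ 1 := by
  unfold heat; split_ifs
  · exact zero_le_one
  · rw [Real.exp_le_one_iff]
    exact div_nonpos_of_nonpos_of_nonneg (by linarith) hr

theorem heat_add {s t r : ℝ} (hs : 0 ≤ s) (ht : 0 ≤ t) (hr : 0 ≤ r) :
    heat (s + t) r = heat s r * heat t r := by
  rcases hs.eq_or_lt with rfl | hs'
  · simp [heat_zero]
  rcases ht.eq_or_lt with rfl | ht'
  · simp [heat_zero]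
  rcases hr.eq_or_lt with rfl | hr'
  · simp [heat, hs', ht', add_pos hs' ht']
  · rw [heat_of_pos _ hr', heat_of_pos _ hr', heat_of_pos _ hr', ← Real.exp_add]
    congr 1; ring

/-- This is `1 - exp (-x) ≤ x` at `x = (t - s) / r`. The factor `r` absorbs the rate `1 / r`, so the
Lipschitz constant does not depend on `r`. -/
theorem mul_heat_sub_le {s t r : ℝ} (hs : 0 ≤ s) (hst : s ≤ t) (hr : 0 ≤ r) :
    |r * (heat t r - heat s r)| ≤ t - s := by
  rcases hr.eq_or_lt with rfl | hr'
  · simp; exact hst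
  have ht : heat t r = heat s r * heat (t - s) r := by
    rw [← heat_add hs (by linarith) hr]; congr 1; ring
  have h1 := heat_le_one (t := t - s) (by linarith) hr
  have h2 : 1 - (t - s) / r ≤ heat (t - s) r := by
    rw [heat_of_pos _ hr']
    have := Real.add_one_le_exp (-(t - s) / r)
    rw [neg_div] at this ⊢
    linarith
  have h3 : r * (1 - heat (t - s) r) ≤ t - s := by
    have : r * (1 - heat (t - s) r) ≤ r * ((t - s) / r) := by gcongr; linarith
    rwa [mul_div_cancel₀ _ hr'.ne'] at this
  rw [ht, show r * (heat s r * heat (t - s) r - heat s r)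
    = -(heat s r * (r * (1 - heat (t - s) r))) by ring, abs_neg, abs_of_nonneg
      (mul_nonneg (heat_nonneg _ _) (mul_nonneg hr (by linarith)))]
  have := mul_le_mul (heat_le_one hs hr) h3 (mul_nonneg hr (by linarith)) zero_le_one
  linarith

/-- Second-order counterpart: two factors `r` control the Taylor remainder `exp (-x) - 1 + x`
uniformly in `r`, which yields time derivatives in operator norm. -/
theorem sq_mul_heat_sub_le {s t r : ℝ} (hs : 0 ≤ s) (hst : s ≤ t) (hr : 0 ≤ r) :
    |r * r * (heat t r - heat s r) + (t - s) * (r * heat s r)| ≤ (t - s) ^ 2 := by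
  rcases hr.eq_or_lt with rfl | hr'
  · simp; positivity
  have ht : heat t r = heat s r * heat (t - s) r := by
    rw [← heat_add hs (by linarith) hr]; congr 1; ring
  set x := (t - s) / r with hx
  have hx0 : 0 ≤ x := div_nonneg (by linarith) hr
  have hxr : t - s = r * x := by rw [hx, mul_div_cancel₀ _ hr'.ne']
  have hh : heat (t - s) r = Real.exp (-x) := by rw [heat_of_pos _ hr', neg_div]
  have h1 : 0 ≤ Real.exp (-x) - 1 + x := by linarith [Real.add_one_le_exp (-x)]
  -- Follows from `exp (-x) ≤ 1 / (1 + x)` and `1 / (1 + x) ≤ 1 - x + x ^ 2`.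
  have h2 : Real.exp (-x) - 1 + x ≤ x ^ 2 := by
    have h3 : Real.exp (-x) * (1 + x) ≤ 1 := by
      have := Real.add_one_le_exp x
      calc _ ≤ Real.exp (-x) * Real.exp x := by gcongr; linarith
        _ = 1 := by rw [← Real.exp_add]; simp
    have h4 : Real.exp (-x) ≤ 1 := Real.exp_le_one_iff.mpr (by linarith)
    nlinarith
  rw [ht, hh, hxr, show r * r * (heat s r * Real.exp (-x) - heat s r) + r * x * (r * heat s r)
    = heat s r * (r ^ 2 * (Real.exp (-x) - 1 + x)) by ring, abs_of_nonneg
      (mul_nonneg (heat_nonneg _ _) (by positivity))]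
  have := mul_le_mul (heat_le_one hs hr)
    (mul_le_mul_of_nonneg_left h2 (sq_nonneg r)) (by positivity) zero_le_one
  linarith

/-- For `t > 0` the value `0` at `r = 0` is forced by `exp (-t / x) ≤ x / t`. It allows the calculus
to be applied to resolvents with a kernel, such as the finite-volume ones: on the kernel the
semigroup vanishes for positive times. -/
theorem continuous_heat (t : ℝ) (ht : 0 ≤ t) : Continuous (heat t) := by
  rcases ht.eq_or_lt with rfl | ht
  · simp only [funext heat_zero]; exact continuous_const
  rw [continuous_iff_continuousAt]
  intro r
  rcases lt_trichotomy r 0 with hr | rfl | hr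
  · refine (continuousAt_const (y := (0 : ℝ))).congr ?_
    filter_upwards [gt_mem_nhds hr] with x hx
    simp [heat, ht, hx.le]
  · have h0 : heat t 0 = 0 := by simp [heat, ht]
    rw [ContinuousAt, h0, Metric.tendsto_nhds_nhds]
    intro ε hε
    refine ⟨ε * t, by positivity, fun {x} hx => ?_⟩
    rw [dist_zero_right, Real.norm_eq_abs, abs_of_nonneg (heat_nonneg _ _)]
    rw [dist_zero_right, Real.norm_eq_abs] at hx
    rcases le_or_gt x 0 with hx0 | hx0
    · simpa [heat, ht, hx0]
    rw [abs_of_pos hx0] at hx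
    rw [heat_of_pos _ hx0, neg_div, Real.exp_neg]
    have h1 := Real.add_one_le_exp (t / x)
    have h2 : 0 < t / x := by positivity
    calc (Real.exp (t / x))⁻¹ ≤ (t / x)⁻¹ := by gcongr; linarith
      _ = x / t := inv_div _ _
      _ < ε := by rwa [div_lt_iff₀ ht]
  · have : ContinuousAt (fun r => Real.exp (-t / r)) r := by
      refine Real.continuous_exp.continuousAt.comp ?_
      exact continuousAt_const.div continuousAt_id hr.ne'
    refine this.congr ?_
    filter_upwards [lt_mem_nhds hr] with x hx
    rw [heat_of_pos _ hx]

section HeatOperator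

variable {H : Type*} [NormedAddCommGroup H] [InnerProductSpace ℂ H] [CompleteSpace H]

/-- The operator `exp (-t R⁻¹)`, defined by functional calculus for a positive operator `R`. -/
noncomputable def heatOp (R : H →L[ℂ] H) (t : ℝ) : H →L[ℂ] H := cfc (heat t) R

theorem ContinuousLinearMap.IsPositive.spectrum_nonneg {R : H →L[ℂ] H} (hR : R.IsPositive) {r : ℝ}
    (hr : r ∈ spectrum ℝ R) : 0 ≤ r :=
  spectrum_nonneg_of_nonneg ((ContinuousLinearMap.nonneg_iff_isPositive R).mpr hR) hr

variable {R : H →L[ℂ] H} (hR : R.IsPositive)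
include hR

theorem heatOp_zero : heatOp R 0 = 1 := by
  unfold heatOp
  rw [funext heat_zero]
  exact cfc_const_one ℝ R hR.isSelfAdjoint

theorem norm_heatOp_le {t : ℝ} (ht : 0 ≤ t) : ‖heatOp R t‖ ≤ 1 := by
  refine norm_cfc_le zero_le_one fun r hr => ?_
  rw [Real.norm_eq_abs, abs_of_nonneg (heat_nonneg _ _)]
  exact heat_le_one ht (hR.spectrum_nonneg hr)

theorem heatOp_add {s t : ℝ} (hs : 0 ≤ s) (ht : 0 ≤ t) :
    heatOp R (s + t) = heatOp R s * heatOp R t := by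
  unfold heatOp
  rw [← cfc_mul _ _ R (continuous_heat s hs).continuousOn (continuous_heat t ht).continuousOn]
  exact cfc_congr fun r hr => heat_add hs ht (hR.spectrum_nonneg hr)

theorem mul_heatOp {t : ℝ} (ht : 0 ≤ t) : R * heatOp R t = cfc (fun r => r * heat t r) R := by
  have := hR.isSelfAdjoint
  rw [cfc_mul (fun r => r) (heat t) R (by fun_prop) (continuous_heat t ht).continuousOn,
    cfc_id' ℝ R]; rfl

theorem heatOp_mul {t : ℝ} (ht : 0 ≤ t) : heatOp R t * R = R * heatOp R t := by
  have := hR.isSelfAdjoint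
  rw [mul_heatOp hR ht]
  simp_rw [mul_comm _ (heat t _)]
  rw [cfc_mul (heat t) (fun r => r) R (continuous_heat t ht).continuousOn (by fun_prop),
    cfc_id' ℝ R]; rfl

theorem norm_mul_heatOp_sub_le {s t : ℝ} (hs : 0 ≤ s) (hst : s ≤ t) :
    ‖R * (heatOp R t - heatOp R s)‖ ≤ t - s := by
  have h1 := continuous_heat s hs
  have h2 := continuous_heat t (hs.trans hst)
  have : R * (heatOp R t - heatOp R s) = cfc (fun r => r * (heat t r - heat s r)) R := by
    simp_rw [mul_sub]
    rw [cfc_sub (fun r => r * heat t r) (fun r => r * heat s r) R (by fun_prop) (by fun_prop),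
      mul_heatOp hR hs, mul_heatOp hR (hs.trans hst)]
  rw [this]
  exact norm_cfc_le (by linarith) fun r hr => mul_heat_sub_le hs hst (hR.spectrum_nonneg hr)

theorem norm_sq_mul_heatOp_sub_le {s t : ℝ} (hs : 0 ≤ s) (hst : s ≤ t) :
    ‖R * (R * (heatOp R t - heatOp R s)) + (t - s) • (R * heatOp R s)‖ ≤ (t - s) ^ 2 := by
  have h1 := continuous_heat s hs
  have h2 := continuous_heat t (hs.trans hst)
  have hsa := hR.isSelfAdjoint
  have : R * (R * (heatOp R t - heatOp R s)) + (t - s) • (R * heatOp R s)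
      = cfc (fun r => r * r * (heat t r - heat s r) + (t - s) * (r * heat s r)) R := by
    rw [cfc_add R (fun r => r * r * (heat t r - heat s r)) (fun r => (t - s) * (r * heat s r))
        (by fun_prop) (by fun_prop), cfc_const_mul (t - s) (fun r => r * heat s r) R (by fun_prop),
      cfc_mul (fun r => r * r) (fun r => heat t r - heat s r) R (by fun_prop) (by fun_prop),
      cfc_sub (heat t) (heat s) R (by fun_prop) (by fun_prop), cfc_mul (fun r => r) (fun r => r) R
      (by fun_prop) (by fun_prop), cfc_id' ℝ R, mul_heatOp hR hs, mul_assoc]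
    rfl
  rw [this]
  exact norm_cfc_le (by positivity) fun r hr => sq_mul_heat_sub_le hs hst (hR.spectrum_nonneg hr)

end HeatOperator

/-! ### Uniqueness of the semigroup with a given generator -/

section Uniqueness

variable {H : Type*} [NormedAddCommGroup H] [InnerProductSpace ℂ H]

theorem hasDerivWithinAt_norm_sq_complex {w : ℝ → H} {w' : H} {s : Set ℝ} {x : ℝ}
    (h : HasDerivWithinAt w w' s x) :
    HasDerivWithinAt (fun z => ‖w z‖ ^ 2) (2 * (inner ℂ (w x) w').re) s x := by
  have h1 := Complex.reCLM.hasFDerivAt.comp_hasDerivWithinAt x (h.inner ℂ h)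
  have h2 : (Complex.reCLM ∘ fun z => inner ℂ (w z) (w z)) = fun z => ‖w z‖ ^ 2 := by
    funext z
    simp [inner_self_eq_norm_sq_to_K, ← Complex.ofReal_pow]
  rw [h2] at h1
  rwa [Complex.reCLM_apply, Complex.add_re, ← inner_conj_symm w', Complex.conj_re,
    ← two_mul] at h1

/-- Gronwall with zero initial value. Only a lower bound of right difference quotients enters,
because the definition of the generator gives right derivatives. -/
theorem nonpos_of_deriv_right_le {f f' : ℝ → ℝ} {K t : ℝ} (hf : Continuous f)
    (hf' : ∀ x, 0 ≤ x → ∀ r, f' x < r → ∃ᶠ z in 𝓝[>] x, (z - x)⁻¹ * (f z - f x) < r)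
    (h0 : f 0 = 0) (bound : ∀ x, 0 ≤ x → f' x ≤ K * f x) (ht : 0 ≤ t) : f t ≤ 0 := by
  have := le_gronwallBound_of_liminf_deriv_right_le (δ := 0) (ε := 0) (a := 0) (b := t)
    hf.continuousOn (fun x hx r hr => hf' x hx.1 r hr) h0.le
    (fun x hx => by simpa using bound x hx.1) t ⟨ht, le_rfl⟩
  simpa [gronwallBound_ε0_δ0] using this

namespace IsC0SemigroupGeneratedBy

variable {S T : ℝ≥0 → H →L[ℂ] H} {A : H →ₗ.[ℂ] H}

theorem comm (hS : IsC0SemigroupGeneratedBy S A) (s t : ℝ≥0) (f : H) :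
    S s (S t f) = S t (S s f) := by
  have h1 := hS.map_add s t
  rw [add_comm, hS.map_add t s] at h1
  exact (DFunLike.congr_fun h1 f).symm

theorem apply_mem_graph (hS : IsC0SemigroupGeneratedBy S A) {f h : H} (hf : (f, h) ∈ A.graph)
    (s : ℝ≥0) : (S s f, S s h) ∈ A.graph := by
  rw [hS.generator] at hf ⊢
  refine (((S s).continuous.tendsto h).comp hf).congr fun ε => ?_
  simp [hS.comm s ε f]

/-- The increment from `s` to `z` factors as `S s` applied to the increment from `0` to `z - s`, so
differentiability at `0` from the right propagates. -/
theorem hasDerivWithinAt (hS : IsC0SemigroupGeneratedBy S A) {f h : H} (hf : (f, h) ∈ A.graph)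
    {s : ℝ} (hs : 0 ≤ s) :
    HasDerivWithinAt (fun z : ℝ => S z.toNNReal f) (S s.toNNReal h) (Set.Ici s) s := by
  rw [hasDerivWithinAt_iff_tendsto_slope, Set.Ici_sdiff_left]
  have h1 : Tendsto (fun z : ℝ => (z - s).toNNReal) (𝓝[>] s) (𝓝[>] 0) := by
    refine tendsto_nhdsWithin_iff.mpr ⟨?_, ?_⟩
    · have : Continuous fun z : ℝ => (z - s).toNNReal := by fun_prop
      have h2 := (this.tendsto s).mono_left (nhdsWithin_le_nhds (s := Set.Ioi s))
      simpa using h2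
    · filter_upwards [self_mem_nhdsWithin] with z hz
      simpa using hz
  refine ((((S s.toNNReal).continuous.tendsto h).comp ((hS.generator f h).mp hf)).comp h1).congr' ?_
  filter_upwards [self_mem_nhdsWithin] with z (hz : s < z)
  have h3 : z.toNNReal = s.toNNReal + (z - s).toNNReal := by
    rw [← Real.toNNReal_add hs (by linarith)]; congr 1; ring
  simp only [Function.comp, slope, vsub_eq_sub, map_smul, map_sub]
  rw [h3, hS.map_add, Real.coe_toNNReal _ (by linarith : 0 ≤ z - s)]
  simp only [ContinuousLinearMap.comp_apply]
  exact (Complex.coe_smul _ _)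

/-- A strongly continuous semigroup is determined by its generator, if that is densely defined
and bounded above. -/
theorem eq (hS : IsC0SemigroupGeneratedBy S A) (hT : IsC0SemigroupGeneratedBy T A) (c : ℝ)
    (hc : ∀ f h, (f, h) ∈ A.graph → (inner ℂ f h).re ≤ c * ‖f‖ ^ 2)
    (hd : Dense (A.domain : Set H)) : S = T := by
  funext t
  refine ContinuousLinearMap.ext_on (f := S t) (g := T t)
    (hd.mono Submodule.subset_span) fun f hf => ?_
  obtain ⟨h, hh⟩ : ∃ h, (f, h) ∈ A.graph := ⟨A ⟨f, hf⟩, A.mem_graph ⟨f, hf⟩⟩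
  -- The difference `w` of two orbits starts at `0` and satisfies `w' = A w` from the right, so the
  -- derivative of `‖w‖ ^ 2` is `2 Re ⟪w, A w⟫ ≤ 2 c ‖w‖ ^ 2`.
  set w : ℝ → H := fun z => S z.toNNReal f - T z.toNNReal f with hw
  have hw' : ∀ s, 0 ≤ s → HasDerivWithinAt w (S s.toNNReal h - T s.toNNReal h) (Set.Ici s) s :=
    fun s hs => (hS.hasDerivWithinAt hh hs).sub (hT.hasDerivWithinAt hh hs)
  have hwc : Continuous w := by
    have h1 := (hS.continuous f).comp continuous_real_toNNReal
    have h2 := (hT.continuous f).comp continuous_real_toNNReal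
    exact h1.sub h2
  have hslope : ∀ s, 0 ≤ s → ∀ r, 2 * (inner ℂ (w s) (S s.toNNReal h - T s.toNNReal h)).re < r →
      ∃ᶠ z in 𝓝[>] s, (z - s)⁻¹ * (‖w z‖ ^ 2 - ‖w s‖ ^ 2) < r := by
    intro s hs r hr
    have h1 := hasDerivWithinAt_norm_sq_complex (hw' s hs)
    refine (h1.liminf_right_slope_le hr).mono fun z hz => ?_
    rwa [slope_def_field, div_eq_inv_mul] at hz
  have key : ‖w t‖ ^ 2 ≤ 0 := nonpos_of_deriv_right_le (f := fun s => ‖w s‖ ^ 2) (by fun_prop)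
    hslope (by simp [hw, hS.map_zero, hT.map_zero])
    (fun s hs => by
      have h1 := hc _ _ (A.graph.sub_mem (hS.apply_mem_graph hh s.toNNReal)
        (hT.apply_mem_graph hh s.toNNReal))
      change 2 * (inner ℂ (w s) _).re ≤ 2 * c * ‖w s‖ ^ 2
      change (inner ℂ (w s) _).re ≤ c * ‖w s‖ ^ 2 at h1
      linarith) t.2
  have h0 : w t = 0 := by
    have : ‖w t‖ ^ 2 = 0 := le_antisymm key (sq_nonneg _)
    simpa [gronwallBound_ε0_δ0] using this
  simpa [hw, sub_eq_zero] using h0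

end IsC0SemigroupGeneratedBy

end Uniqueness

/-! ### The semigroup generated by `l - R⁻¹` -/

section Resolvent

variable {H : Type*} [NormedAddCommGroup H] [InnerProductSpace ℂ H] [CompleteSpace H]
variable {R : H →L[ℂ] H} (hR : R.IsPositive)
include hR

/-- For a symmetric operator the orthogonal complement of the range is the kernel. -/
theorem denseRange_of_isPositive (hinj : ∀ k, R k = 0 → k = 0) : DenseRange R := by
  have : (LinearMap.range (R : H →ₗ[ℂ] H)).topologicalClosure = ⊤ := by
    rw [Submodule.topologicalClosure_eq_top_iff, Submodule.eq_bot_iff]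
    intro x hx
    refine hinj x (ext_inner_left ℂ fun y => ?_)
    rw [inner_zero_right]
    exact (hR.isSymmetric y x).symm.trans (hx _ ⟨y, rfl⟩)
  have h2 := (Submodule.dense_iff_topologicalClosure_eq_top).mpr this
  exact h2

/-- On the dense range of `R` the second-order bound gives an error of size `t ‖k'‖`. The
first-order bound makes the operators `t⁻¹ R (heatOp R t - 1)` uniformly contractive, so the limit
extends to all `k`. No domain condition is needed, since one factor `R` has been kept. -/
theorem tendsto_heatOp_slope (hinj : ∀ k, R k = 0 → k = 0) (k : H) :
    Tendsto (fun t : ℝ => t⁻¹ • (R (heatOp R t k) - R k)) (𝓝[>] 0) (𝓝 (-k)) := by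
  rw [Metric.tendsto_nhds]
  intro ε hε
  obtain ⟨k', hk'⟩ := (denseRange_of_isPositive hR hinj).exists_dist_lt k (show 0 < ε / 4 by positivity)
  have hlim : Tendsto (fun t : ℝ => t * ‖k'‖) (𝓝[>] 0) (𝓝 0) := by
    have : Continuous fun t : ℝ => t * ‖k'‖ := by fun_prop
    simpa using (this.tendsto 0).mono_left nhdsWithin_le_nhds
  filter_upwards [self_mem_nhdsWithin, hlim.eventually (gt_mem_nhds (show 0 < ε / 2 by positivity))]
    with t (ht : 0 < t) ht2
  have h1 := norm_mul_heatOp_sub_le hR le_rfl ht.le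
  have h2 := norm_sq_mul_heatOp_sub_le hR le_rfl ht.le
  rw [heatOp_zero hR, sub_zero] at h1 h2
  have h3 : ‖t⁻¹ • (R * (heatOp R t - 1)) (k - R k')‖ ≤ ε / 4 := by
    rw [norm_smul, Real.norm_of_nonneg (by positivity)]
    calc t⁻¹ * ‖(R * (heatOp R t - 1)) (k - R k')‖ ≤ t⁻¹ * (t * (ε / 4)) := by
          gcongr
          refine (ContinuousLinearMap.le_opNorm _ _).trans ?_
          gcongr
          rw [← dist_eq_norm]; exact hk'.le
      _ = ε / 4 := by field_simp
  have h4 : ‖t⁻¹ • (R * (R * (heatOp R t - 1)) + t • (R * 1)) k'‖ ≤ t * ‖k'‖ := by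
    rw [norm_smul, Real.norm_of_nonneg (by positivity)]
    calc t⁻¹ * _ ≤ t⁻¹ * (t ^ 2 * ‖k'‖) := by
          gcongr
          refine (ContinuousLinearMap.le_opNorm _ _).trans ?_
          gcongr
      _ = t * ‖k'‖ := by field_simp
  have h5 : t⁻¹ • (R (heatOp R t k) - R k) - -k = t⁻¹ • (R * (heatOp R t - 1)) (k - R k')
      + t⁻¹ • (R * (R * (heatOp R t - 1)) + t • (R * 1)) k' + (k - R k') := by
    have h6 : heatOp R t (R k') = R (heatOp R t k') :=
      DFunLike.congr_fun (heatOp_mul hR ht.le) k'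
    simp only [mul_apply_eq_comp, _root_.add_apply,
      _root_.sub_apply, one_apply_eq_self, map_sub, h6, smul_add, smul_sub,
      _root_.smul_apply, smul_smul, inv_mul_cancel₀ ht.ne', one_smul]
    abel
  rw [dist_eq_norm, h5]
  have h7 : ‖k - R k'‖ < ε / 4 := by rw [← dist_eq_norm]; exact hk'
  calc _ ≤ ε / 4 + t * ‖k'‖ + ‖k - R k'‖ := norm_add_le_of_le (norm_add_le_of_le h3 h4) le_rfl
    _ < ε := by linarith

theorem tendsto_exp_smul_heatOp_slope (hinj : ∀ k, R k = 0 → k = 0) (l : ℝ) (k : H) :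
    Tendsto (fun t : ℝ => t⁻¹ • (Real.exp (l * t) • R (heatOp R t k) - R k)) (𝓝[>] 0)
      (𝓝 (-k + l • R k)) := by
  have h1 : Tendsto (fun t : ℝ => Real.exp (l * t)) (𝓝[>] 0) (𝓝 1) := by
    have : Continuous fun t : ℝ => Real.exp (l * t) := by fun_prop
    simpa using (this.tendsto 0).mono_left (nhdsWithin_le_nhds (s := Set.Ioi 0))
  have h2 : Tendsto (fun t : ℝ => t⁻¹ * (Real.exp (l * t) - 1)) (𝓝[>] 0) (𝓝 l) := by
    have : HasDerivAt (fun t : ℝ => Real.exp (l * t)) l 0 := by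
      simpa using ((hasDerivAt_id (0 : ℝ)).const_mul l).exp
    have h3 := (hasDerivAt_iff_tendsto_slope.mp this).mono_left
      (nhdsWithin_mono 0 (fun x (hx : x ∈ Set.Ioi (0 : ℝ)) => ne_of_gt hx))
    refine h3.congr fun t => ?_
    simp [slope]
  have h3 := (h1.smul (tendsto_heatOp_slope hR hinj k)).add (h2.smul_const (R k))
  rw [one_smul] at h3
  refine h3.congr fun t => ?_
  module

/-- Orbits of vectors in the range of `R` are Lipschitz in time; contractivity makes the
approximation of a general orbit by these uniform in time. -/
theorem continuous_heatOp_apply (hinj : ∀ k, R k = 0 → k = 0) (f : H) :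
    Continuous fun t : ℝ≥0 => heatOp R t f := by
  refine continuous_of_uniform_approx_of_continuous fun u hu => ?_
  obtain ⟨ε, hε, hu⟩ := Metric.mem_uniformity_dist.mp hu
  obtain ⟨k, hk⟩ := (denseRange_of_isPositive hR hinj).exists_dist_lt f hε
  refine ⟨fun t => heatOp R t (R k), ?_, fun t => hu ?_⟩
  · refine (LipschitzWith.of_dist_le_mul (K := ‖k‖₊) fun s t => ?_).continuous
    wlog hst : s ≤ t generalizing s t
    · rw [dist_comm, dist_comm s t]; exact this t s (le_of_not_ge hst)
    have h6 : ∀ t : ℝ≥0, heatOp R t (R k) = R (heatOp R t k) := fun t =>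
      DFunLike.congr_fun (heatOp_mul hR t.2) k
    rw [dist_comm, dist_eq_norm, h6, h6, ← map_sub, ← _root_.sub_apply,
      ← mul_apply_eq_comp, dist_comm, NNReal.dist_eq,
      abs_of_nonneg (sub_nonneg.mpr (NNReal.coe_le_coe.mpr hst)), mul_comm, coe_nnnorm]
    refine (ContinuousLinearMap.le_opNorm _ _).trans ?_
    exact mul_le_mul_of_nonneg_right (norm_mul_heatOp_sub_le hR s.2 hst) (norm_nonneg k)
  · rw [dist_eq_norm, ← map_sub]
    calc _ ≤ ‖heatOp R t‖ * ‖f - R k‖ := ContinuousLinearMap.le_opNorm _ _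
      _ ≤ 1 * ‖f - R k‖ := by gcongr; exact norm_heatOp_le hR t.2
      _ < ε := by rw [one_mul, ← dist_eq_norm]; exact hk

/-- If `R` is positive and injective, then `exp (t (l - R⁻¹))` is a strongly continuous semigroup
with generator `l - R⁻¹`. -/
theorem isC0SemigroupGeneratedBy_heatOp (hinj : ∀ k, R k = 0 → k = 0) (l : ℝ) (A : H →ₗ.[ℂ] H)
    (hA : ∀ f h, (f, h) ∈ A.graph ↔ R (l • f - h) = f) :
    IsC0SemigroupGeneratedBy (fun t : ℝ≥0 => Real.exp (l * t) • heatOp R t) A where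
  map_zero := by simp [heatOp_zero hR]; rfl
  map_add s t := by
    rw [NNReal.coe_add, mul_add, Real.exp_add]
    have := heatOp_add hR s.2 t.2
    ext f
    rw [show heatOp R (s + t) = _ from this]
    simp [smul_smul, mul_comm]
  continuous f := by
    have := continuous_heatOp_apply hR hinj f
    simp only [_root_.smul_apply]
    fun_prop
  generator f h := by
    have hcoe : Tendsto (fun t : ℝ≥0 => (t : ℝ)) (𝓝[>] 0) (𝓝[>] 0) := by
      refine tendsto_nhdsWithin_iff.mpr ⟨?_, ?_⟩
      · exact (NNReal.continuous_coe.tendsto 0).mono_left nhdsWithin_le_nhds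
      · filter_upwards [self_mem_nhdsWithin] with z hz
        exact hz
    have hcomm : ∀ (t : ℝ≥0) k, heatOp R t (R k) = R (heatOp R t k) := fun t k =>
      DFunLike.congr_fun (heatOp_mul hR t.2) k
    rw [hA]
    constructor
    · intro hf
      have h1 := (tendsto_exp_smul_heatOp_slope hR hinj l (l • f - h)).comp hcoe
      rw [show -(l • f - h) + l • R (l • f - h) = h by rw [hf]; abel] at h1
      refine h1.congr fun t => ?_
      rw [Complex.coe_smul, Function.comp_apply, _root_.smul_apply, ← hcomm, hf]
    · intro hf
      -- Conversely, if the slope at `f` converges to `h`, applying `R` gives the limit `R h`, while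
      -- the regularised slope converges to `-f + l • R f`. Equating the two puts `(f, h)` in the
      -- graph, so the domain of the generator is not larger.
      have h1 := (tendsto_exp_smul_heatOp_slope hR hinj l f).comp hcoe
      have h2 := (R.continuous.tendsto h).comp hf
      have h3 := tendsto_nhds_unique (h1.congr fun t => ?_) h2
      · rw [map_sub, ← h3, ContinuousLinearMap.map_smul_of_tower]; abel
      · simp only [Function.comp_apply]
        rw [Complex.coe_smul, _root_.smul_apply, R.map_smul_of_tower, map_sub,
          R.map_smul_of_tower]

end Resolvent

/-! ### Strong convergence of resolvents and of semigroups -/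

section StrongConvergence

variable {H : Type*} [NormedAddCommGroup H] [InnerProductSpace ℂ H]
variable {ι : Type*} {l : Filter ι} {R : H →L[ℂ] H} {S : ι → H →L[ℂ] H}

theorem tendsto_clm_apply_of_norm_le (hS : ∀ i, ‖S i‖ ≤ 1)
    (hlim : ∀ f, Tendsto (fun i => S i f) l (𝓝 (R f))) {g : ι → H} {k : H}
    (hg : Tendsto g l (𝓝 k)) : Tendsto (fun i => S i (g i)) l (𝓝 (R k)) := by
  have h1 : Tendsto (fun i => S i (g i - k)) l (𝓝 0) := by
    refine squeeze_zero_norm (fun i => ?_) (tendsto_iff_norm_sub_tendsto_zero.mp hg)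
    calc _ ≤ ‖S i‖ * ‖g i - k‖ := (S i).le_opNorm _
      _ ≤ 1 * ‖g i - k‖ := by gcongr; exact hS i
      _ = _ := one_mul _
  have h2 := h1.add (hlim k)
  simpa using h2

/-- The uniform norm bound makes strong convergence compatible with products, hence with powers. -/
theorem tendsto_aeval_apply (hS : ∀ i, ‖S i‖ ≤ 1)
    (hlim : ∀ f, Tendsto (fun i => S i f) l (𝓝 (R f))) (p : Polynomial ℝ) (f : H) :
    Tendsto (fun i => Polynomial.aeval (S i) p f) l (𝓝 (Polynomial.aeval R p f)) := by
  induction p using Polynomial.induction_on' with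
  | add p q hp hq => simpa using hp.add hq
  | monomial n a =>
    have : ∀ n, Tendsto (fun i => (S i ^ n) f) l (𝓝 ((R ^ n) f)) := by
      intro n
      induction n with
      | zero => simpa using tendsto_const_nhds
      | succ n ih =>
        simp only [pow_succ', mul_apply_eq_comp]
        exact tendsto_clm_apply_of_norm_le hS hlim ih
    have h2 : ∀ T : H →L[ℂ] H, Polynomial.aeval T (Polynomial.monomial n a) f = a • (T ^ n) f := by
      intro T
      rw [Polynomial.aeval_monomial, Algebra.algebraMap_eq_smul_one]
      simp
    simp only [h2]
    exact (this n).const_smul a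

variable [CompleteSpace H]

theorem ContinuousLinearMap.IsPositive.spectrum_subset (hR : R.IsPositive) (hR1 : ‖R‖ ≤ 1) :
    spectrum ℝ R ⊆ Set.Icc 0 1 := fun r hr => by
  refine ⟨hR.spectrum_nonneg hr, ?_⟩
  have h1 := spectrum.norm_le_norm_mul_of_mem hr
  have h2 : ‖R‖ * ‖(1 : H →L[ℂ] H)‖ ≤ 1 * 1 := by
    gcongr; exact ContinuousLinearMap.norm_id_le
  exact (le_abs_self r).trans (by simpa using h1.trans h2)

/-- Strong convergence of resolvents implies strong convergence of the semigroups. -/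
theorem tendsto_heatOp_apply (hRp : R.IsPositive) (hR1 : ‖R‖ ≤ 1) (hSp : ∀ i, (S i).IsPositive)
    (hS : ∀ i, ‖S i‖ ≤ 1) (hlim : ∀ f, Tendsto (fun i => S i f) l (𝓝 (R f)))
    {t : ℝ} (ht : 0 ≤ t) (f : H) :
    Tendsto (fun i => heatOp (S i) t f) l (𝓝 (heatOp R t f)) := by
  rw [Metric.tendsto_nhds]
  intro ε hε
  -- All spectra lie in `[0, 1]`, so a single polynomial close to `heat t` on `[0, 1]` serves every
  -- operator at once. The error is split in three, and the `+ 1` avoids dividing by zero when `f =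
  -- 0`.
  set δ : ℝ := ε / (3 * (‖f‖ + 1)) with hδ
  have hδ0 : 0 < δ := by positivity
  obtain ⟨p, hp⟩ := exists_polynomial_near_of_continuousOn 0 1 (heat t)
    (continuous_heat t ht).continuousOn δ hδ0
  have key : ∀ T : H →L[ℂ] H, T.IsPositive → ‖T‖ ≤ 1 →
      ‖heatOp T t f - Polynomial.aeval T p f‖ < ε / 3 := by
    intro T hT hT1
    have hsa := hT.isSelfAdjoint
    have h1 : ‖heatOp T t - Polynomial.aeval T p‖ ≤ δ := by
      rw [heatOp, ← cfc_polynomial p T hsa, ← cfc_sub _ _ T (continuous_heat t ht).continuousOn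
        (by fun_prop)]
      refine norm_cfc_le hδ0.le fun r hr => ?_
      rw [norm_sub_rev]
      exact (hp r (hT.spectrum_subset hT1 hr)).le
    rw [← _root_.sub_apply]
    calc _ ≤ δ * ‖f‖ := (ContinuousLinearMap.le_opNorm _ _).trans (by gcongr)
      _ < δ * (‖f‖ + 1) := by gcongr; linarith
      _ = ε / 3 := by rw [hδ]; field_simp
  filter_upwards [(Metric.tendsto_nhds.mp (tendsto_aeval_apply hS hlim p f)) (ε / 3)
    (by positivity)] with i hi
  have h1 := key (S i) (hSp i) (hS i)
  have h2 := key R hRp hR1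
  rw [dist_eq_norm] at hi ⊢
  calc _ = ‖(heatOp (S i) t f - Polynomial.aeval (S i) p f)
      + (Polynomial.aeval (S i) p f - Polynomial.aeval R p f)
      - (heatOp R t f - Polynomial.aeval R p f)‖ := by congr 1; abel
    _ ≤ _ := norm_sub_le_of_le (norm_add_le_of_le le_rfl le_rfl) le_rfl
    _ < ε := by linarith

end StrongConvergence

/-! ### Resolvents built from a form domain, and their approximation by subspaces -/

section FormResolvent

variable {V H : Type*} [NormedAddCommGroup V] [InnerProductSpace ℂ V] [CompleteSpace V]
  [NormedAddCommGroup H] [InnerProductSpace ℂ H] [CompleteSpace H]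

/-- For the inclusion `J` of a form domain `V` into `H`, the inverse of the operator associated
with the restriction of the form to a subspace `U`. -/
noncomputable def formResolvent (J : V →L[ℂ] H) (U : Submodule ℂ V) [U.HasOrthogonalProjection] :
    H →L[ℂ] H :=
  J ∘L U.starProjection ∘L J.adjoint

variable (J : V →L[ℂ] H) (U : Submodule ℂ V) [U.HasOrthogonalProjection]

theorem formResolvent_isPositive : (formResolvent J U).IsPositive :=
  (ContinuousLinearMap.IsPositive.of_isStarProjection isStarProjection_starProjection).conj_adjoint J

theorem norm_formResolvent_le (hJ : ‖J‖ ≤ 1) : ‖formResolvent J U‖ ≤ 1 := by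
  have hJ' : ‖J.adjoint‖ ≤ 1 := by rwa [LinearIsometryEquiv.norm_map]
  calc _ ≤ ‖J‖ * (‖U.starProjection‖ * ‖J.adjoint‖) :=
        (J.opNorm_comp_le _).trans (by gcongr; exact ContinuousLinearMap.opNorm_comp_le _ _)
    _ ≤ 1 * (1 * 1) := by gcongr; exact U.starProjection_norm_le
    _ = 1 := by norm_num

/-- With the form as scalar product of `V`, the vector `P_U J* f` is the Riesz representative in `U`
of the functional given by `f`; this is the weak equation tested on `U`. -/
theorem exists_formResolvent_eq (f : H) : ∃ u ∈ U, formResolvent J U f = J u ∧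
    ∀ e ∈ U, inner ℂ e u = inner ℂ (J e) f := by
  refine ⟨U.starProjection (J.adjoint f), U.starProjection_apply_mem _, rfl, fun e he => ?_⟩
  rw [← J.adjoint_inner_right, ← U.inner_starProjection_left_eq_right,
    U.starProjection_eq_self_iff.mpr he]

/-- Orthogonal projections onto increasing subspaces with dense union converge strongly to the
identity. This is the passage from finite sets of vertices to the whole graph. -/
theorem tendsto_formResolvent {ι : Type*} [Preorder ι] (W : ι → Submodule ℂ V)
    [∀ i, (W i).HasOrthogonalProjection] (hW : Monotone W)
    (hW' : ⊤ ≤ (⨆ i, W i).topologicalClosure) (f : H) :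
    Tendsto (fun i => formResolvent J (W i) f) atTop (𝓝 (formResolvent J ⊤ f)) := by
  have := Submodule.starProjection_tendsto_self W hW (J.adjoint f) hW'
  have h2 := (J.continuous.tendsto _).comp this
  rw [show formResolvent J ⊤ f = J (J.adjoint f) by
    change J ((⊤ : Submodule ℂ V).starProjection (J.adjoint f)) = _
    rw [Submodule.starProjection_eq_self_iff.mpr Submodule.mem_top]]
  exact h2

end FormResolvent

/-! ### The self-adjoint operator `R⁻¹ - l` -/

section InverseOperator

variable {H : Type*} [NormedAddCommGroup H] [InnerProductSpace ℂ H] [CompleteSpace H]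
variable {R : H →L[ℂ] H} (hR : R.IsPositive) (hinj : ∀ k, R k = 0 → k = 0) (l : ℝ)

omit [CompleteSpace H] in
include hinj in
-- The relation on the right is a subspace of `H × H`, and injectivity of `R` is what makes it
-- single-valued.
theorem exists_inverse_sub : ∃ A : H →ₗ.[ℂ] H, ∀ f h, (f, h) ∈ A.graph ↔ R (l • f + h) = f := by
  let B : H × H →ₗ[ℂ] H := (R : H →ₗ[ℂ] H) ∘ₗ ((l : ℂ) • LinearMap.fst ℂ H H + LinearMap.snd ℂ H H)
    - LinearMap.fst ℂ H H
  refine ⟨(LinearMap.ker B).toLinearPMap, fun f h => ?_⟩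
  have hmem : ∀ f h, (f, h) ∈ LinearMap.ker B ↔ R (l • f + h) = f := by
    intro f h
    rw [LinearMap.mem_ker]
    simp [B, sub_eq_zero]
  rw [Submodule.toLinearPMap_graph_eq, hmem]
  rintro ⟨f, h⟩ hx (rfl : f = 0)
  rw [hmem] at hx
  exact hinj h (by simpa using hx)

include hR hinj in
theorem dense_domain_of_graph {A : H →ₗ.[ℂ] H}
    (hA : ∀ f h, (f, h) ∈ A.graph ↔ R (l • f + h) = f) : Dense (A.domain : Set H) := by
  refine (denseRange_of_isPositive hR hinj).mono ?_
  rintro _ ⟨k, rfl⟩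
  have : (R k, k - l • R k) ∈ A.graph := by rw [hA]; congr 1; abel
  exact A.mem_domain_of_mem_graph this

include hR hinj in
-- The pairs `(R k, k - l • R k)` lie in the graph. Orthogonality to them turns membership in the
-- adjoint graph into `R (l • x + y) = x`, by symmetry of `R`.
theorem isSelfAdjoint_of_graph {A : H →ₗ.[ℂ] H}
    (hA : ∀ f h, (f, h) ∈ A.graph ↔ R (l • f + h) = f) : IsSelfAdjoint A := by
  rw [LinearPMap.isSelfAdjoint_def]
  refine LinearPMap.eq_of_eq_graph ?_
  rw [LinearPMap.adjoint_graph_eq_graph_adjoint (dense_domain_of_graph hR hinj l hA)]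
  ext ⟨x, y⟩
  rw [Submodule.mem_adjoint_iff, hA]
  have hsymm : ∀ a b, inner ℂ (R a) b = inner ℂ a (R b) := hR.isSymmetric
  constructor
  · intro h
    refine ext_inner_left ℂ fun k => ?_
    have h1 := h (R k) (k - l • R k) (by rw [hA]; congr 1; abel)
    rw [inner_sub_left, sub_eq_zero, ← Complex.coe_smul, inner_smul_left, Complex.conj_ofReal] at h1
    rw [← hsymm, inner_add_right, ← h1, ← Complex.coe_smul, inner_smul_right]
    ring
  · intro h a b hab
    rw [hA] at hab
    simp only
    have h1 : inner ℂ (l • a + b) x = inner ℂ a (l • x + y) := by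
      conv_lhs => rw [← h]
      conv_rhs => rw [← hab]
      rw [hsymm]
    rw [inner_add_left, inner_add_right, ← Complex.coe_smul, ← Complex.coe_smul, inner_smul_left,
      inner_smul_right, Complex.conj_ofReal] at h1
    linear_combination h1

end InverseOperator

theorem isMagneticPotential_zero {X : Type*} : IsMagneticPotential fun _ _ : X => (0 : ℝ) :=
  ⟨fun _ _ => by simp [Real.pi_pos.le], fun _ _ => by simp⟩

namespace WeightedGraph

variable {X : Type*} (G : WeightedGraph X)

/-! ### Point values in `ℓ²(X, m)` -/

section PointValues

variable [MeasurableSpace X] [DiscreteMeasurableSpace X]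

theorem measure_singleton (x : X) : G.measure {x} = ENNReal.ofReal (G.m x) := by
  rw [measure, Measure.sum_apply _ (by measurability), tsum_eq_single x]
  · simp
  · intro y hy; simp [hy]

/-- Every point has positive mass, so a null set is empty; elements of `ell2` can be treated as
functions from here on. -/
theorem eq_of_ae_eq {α : Type*} {f g : X → α} (h : f =ᵐ[G.measure] g) : f = g := by
  funext x
  by_contra hx
  have h1 : G.measure {x} ≤ 0 := by
    rw [← ae_iff.mp h]
    exact measure_mono (by simpa using hx)
  rw [measure_singleton, nonpos_iff_eq_zero, ENNReal.ofReal_eq_zero] at h1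
  exact absurd h1 (not_le.mpr (G.m_pos x))

theorem coe_add (f g : G.ell2) : ⇑(f + g) = ⇑f + ⇑g := G.eq_of_ae_eq (Lp.coeFn_add f g)

theorem coe_smul (c : ℂ) (f : G.ell2) : ⇑(c • f) = c • ⇑f := G.eq_of_ae_eq (Lp.coeFn_smul c f)

theorem coe_zero : ⇑(0 : G.ell2) = 0 := G.eq_of_ae_eq (Lp.coeFn_zero _ _ _)

/-- The indicator function of the vertex `x`. -/
noncomputable def delta (x : X) : G.ell2 :=
  indicatorConstLp 2 (measurableSet_singleton x)
    (by rw [measure_singleton]; exact ENNReal.ofReal_ne_top) 1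

theorem coe_delta (x : X) : ⇑(G.delta x) = Set.indicator {x} fun _ => (1 : ℂ) :=
  G.eq_of_ae_eq indicatorConstLp_coeFn

theorem inner_delta (x : X) (f : G.ell2) : inner ℂ (G.delta x) f = G.m x * f x := by
  rw [delta, L2.inner_indicatorConstLp_one, integral_singleton, Measure.real, measure_singleton,
    ENNReal.toReal_ofReal (G.m_pos x).le, Complex.real_smul]

/-- Evaluation at a vertex as a bounded functional. -/
noncomputable def evalCLM (x : X) : G.ell2 →L[ℂ] ℂ := ((G.m x : ℂ)⁻¹) • innerSL ℂ (G.delta x)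

theorem evalCLM_apply (x : X) (f : G.ell2) : G.evalCLM x f = f x := by
  have : (G.m x : ℂ) ≠ 0 := by exact_mod_cast (G.m_pos x).ne'
  simp only [evalCLM, _root_.smul_apply, innerSL_apply_apply, inner_delta, smul_eq_mul]
  field_simp

omit [DiscreteMeasurableSpace X] in
theorem ell2_ext {f g : G.ell2} (h : ∀ x, f x = g x) : f = g :=
  Lp.ext (Eventually.of_forall h)

/-- The embedding of the finitely supported functions. -/
noncomputable def ofFinsupp : (X →₀ ℂ) →ₗ[ℂ] G.ell2 := Finsupp.linearCombination ℂ G.delta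

theorem coe_ofFinsupp (φ : X →₀ ℂ) : ⇑(G.ofFinsupp φ) = ⇑φ := by
  classical
  induction φ using Finsupp.induction_linear with
  | zero => rw [map_zero, coe_zero]; rfl
  | add f g hf hg => rw [map_add, coe_add, hf, hg]; rfl
  | single x c =>
    rw [ofFinsupp, Finsupp.linearCombination_single, coe_smul, coe_delta]
    funext y
    simp [Finsupp.single_apply, Pi.single_apply, eq_comm]

theorem ofFinsupp_mem_Cc (φ : X →₀ ℂ) : G.ofFinsupp φ ∈ G.Cc := by
  rw [Cc, Set.mem_ofPred_eq, coe_ofFinsupp]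
  exact φ.hasFiniteSupport

theorem exists_ofFinsupp {f : G.ell2} (hf : f ∈ G.Cc) : ∃ φ, G.ofFinsupp φ = f :=
  ⟨Finsupp.ofSupportFinite f hf, G.ell2_ext fun x => by rw [coe_ofFinsupp]; rfl⟩

theorem inner_ofFinsupp (φ : X →₀ ℂ) (f : G.ell2) {S : Finset X} (hS : φ.support ⊆ S) :
    inner ℂ (G.ofFinsupp φ) f = ∑ x ∈ S, conj (φ x) * (G.m x * f x) := by
  rw [ofFinsupp, Finsupp.linearCombination_apply, Finsupp.sum, sum_inner,
    ← Finset.sum_subset hS (fun x _ hx => by simp [Finsupp.notMem_support_iff.mp hx])]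
  exact Finset.sum_congr rfl fun x _ => by rw [inner_smul_left, inner_delta]

theorem norm_sq_ofFinsupp (φ : X →₀ ℂ) {S : Finset X} (hS : φ.support ⊆ S) :
    ‖G.ofFinsupp φ‖ ^ 2 = ∑ x ∈ S, G.m x * ‖φ x‖ ^ 2 := by
  have h1 : inner ℂ (G.ofFinsupp φ) (G.ofFinsupp φ)
      = ((∑ x ∈ S, G.m x * ‖φ x‖ ^ 2 : ℝ) : ℂ) := by
    rw [G.inner_ofFinsupp φ _ hS, coe_ofFinsupp]
    push_cast
    refine Finset.sum_congr rfl fun x _ => ?_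
    rw [← Complex.conj_mul']; ring
  rw [inner_self_eq_norm_sq_to_K] at h1
  exact Complex.ofReal_injective (by simpa using h1)

end PointValues

/-! ### The form on finitely supported functions -/

section FiniteForm

variable {w : X → ℝ} {θ : X → X → ℝ}

theorem hasSum_mul_b {a : X → ℂ} {S : Finset X} (ha : ∀ x ∉ S, a x = 0) :
    HasSum (fun p : X × X => (G.b p.1 p.2 : ℂ) * a p.1) (∑ x ∈ S, (G.degOne x : ℂ) * a x) := by
  classical
  have h1 : ∀ x ∈ S, HasSum (fun p : X × X => if p.1 = x then (G.b x p.2 : ℂ) * a x else 0)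
      ((G.degOne x : ℂ) * a x) := by
    intro x _
    have hinj : Function.Injective fun y : X => (x, y) := Prod.mk_right_injective x
    refine (hinj.hasSum_iff ?_).mp ?_
    · rintro ⟨y, z⟩ hy
      rw [if_neg]
      rintro rfl
      exact hy ⟨z, rfl⟩
    · simp only [Function.comp_def, if_true]
      exact ((Complex.hasSum_ofReal.mpr (G.b_summable x).hasSum)).mul_right _
  refine (hasSum_sum h1).congr_fun ?_
  rintro ⟨x, y⟩
  by_cases hx : x ∈ S
  · rw [Finset.sum_eq_single_of_mem x hx]
    · simp
    · intro z _ hz; rw [if_neg]; exact fun h => hz h.symm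
  · rw [Finset.sum_eq_zero]
    · simp [ha x hx]
    · intro z hz; rw [if_neg]; rintro rfl; exact hx hz

/-- Expanding the product gives two families and their images under exchanging `x` and `y`. Symmetry
of `b` and antisymmetry of `θ` identify them, whence the factor `2`. The diagonal family runs over
infinitely many edges and converges because the degrees are finite; the cross terms are finite sums.
-/
theorem hasSum_form (hθ : IsMagneticPotential θ) {f g : X → ℂ} {S : Finset X}
    (hf : ∀ x ∉ S, f x = 0) (hg : ∀ x ∉ S, g x = 0) :
    HasSum (fun p : X × X => (G.b p.1 p.2 : ℂ)
      * (f p.1 - Complex.exp (Complex.I * (θ p.1 p.2 : ℂ)) * f p.2)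
      * conj (g p.1 - Complex.exp (Complex.I * (θ p.1 p.2 : ℂ)) * g p.2))
      (2 * (∑ x ∈ S, (G.degOne x : ℂ) * (f x * conj (g x)) - ∑ x ∈ S, ∑ y ∈ S,
        (G.b x y : ℂ) * Complex.exp (Complex.I * (θ x y : ℂ)) * f y * conj (g x))) := by
  have hA := G.hasSum_mul_b (a := fun x => f x * conj (g x)) (S := S)
    (fun x hx => by simp [hf x hx])
  have hC : HasSum (fun p : X × X =>
      (G.b p.1 p.2 : ℂ) * Complex.exp (Complex.I * (θ p.1 p.2 : ℂ)) * f p.2 * conj (g p.1))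
      (∑ x ∈ S, ∑ y ∈ S,
        (G.b x y : ℂ) * Complex.exp (Complex.I * (θ x y : ℂ)) * f y * conj (g x)) := by
    rw [← Finset.sum_product']
    refine hasSum_sum_of_ne_finset_zero ?_
    rintro ⟨x, y⟩ hxy
    rw [Finset.mem_product, not_and_or] at hxy
    rcases hxy with h | h
    · simp [hg x h]
    · simp [hf y h]
  have hB := (Equiv.prodComm X X).hasSum_iff.mpr hA
  have hD := (Equiv.prodComm X X).hasSum_iff.mpr hC
  have h := (hA.add hB).sub (hC.add hD)
  rw [two_mul, sub_add_sub_comm]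
  refine h.congr_fun ?_
  · rintro ⟨x, y⟩
    simp only [Function.comp_apply, Equiv.prodComm_apply, Prod.swap, map_sub, map_mul]
    rw [G.b_symm y x, hθ.antisymm y x, ← Complex.exp_conj]
    have h1 : conj (Complex.I * (θ x y : ℂ)) = Complex.I * ((-θ x y : ℝ) : ℂ) := by simp
    have h2 : Complex.exp (Complex.I * (θ x y : ℂ)) * Complex.exp (Complex.I * ((-θ x y : ℝ) : ℂ))
        = 1 := by
      rw [← Complex.exp_add]; simp
    rw [h1]
    linear_combination (G.b x y : ℂ) * f y * conj (g y) * h2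

theorem form_eq (hθ : IsMagneticPotential θ) {f g : X → ℂ} {S : Finset X}
    (hf : ∀ x ∉ S, f x = 0) (hg : ∀ x ∉ S, g x = 0) :
    G.form w θ f g = ∑ x ∈ S, ((G.degOne x + w x * G.m x : ℝ) : ℂ) * (f x * conj (g x))
      - ∑ x ∈ S, ∑ y ∈ S,
        (G.b x y : ℂ) * Complex.exp (Complex.I * (θ x y : ℂ)) * f y * conj (g x) := by
  rw [form, (G.hasSum_form hθ hf hg).tsum_eq, potentialForm, tsum_eq_sum (s := S)]
  · push_cast
    simp only [add_mul, Finset.sum_add_distrib]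
    have : ∑ x ∈ S, (w x : ℂ) * f x * conj (g x) * (G.m x : ℂ)
        = ∑ x ∈ S, (w x : ℂ) * (G.m x : ℂ) * (f x * conj (g x)) :=
      Finset.sum_congr rfl fun x _ => by ring
    rw [this]; ring
  · intro x hx; simp [hf x hx]

theorem form_add_left (hθ : IsMagneticPotential θ) (φ ψ χ : X →₀ ℂ) :
    G.form w θ ⇑(φ + ψ) χ = G.form w θ φ χ + G.form w θ ψ χ := by
  classical
  set S := φ.support ∪ ψ.support ∪ χ.support
  have h1 : ∀ x ∉ S, φ x = 0 := fun x hx => by simp [S] at hx; exact hx.1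
  have h2 : ∀ x ∉ S, ψ x = 0 := fun x hx => by simp [S] at hx; exact hx.2.1
  have h3 : ∀ x ∉ S, χ x = 0 := fun x hx => by simp [S] at hx; exact hx.2.2
  rw [G.form_eq hθ h1 h3, G.form_eq hθ h2 h3,
    G.form_eq hθ (S := S) (fun x hx => by simp [h1 x hx, h2 x hx]) h3, sub_add_sub_comm,
    ← Finset.sum_add_distrib, ← Finset.sum_add_distrib]
  simp only [← Finset.sum_add_distrib, Finsupp.add_apply]
  congr 1
  · exact Finset.sum_congr rfl fun x _ => by ring
  · exact Finset.sum_congr rfl fun x _ => Finset.sum_congr rfl fun y _ => by ring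

theorem form_smul_left (hθ : IsMagneticPotential θ) (c : ℂ) (φ χ : X →₀ ℂ) :
    G.form w θ ⇑(c • φ) χ = c * G.form w θ φ χ := by
  classical
  set S := φ.support ∪ χ.support
  have h1 : ∀ x ∉ S, φ x = 0 := fun x hx => by simp [S] at hx; exact hx.1
  have h3 : ∀ x ∉ S, χ x = 0 := fun x hx => by simp [S] at hx; exact hx.2
  rw [G.form_eq hθ h1 h3, G.form_eq hθ (S := S) (fun x hx => by simp [h1 x hx]) h3, mul_sub,
    Finset.mul_sum, Finset.mul_sum]
  simp only [Finset.mul_sum, Finsupp.smul_apply, smul_eq_mul]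
  congr 1
  · exact Finset.sum_congr rfl fun x _ => by ring
  · exact Finset.sum_congr rfl fun x _ => Finset.sum_congr rfl fun y _ => by ring

theorem conj_form (hθ : IsMagneticPotential θ) (φ χ : X →₀ ℂ) :
    conj (G.form w θ φ χ) = G.form w θ χ φ := by
  classical
  set S := φ.support ∪ χ.support
  have h1 : ∀ x ∉ S, φ x = 0 := fun x hx => by simp [S] at hx; exact hx.1
  have h3 : ∀ x ∉ S, χ x = 0 := fun x hx => by simp [S] at hx; exact hx.2
  rw [G.form_eq hθ h1 h3, G.form_eq hθ h3 h1, map_sub, map_sum, map_sum]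
  congr 1
  · exact Finset.sum_congr rfl fun x _ => by
      simp only [map_mul, Complex.conj_ofReal, Complex.conj_conj]; ring
  · simp only [map_sum]
    rw [Finset.sum_comm]
    refine Finset.sum_congr rfl fun x _ => Finset.sum_congr rfl fun y _ => ?_
    simp only [map_mul, Complex.conj_ofReal, Complex.conj_conj, ← Complex.exp_conj]
    rw [hθ.antisymm x y, G.b_symm x y]
    simp only [Complex.conj_I, Complex.ofReal_neg, neg_mul, mul_neg]
    ring

/-- The diamagnetic inequality on finitely supported functions. -/
theorem form_abs_le (hθ : IsMagneticPotential θ) (φ ψ : X →₀ ℂ) (hψ : ∀ x, ψ x = ‖φ x‖) :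
    (G.form w (fun _ _ => 0) ψ ψ).re ≤ (G.form w θ φ φ).re := by
  have h1 : ∀ x ∉ φ.support, φ x = 0 := fun x hx => by simpa using hx
  have h2 : ∀ x ∉ φ.support, ψ x = 0 := fun x hx => by simp [hψ, h1 x hx]
  rw [G.form_eq hθ h1 h1, G.form_eq isMagneticPotential_zero h2 h2, Complex.sub_re, Complex.sub_re,
    Complex.re_sum, Complex.re_sum, Complex.re_sum, Complex.re_sum]
  -- The diagonal parts of both forms coincide, and off the diagonal the phase is removed by `Re z ≤
  -- |z|`.
  refine sub_le_sub (le_of_eq (Finset.sum_congr rfl fun x _ => ?_))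
    (Finset.sum_le_sum fun x _ => ?_)
  · rw [Complex.mul_conj, Complex.mul_conj, Complex.normSq_eq_norm_sq, Complex.normSq_eq_norm_sq,
      hψ]
    simp
  · rw [Complex.re_sum, Complex.re_sum]
    refine Finset.sum_le_sum fun y _ => ?_
    refine (Complex.re_le_norm _).trans (le_of_eq ?_)
    rw [hψ, hψ]
    simp only [norm_mul, Complex.norm_exp_I_mul_ofReal, Complex.norm_conj, Complex.norm_real,
      Real.norm_of_nonneg (G.b_nonneg x y), Complex.ofReal_zero, mul_zero, Complex.exp_zero,
      Complex.conj_ofReal, mul_one, ← Complex.ofReal_mul, Complex.ofReal_re]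

theorem form_add_const (hθ : IsMagneticPotential θ) [MeasurableSpace X] [DiscreteMeasurableSpace X]
    (c : ℝ) (φ χ : X →₀ ℂ) :
    G.form (fun x => w x + c) θ φ χ
      = G.form w θ φ χ + c * inner ℂ (G.ofFinsupp χ) (G.ofFinsupp φ) := by
  classical
  set S := φ.support ∪ χ.support
  have h1 : ∀ x ∉ S, φ x = 0 := fun x hx => by simp [S] at hx; exact hx.1
  have h3 : ∀ x ∉ S, χ x = 0 := fun x hx => by simp [S] at hx; exact hx.2
  rw [G.form_eq hθ h1 h3, G.form_eq hθ h1 h3,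
    G.inner_ofFinsupp χ _ (S := S) Finset.subset_union_right, coe_ofFinsupp, Finset.mul_sum,
    sub_add_eq_add_sub, ← Finset.sum_add_distrib]
  congr 1
  refine Finset.sum_congr rfl fun x _ => ?_
  push_cast; ring

end FiniteForm

end WeightedGraph

namespace WeightedGraph

variable {X : Type*} (G : WeightedGraph X) [MeasurableSpace X] [DiscreteMeasurableSpace X]

/-! ### The form domain -/

/-- The form `Q_{w,θ}^{(c)}` dominates the scalar product. -/
structure IsCoercive (w : X → ℝ) (θ : X → X → ℝ) : Prop where
  magnetic : IsMagneticPotential θ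
  norm_sq_le : ∀ φ : X →₀ ℂ, ‖G.ofFinsupp φ‖ ^ 2 ≤ (G.form w θ φ φ).re

variable {G} {w : X → ℝ} {θ : X → X → ℝ}

/-- The finitely supported functions with the scalar product given by the form. -/
def FormCore (_h : G.IsCoercive w θ) : Type _ := X →₀ ℂ

variable (h : G.IsCoercive w θ)

noncomputable instance : AddCommGroup (FormCore h) := inferInstanceAs (AddCommGroup (X →₀ ℂ))
noncomputable instance : Module ℂ (FormCore h) := inferInstanceAs (Module ℂ (X →₀ ℂ))

/-- The identification of `FormCore` with the finitely supported functions. -/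
noncomputable def FormCore.equiv : FormCore h ≃ₗ[ℂ] (X →₀ ℂ) := LinearEquiv.refl ℂ (X →₀ ℂ)

/-- The scalar product `⟪φ, ψ⟫ = Q(ψ, φ)`. -/
@[reducible] noncomputable def formCoreInner : InnerProductSpace.Core ℂ (FormCore h) where
  inner φ ψ := G.form w θ (FormCore.equiv h ψ) (FormCore.equiv h φ)
  conj_inner_symm φ ψ := G.conj_form h.magnetic _ _
  re_inner_nonneg φ := (sq_nonneg _).trans (h.norm_sq_le (FormCore.equiv h φ))
  add_left φ ψ χ := by
    rw [← G.conj_form h.magnetic, map_add, G.form_add_left h.magnetic, map_add,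
      G.conj_form h.magnetic, G.conj_form h.magnetic]
  smul_left φ ψ c := by
    rw [← G.conj_form h.magnetic, map_smul, G.form_smul_left h.magnetic, map_mul,
      G.conj_form h.magnetic]
  definite φ hφ := by
    have h1 := h.norm_sq_le (FormCore.equiv h φ)
    rw [hφ, Complex.zero_re] at h1
    have h2 : ‖G.ofFinsupp (FormCore.equiv h φ)‖ = 0 := by
      have := le_antisymm h1 (sq_nonneg _)
      simpa using this
    rw [norm_eq_zero] at h2
    have h3 := G.coe_ofFinsupp (FormCore.equiv h φ)
    rw [h2, coe_zero] at h3
    exact (FormCore.equiv h).map_eq_zero_iff.mp (DFunLike.coe_injective h3.symm)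

noncomputable instance : NormedAddCommGroup (FormCore h) :=
  @InnerProductSpace.Core.toNormedAddCommGroup ℂ _ _ _ _ (formCoreInner h)

noncomputable instance : InnerProductSpace ℂ (FormCore h) :=
  InnerProductSpace.ofCore (formCoreInner h).toCore

theorem FormCore.inner_eq (φ ψ : FormCore h) :
    inner ℂ φ ψ = G.form w θ (FormCore.equiv h ψ) (FormCore.equiv h φ) := rfl

theorem FormCore.norm_sq_eq (φ : FormCore h) :
    ‖φ‖ ^ 2 = (G.form w θ (FormCore.equiv h φ) (FormCore.equiv h φ)).re := by
  rw [← FormCore.inner_eq, inner_self_eq_norm_sq_to_K]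
  simp [← Complex.ofReal_pow]

/-- The inclusion of the form core into `ℓ²(X, m)`. -/
noncomputable def coreInclusion : FormCore h →L[ℂ] G.ell2 :=
  (G.ofFinsupp ∘ₗ (FormCore.equiv h).toLinearMap).mkContinuous 1 fun φ => by
    rw [one_mul, ← abs_of_nonneg (norm_nonneg (_ : G.ell2)), ← abs_of_nonneg (norm_nonneg φ)]
    refine sq_le_sq.mp ?_
    rw [FormCore.norm_sq_eq]
    exact h.norm_sq_le _

/-- The Hilbert space completion of the form core. -/
abbrev FormDomain := UniformSpace.Completion (FormCore h)

/-- The canonical map of the completed form domain to `ℓ²(X, m)`. -/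
noncomputable def domainInclusion : FormDomain h →L[ℂ] G.ell2 :=
  (coreInclusion h).extend UniformSpace.Completion.toComplL

theorem domainInclusion_coe (φ : FormCore h) :
    domainInclusion h (φ : FormDomain h) = G.ofFinsupp (FormCore.equiv h φ) :=
  ContinuousLinearMap.extend_eq (e := UniformSpace.Completion.toComplL) _
    UniformSpace.Completion.denseRange_coe
    (UniformSpace.Completion.isUniformInducing_coe _) φ

theorem norm_domainInclusion_le : ‖domainInclusion h‖ ≤ 1 := by
  refine ContinuousLinearMap.opNorm_le_bound _ zero_le_one fun a => ?_
  refine UniformSpace.Completion.induction_on (p := fun a => ‖domainInclusion h a‖ ≤ 1 * ‖a‖) a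
    (isClosed_le (by fun_prop) (by fun_prop)) fun φ => ?_
  rw [domainInclusion_coe, UniformSpace.Completion.norm_coe]
  exact LinearMap.mkContinuous_norm_le _ zero_le_one _ |> (coreInclusion h).le_of_opNorm_le <| φ

/-- The functions in the form domain supported in the finite set `S`. -/
noncomputable def finiteDomain (S : Finset X) : Submodule ℂ (FormDomain h) :=
  (Finsupp.supported ℂ ℂ (S : Set X)).map
    ((UniformSpace.Completion.toComplₗᵢ (𝕜 := ℂ) (E := FormCore h)).toLinearMap
      ∘ₗ (FormCore.equiv h).symm.toLinearMap)

instance (S : Finset X) : FiniteDimensional ℂ (finiteDomain h S) := by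
  have : FiniteDimensional ℂ (Finsupp.supported ℂ ℂ (S : Set X)) :=
    Module.Finite.equiv (Finsupp.supportedEquivFinsupp (S : Set X)).symm
  unfold finiteDomain; infer_instance

theorem mem_finiteDomain {S : Finset X} {a : FormDomain h} :
    a ∈ finiteDomain h S ↔ ∃ φ : X →₀ ℂ, φ.support ⊆ S ∧ ((FormCore.equiv h).symm φ : FormDomain h) = a := by
  simp only [finiteDomain, Submodule.mem_map, Finsupp.mem_supported, Finset.coe_subset]
  rfl

theorem monotone_finiteDomain : Monotone (finiteDomain h) := fun _ _ hST =>
  Submodule.map_mono (Finsupp.supported_mono (by exact_mod_cast hST))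

theorem dense_iSup_finiteDomain : ⊤ ≤ (⨆ S, finiteDomain h S).topologicalClosure := by
  rw [top_le_iff, ← Submodule.dense_iff_topologicalClosure_eq_top]
  refine (UniformSpace.Completion.denseRange_coe (α := FormCore h)).mono ?_
  rintro _ ⟨φ, rfl⟩
  exact Submodule.mem_iSup_of_mem (FormCore.equiv h φ).support
    ((mem_finiteDomain h).mpr ⟨_, subset_rfl, rfl⟩)

/-- The resolvent of the operator restricted to the finite set `S` (with Dirichlet conditions). -/
noncomputable def finiteResolvent (S : Finset X) : G.ell2 →L[ℂ] G.ell2 :=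
  formResolvent (domainInclusion h) (finiteDomain h S)

/-- The resolvent of the operator associated with the form. -/
noncomputable def resolventOp : G.ell2 →L[ℂ] G.ell2 := formResolvent (domainInclusion h) ⊤

theorem tendsto_finiteResolvent (f : G.ell2) :
    Tendsto (fun S => finiteResolvent h S f) atTop (𝓝 (resolventOp h f)) :=
  tendsto_formResolvent _ _ (monotone_finiteDomain h) (dense_iSup_finiteDomain h) f

theorem exists_finiteResolvent_eq (S : Finset X) (f : G.ell2) : ∃ φ : X →₀ ℂ, φ.support ⊆ S ∧
    finiteResolvent h S f = G.ofFinsupp φ ∧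
    ∀ ψ : X →₀ ℂ, ψ.support ⊆ S → G.form w θ φ ψ = inner ℂ (G.ofFinsupp ψ) f := by
  obtain ⟨u, hu, h1, h2⟩ := exists_formResolvent_eq (domainInclusion h) (finiteDomain h S) f
  obtain ⟨φ, hφ, rfl⟩ := (mem_finiteDomain h).mp hu
  refine ⟨φ, hφ, ?_, fun ψ hψ => ?_⟩
  · rw [finiteResolvent, h1, domainInclusion_coe]; rfl
  · have h3 := h2 ((FormCore.equiv h).symm ψ : FormDomain h)
      ((mem_finiteDomain h).mpr ⟨ψ, hψ, rfl⟩)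
    rw [UniformSpace.Completion.inner_coe, FormCore.inner_eq, domainInclusion_coe] at h3
    exact h3

/-- The finite volume resolvent equation. -/
theorem finiteResolvent_equation {S : Finset X} {x : X} (hx : x ∈ S) (f : G.ell2) :
    ((G.degOne x + w x * G.m x : ℝ) : ℂ) * finiteResolvent h S f x
      - ∑ y ∈ S, (G.b x y : ℂ) * Complex.exp (Complex.I * (θ x y : ℂ)) * finiteResolvent h S f y
      = G.m x * f x := by
  classical
  obtain ⟨φ, hφ, h1, h2⟩ := exists_finiteResolvent_eq h S f
  -- Testing the weak equation with the indicator of `x` gives the equation at `x`.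
  have h3 := h2 (Finsupp.single x 1)
    ((Finsupp.support_single_subset).trans (Finset.singleton_subset_iff.mpr hx))
  rw [G.inner_ofFinsupp _ _ (S := {x}) Finsupp.support_single_subset, Finset.sum_singleton,
    G.form_eq h.magnetic (S := S)] at h3
  · rw [h1, coe_ofFinsupp]
    simp only [Finsupp.single_eq_same, map_one, one_mul] at h3
    rw [← h3]
    congr 1
    · rw [Finset.sum_eq_single_of_mem x hx]
      · simp
      · intro y _ hy; simp [hy.symm]
    · symm
      rw [Finset.sum_eq_single_of_mem x hx]
      · simp
      · intro y _ hy; simp [hy.symm]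
  · intro y hy
    exact Finsupp.notMem_support_iff.mp fun hy' => hy (hφ hy')
  · intro y hy
    rw [Finsupp.single_apply, if_neg]
    rintro rfl; exact hy hx

/-! ### A strictly positive superharmonic function -/

/-- The solution `φ` is the unique minimiser of `Q(φ) - 2 Re ⟪φ, δ_x⟫` among functions supported in
`S`. Replacing `φ` by `|φ|` increases neither term, and coercivity applied to `|φ| - φ` shows that
both agree. -/
theorem finiteResolvent_delta_nonneg (h0 : G.IsCoercive w fun _ _ => 0) (S : Finset X) (x y : X) :
    finiteResolvent h0 S (G.delta x) y = ‖finiteResolvent h0 S (G.delta x) y‖ := by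
  classical
  obtain ⟨φ, hφ, h1, h2⟩ := exists_finiteResolvent_eq h0 S (G.delta x)
  let ψ : X →₀ ℂ := φ.mapRange (fun z => (‖z‖ : ℂ)) (by simp)
  have hψ : ∀ z, ψ z = ‖φ z‖ := fun z => by simp [ψ]
  have hψS : ψ.support ⊆ S := (Finsupp.support_mapRange).trans hφ
  have h3 := h2 ψ hψS
  have h4 := h2 φ hφ
  have h5 := G.form_abs_le (w := w) isMagneticPotential_zero φ ψ hψ
  have h6 := h0.norm_sq_le (ψ - φ)
  have h7 : (G.form w (fun _ _ => 0) ⇑(ψ - φ) ⇑(ψ - φ)).re = (G.form w (fun _ _ => 0) ψ ψ).re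
      + (G.form w (fun _ _ => 0) φ φ).re - 2 * (G.form w (fun _ _ => 0) φ ψ).re := by
    have e : ∀ χ : X →₀ ℂ, G.form w (fun _ _ => 0) ⇑(ψ - φ) χ
        = G.form w (fun _ _ => 0) ψ χ - G.form w (fun _ _ => 0) φ χ := by
      intro χ
      rw [sub_eq_add_neg, ← neg_one_smul ℂ φ, G.form_add_left isMagneticPotential_zero,
        G.form_smul_left isMagneticPotential_zero]
      ring
    rw [e, ← G.conj_form isMagneticPotential_zero (ψ - φ) ψ,
      ← G.conj_form isMagneticPotential_zero (ψ - φ) φ, e, e,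
      ← G.conj_form isMagneticPotential_zero φ ψ]
    simp only [map_sub, Complex.sub_re, Complex.conj_re]
    ring
  have h8 : (inner ℂ (G.ofFinsupp φ) (G.delta x)).re ≤ (inner ℂ (G.ofFinsupp ψ) (G.delta x)).re := by
    rw [← inner_conj_symm, ← inner_conj_symm (G.ofFinsupp ψ), inner_delta, inner_delta,
      coe_ofFinsupp, coe_ofFinsupp, hψ, Complex.conj_re, Complex.conj_re, Complex.re_ofReal_mul,
      Complex.re_ofReal_mul]
    refine mul_le_mul_of_nonneg_left ?_ (G.m_pos x).le
    exact Complex.re_le_norm _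
  have h9 : ‖G.ofFinsupp (ψ - φ)‖ ^ 2 ≤ 0 := by
    refine h6.trans ?_
    rw [h7, h3]
    rw [h4] at h5
    rw [h4]
    linarith
  have h10 : G.ofFinsupp (ψ - φ) = 0 := by
    have := le_antisymm h9 (sq_nonneg _)
    simpa using this
  have h11 := G.coe_ofFinsupp (ψ - φ)
  rw [h10, coe_zero] at h11
  have h12 := congrFun h11 y
  rw [Finsupp.sub_apply, hψ, Pi.zero_apply] at h12
  rw [h1, coe_ofFinsupp]
  linear_combination h12

theorem tendsto_apply {ι : Type*} {l : Filter ι} {u : ι → G.ell2} {f : G.ell2}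
    (hu : Tendsto u l (𝓝 f)) (x : X) : Tendsto (fun i => u i x) l (𝓝 (f x)) := by
  have := ((G.evalCLM x).continuous.tendsto f).comp hu
  simpa only [Function.comp_def, evalCLM_apply] using this

/-- The function is the resolvent applied to an indicator, obtained as a limit of non-negative
finite-volume solutions. The inequality is stated with finite partial sums, since convergence of the
full sum is only a consequence of it. -/
theorem exists_superharmonic (h0 : G.IsCoercive w fun _ _ => 0) : ∃ u : X → ℝ, (∀ x, 0 < u x) ∧
    ∀ x (F : Finset X), ∑ y ∈ F, G.b x y * u y ≤ (G.degOne x + w x * G.m x) * u x := by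
  classical
  rcases isEmpty_or_nonempty X with hX | ⟨⟨x₀⟩⟩
  · exact ⟨fun _ => 1, fun x => hX.elim x, fun x => hX.elim x⟩
  set f := G.delta x₀ with hf
  set u : X → ℝ := fun x => ‖resolventOp h0 f x‖ with hu
  have hlim : ∀ x, Tendsto (fun S => ‖finiteResolvent h0 S f x‖) atTop (𝓝 (u x)) := fun x =>
    (tendsto_apply (tendsto_finiteResolvent h0 f) x).norm
  have hfx : ∀ x, f x = ((Set.indicator {x₀} (fun _ => (1 : ℝ)) x : ℝ) : ℂ) := by
    intro x
    rw [hf, coe_delta]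
    by_cases hx : x = x₀ <;> simp [hx]
  have key : ∀ x (F : Finset X), ∑ y ∈ F, G.b x y * u y
      + G.m x * Set.indicator {x₀} (fun _ => (1 : ℝ)) x ≤ (G.degOne x + w x * G.m x) * u x := by
    intro x F
    refine le_of_tendsto_of_tendsto (b := atTop) ((tendsto_finsetSum F fun y _ =>
      (hlim y).const_mul (G.b x y)).add_const _) ((hlim x).const_mul _) ?_
    filter_upwards [eventually_ge_atTop (insert x F)] with S hS
    have hxS : x ∈ S := hS (Finset.mem_insert_self _ _)
    have hFS : F ⊆ S := (Finset.subset_insert _ _).trans hS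
    have h1 := finiteResolvent_equation h0 hxS f
    rw [hfx, finiteResolvent_delta_nonneg] at h1
    have h2 : ∑ y ∈ S, (G.b x y : ℂ) * Complex.exp (Complex.I * ((0 : ℝ) : ℂ))
        * finiteResolvent h0 S f y = ((∑ y ∈ S, G.b x y * ‖finiteResolvent h0 S f y‖ : ℝ) : ℂ) := by
      push_cast
      refine Finset.sum_congr rfl fun y _ => ?_
      rw [← finiteResolvent_delta_nonneg]; simp [hf]
    rw [h2] at h1
    have h3 : (G.degOne x + w x * G.m x) * ‖finiteResolvent h0 S f x‖
        - ∑ y ∈ S, G.b x y * ‖finiteResolvent h0 S f y‖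
        = G.m x * Set.indicator {x₀} (fun _ => (1 : ℝ)) x := by exact_mod_cast h1
    have h4 : ∑ y ∈ F, G.b x y * ‖finiteResolvent h0 S f y‖
        ≤ ∑ y ∈ S, G.b x y * ‖finiteResolvent h0 S f y‖ :=
      Finset.sum_le_sum_of_subset_of_nonneg hFS fun y _ _ =>
        mul_nonneg (G.b_nonneg x y) (norm_nonneg _)
    linarith
  have hu0 : ∀ x, 0 ≤ u x := fun x => norm_nonneg _
  have hind : ∀ x, 0 ≤ G.m x * Set.indicator {x₀} (fun _ => (1 : ℝ)) x := fun x =>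
    mul_nonneg (G.m_pos x).le (Set.indicator_nonneg (fun _ _ => zero_le_one) x)
  refine ⟨u, fun x => ?_, fun x F => by linarith [key x F, hind x]⟩
  -- Strict positivity spreads along edges: a zero of `u` next to a vertex where `u > 0` contradicts
  -- superharmonicity. At `x₀` itself the source term `m x₀` excludes a zero.
  induction G.connected x₀ x with
  | refl =>
    refine (hu0 x₀).lt_of_ne fun h0' => ?_
    have := key x₀ ∅
    rw [← h0'] at this
    simp at this
    linarith [G.m_pos x₀]
  | tail _ hbc ih =>
    rename_i y z _
    refine (hu0 z).lt_of_ne fun h0' => ?_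
    have h1 := key z {y}
    rw [← h0', Finset.sum_singleton, G.b_symm] at h1
    have h2 := hind z
    have h3 := mul_pos hbc ih
    linarith

/-! ### Closability -/

/-- The part of the ground state representation of the form that involves only vertices in `F`. -/
noncomputable def partialEnergy (G : WeightedGraph X) (w : X → ℝ) (θ : X → X → ℝ) (u : X → ℝ)
    (F : Finset X) (f : X → ℂ) : ℝ :=
  1 / 2 * ∑ p ∈ F ×ˢ F, G.b p.1 p.2 * u p.1 * u p.2
      * ‖f p.1 / u p.1 - Complex.exp (Complex.I * (θ p.1 p.2 : ℂ)) * (f p.2 / u p.2)‖ ^ 2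
    + ∑ x ∈ F, (G.degOne x + w x * G.m x - (∑' y, G.b x y * u y) / u x) * ‖f x‖ ^ 2

theorem norm_sub_exp_mul_sq (c : ℝ) (z₁ z₂ : ℂ) :
    ‖z₁ - Complex.exp (Complex.I * (c : ℂ)) * z₂‖ ^ 2
      = ‖z₁‖ ^ 2 + ‖z₂‖ ^ 2 - 2 * (Complex.exp (Complex.I * (c : ℂ)) * z₂ * conj z₁).re := by
  rw [← Complex.normSq_eq_norm_sq, Complex.normSq_sub, Complex.normSq_mul,
    Complex.normSq_eq_norm_sq, Complex.normSq_eq_norm_sq, Complex.normSq_eq_norm_sq,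
    Complex.norm_exp_I_mul_ofReal, ← Complex.conj_re (z₁ * _), map_mul, Complex.conj_conj,
    mul_comm (conj z₁)]
  ring

section PartialEnergy

variable {u : X → ℝ} (hu : ∀ x, 0 < u x)
  (hs : ∀ x (F : Finset X), ∑ y ∈ F, G.b x y * u y ≤ (G.degOne x + w x * G.m x) * u x)
include hu hs

omit [MeasurableSpace X] [DiscreteMeasurableSpace X] in
theorem summable_b_mul (x : X) : Summable fun y => G.b x y * u y :=
  summable_of_sum_le (fun y => mul_nonneg (G.b_nonneg x y) (hu y).le) (hs x)

omit [MeasurableSpace X] [DiscreteMeasurableSpace X] in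
theorem monotone_partialEnergy (f : X → ℂ) : Monotone fun F => partialEnergy G w θ u F f := by
  intro F F' hF
  refine add_le_add (mul_le_mul_of_nonneg_left ?_ (by norm_num)) ?_
  · refine Finset.sum_le_sum_of_subset_of_nonneg (Finset.product_subset_product hF hF)
      fun p _ _ => ?_
    have := G.b_nonneg p.1 p.2
    have := hu p.1
    have := hu p.2
    positivity
  · refine Finset.sum_le_sum_of_subset_of_nonneg hF fun x _ _ => mul_nonneg ?_ (sq_nonneg _)
    rw [sub_nonneg, div_le_iff₀ (hu x)]
    exact (summable_b_mul hu hs x).tsum_le_of_sum_le (hs x)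

omit [MeasurableSpace X] [DiscreteMeasurableSpace X] in
-- Once `F` contains the support of `φ`, the partial energy differs from the form only by the tails
-- of the sums `∑ y, b x y * u y` over the finitely many `x` in the support.
theorem tendsto_partialEnergy (hθ : IsMagneticPotential θ) (φ : X →₀ ℂ) :
    Tendsto (fun F => partialEnergy G w θ u F φ) atTop (𝓝 (G.form w θ φ φ).re) := by
  classical
  have h1 : Tendsto (fun F : Finset X => (G.form w θ φ φ).re - ∑ x ∈ φ.support,
      ‖φ x‖ ^ 2 / u x * ((∑' y, G.b x y * u y) - ∑ y ∈ F, G.b x y * u y)) atTop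
      (𝓝 ((G.form w θ φ φ).re - ∑ x ∈ φ.support, ‖φ x‖ ^ 2 / u x
        * ((∑' y, G.b x y * u y) - ∑' y, G.b x y * u y))) :=
    tendsto_const_nhds.sub (tendsto_finsetSum _ fun x _ =>
      (tendsto_const_nhds.sub (summable_b_mul hu hs x).hasSum).const_mul _)
  simp only [sub_self, mul_zero, Finset.sum_const_zero, sub_zero] at h1
  refine h1.congr' ?_
  filter_upwards [eventually_ge_atTop φ.support] with F hF
  have h2 : ∀ x ∉ F, φ x = 0 := fun x hx =>
    Finsupp.notMem_support_iff.mp fun hx' => hx (hF hx')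
  rw [Finset.sum_subset hF (fun x _ hx => by simp [Finsupp.notMem_support_iff.mp hx]),
    G.form_eq hθ h2 h2, partialEnergy]
  have h3 : ∑ p ∈ F ×ˢ F, G.b p.1 p.2 * u p.1 * u p.2
      * ‖φ p.1 / u p.1 - Complex.exp (Complex.I * (θ p.1 p.2 : ℂ)) * (φ p.2 / u p.2)‖ ^ 2
      = 2 * (∑ x ∈ F, ‖φ x‖ ^ 2 / u x * ∑ y ∈ F, G.b x y * u y) - 2 * (∑ x ∈ F, ∑ y ∈ F,
        (G.b x y : ℂ) * Complex.exp (Complex.I * (θ x y : ℂ)) * φ y * conj (φ x)).re := by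
    have h4 : ∀ x y, G.b x y * u x * u y
        * ‖φ x / u x - Complex.exp (Complex.I * (θ x y : ℂ)) * (φ y / u y)‖ ^ 2
        = ‖φ x‖ ^ 2 / u x * (G.b x y * u y) + ‖φ y‖ ^ 2 / u y * (G.b y x * u x)
          - 2 * ((G.b x y : ℂ) * Complex.exp (Complex.I * (θ x y : ℂ)) * φ y * conj (φ x)).re := by
      intro x y
      have hx := (hu x).ne'
      have hy := (hu y).ne'
      have e : (G.b x y : ℂ) * Complex.exp (Complex.I * (θ x y : ℂ)) * φ y * conj (φ x)
          = ((G.b x y * u x * u y : ℝ) : ℂ) * (Complex.exp (Complex.I * (θ x y : ℂ)) * (φ y / u y)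
            * conj (φ x / u x)) := by
        rw [map_div₀, Complex.conj_ofReal]
        have hx' : (u x : ℂ) ≠ 0 := by exact_mod_cast hx
        have hy' : (u y : ℂ) ≠ 0 := by exact_mod_cast hy
        push_cast
        field_simp
      rw [norm_sub_exp_mul_sq, e, Complex.re_ofReal_mul, norm_div, norm_div, Complex.norm_real,
        Complex.norm_real, Real.norm_of_nonneg (hu x).le, Real.norm_of_nonneg (hu y).le,
        G.b_symm y x]
      field_simp
    rw [Finset.sum_product]
    simp only [h4, Finset.sum_sub_distrib, Finset.sum_add_distrib]
    rw [Finset.sum_comm (f := fun x y => ‖φ y‖ ^ 2 / u y * (G.b y x * u x)), Complex.re_sum]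
    simp only [Complex.re_sum, Finset.mul_sum, two_mul, Finset.sum_add_distrib]
  rw [h3, Complex.sub_re, Complex.re_sum]
  have h5 : ∀ x, (((G.degOne x + w x * G.m x : ℝ) : ℂ) * (φ x * conj (φ x))).re
      = (G.degOne x + w x * G.m x) * ‖φ x‖ ^ 2 := by
    intro x
    rw [Complex.re_ofReal_mul, Complex.mul_conj, Complex.normSq_eq_norm_sq, Complex.ofReal_re]
  have h6 : ∀ x, (G.degOne x + w x * G.m x - (∑' y, G.b x y * u y) / u x) * ‖φ x‖ ^ 2
      = (G.degOne x + w x * G.m x) * ‖φ x‖ ^ 2 - ‖φ x‖ ^ 2 / u x * ∑' y, G.b x y * u y := by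
    intro x; ring
  simp only [h5, h6, mul_sub, Finset.sum_sub_distrib]
  ring

/-- A partial energy depends on finitely many point values, hence is continuous on `ℓ²`, and the
bound by the form extends from the core to its completion. -/
theorem partialEnergy_domainInclusion_le (F : Finset X) (a : FormDomain h) :
    partialEnergy G w θ u F (domainInclusion h a) ≤ ‖a‖ ^ 2 := by
  refine UniformSpace.Completion.induction_on
    (p := fun a => partialEnergy G w θ u F (domainInclusion h a) ≤ ‖a‖ ^ 2) a
    (isClosed_le ?_ (by fun_prop)) fun φ => ?_
  · have h1 : ∀ x, Continuous fun a => domainInclusion h a x := fun x => by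
      simp only [← evalCLM_apply]
      fun_prop
    unfold partialEnergy
    fun_prop
  · rw [domainInclusion_coe, coe_ofFinsupp, UniformSpace.Completion.norm_coe, FormCore.norm_sq_eq]
    exact (monotone_partialEnergy hu hs _).ge_of_tendsto
      (tendsto_partialEnergy hu hs h.magnetic _) F

end PartialEnergy

/-- If `a` is mapped to `0`, then `φ - a` and `φ` have the same partial energies, so `‖φ‖ ≤ ‖φ - a‖`
on the core and, by density, everywhere; the choice `φ = a` gives `a = 0`. The superharmonic
function comes from the zero-field form, which is why `h0` appears for every `θ`. -/
theorem domainInclusion_injective (h0 : G.IsCoercive w fun _ _ => 0) (a : FormDomain h)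
    (ha : domainInclusion h a = 0) : a = 0 := by
  obtain ⟨u, hu, hs⟩ := exists_superharmonic h0
  have h1 : ∀ φ : FormCore h, ‖(φ : FormDomain h)‖ ^ 2 ≤ ‖(φ : FormDomain h) - a‖ ^ 2 := by
    intro φ
    rw [UniformSpace.Completion.norm_coe, FormCore.norm_sq_eq]
    refine le_of_tendsto (tendsto_partialEnergy hu hs h.magnetic _)
      (Eventually.of_forall fun F => ?_)
    have h2 := partialEnergy_domainInclusion_le h hu hs F ((φ : FormDomain h) - a)
    rwa [map_sub, ha, sub_zero, domainInclusion_coe, coe_ofFinsupp] at h2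
  have h3 : ∀ b : FormDomain h, ‖b‖ ^ 2 ≤ ‖b - a‖ ^ 2 := fun b =>
    UniformSpace.Completion.induction_on (p := fun b : FormDomain h => ‖b‖ ^ 2 ≤ ‖b - a‖ ^ 2) b
      (isClosed_le (by fun_prop) (by fun_prop)) h1
  have h4 := h3 a
  rw [sub_self, norm_zero] at h4
  have := le_antisymm (by simpa using h4) (sq_nonneg ‖a‖)
  simpa using this

end WeightedGraph

/-! ### From the completed form domain to the closure, the operator and the semigroup -/

namespace WeightedGraph

variable {X : Type*} {G : WeightedGraph X} [MeasurableSpace X] [DiscreteMeasurableSpace X]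
  {v : X → ℝ} {θ : X → X → ℝ}

omit [MeasurableSpace X] [DiscreteMeasurableSpace X] in
theorem form_eq_pos_sub_neg (φ : X →₀ ℂ) :
    G.form v θ φ φ = G.form (fun x => max (v x) 0) θ φ φ
      - G.potentialForm (fun x => max (-v x) 0) φ φ := by
  have h1 : ∀ w : X → ℝ, G.potentialForm w φ φ
      = ∑ x ∈ φ.support, (w x : ℂ) * φ x * conj (φ x) * (G.m x : ℂ) := fun w =>
    tsum_eq_sum fun x hx => by simp [Finsupp.notMem_support_iff.mp hx]
  have h2 : G.potentialForm v φ φ = G.potentialForm (fun x => max (v x) 0) φ φ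
      - G.potentialForm (fun x => max (-v x) 0) φ φ := by
    rw [h1, h1, h1, ← Finset.sum_sub_distrib]
    refine Finset.sum_congr rfl fun x _ => ?_
    have h3 : ((max (v x) 0 : ℝ) : ℂ) - ((max (-v x) 0 : ℝ) : ℂ) = (v x : ℂ) := by
      rw [← Complex.ofReal_sub, max_zero_sub_max_neg_zero_eq_self]
    rw [← h3]; ring
  rw [form, form, h2]; ring

/-- For an admissible potential the forms become coercive after adding a constant. -/
theorem exists_isCoercive (hv : v ∈ G.admissible fun _ _ => 0) :
    ∃ l : ℝ, ∀ θ, IsMagneticPotential θ → G.IsCoercive (fun x => v x + l) θ := by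
  obtain ⟨C, -, hC⟩ := hv
  -- `C` makes the shifted zero-field form non-negative and the extra `1` makes it dominate the
  -- squared norm. Passing to `ψ = |φ|` keeps the norm and does not increase the form, so the same
  -- shift works for all `θ`.
  refine ⟨C + 1, fun θ hθ => ⟨hθ, fun φ => ?_⟩⟩
  let ψ : X →₀ ℂ := φ.mapRange (fun z => (‖z‖ : ℂ)) (by simp)
  have hψ : ∀ z, ψ z = ‖φ z‖ := fun z => by simp [ψ]
  refine le_trans ?_ (G.form_abs_le hθ φ ψ hψ)
  have h1 := hC _ (G.ofFinsupp_mem_Cc ψ)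
  rw [coe_ofFinsupp] at h1
  have h2 : ‖G.ofFinsupp φ‖ ^ 2 = ‖G.ofFinsupp ψ‖ ^ 2 := by
    rw [G.norm_sq_ofFinsupp φ subset_rfl,
      G.norm_sq_ofFinsupp ψ (S := φ.support) Finsupp.support_mapRange]
    exact Finset.sum_congr rfl fun x _ => by simp [hψ]
  rw [G.form_add_const isMagneticPotential_zero, form_eq_pos_sub_neg, h2,
    inner_self_eq_norm_sq_to_K, Complex.add_re, Complex.sub_re, Complex.re_ofReal_mul]
  have h3 : (((‖G.ofFinsupp ψ‖ : ℝ) : ℂ) ^ 2).re = ‖G.ofFinsupp ψ‖ ^ 2 := by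
    rw [← Complex.ofReal_pow, Complex.ofReal_re]
  erw [h3]
  linarith

section Closure

variable {l : ℝ} (h : G.IsCoercive (fun x => v x + l) θ)

theorem form_core (φ ψ : FormCore h) :
    G.form v θ (FormCore.equiv h φ) (FormCore.equiv h ψ)
      = inner ℂ (ψ : FormDomain h) (φ : FormDomain h)
        - l * inner ℂ (domainInclusion h ψ) (domainInclusion h φ) := by
  rw [UniformSpace.Completion.inner_coe, FormCore.inner_eq, G.form_add_const h.magnetic,
    domainInclusion_coe, domainInclusion_coe]
  ring

include h in
theorem isSemibounded_of_isCoercive : G.IsSemibounded v θ := by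
  refine ⟨1 - l, fun f hf => ?_⟩
  obtain ⟨φ, rfl⟩ := G.exists_ofFinsupp hf
  have h1 := h.norm_sq_le φ
  rw [G.form_add_const h.magnetic, inner_self_eq_norm_sq_to_K, Complex.add_re,
    Complex.re_ofReal_mul] at h1
  have h3 : (((‖G.ofFinsupp φ‖ : ℝ) : ℂ) ^ 2).re = ‖G.ofFinsupp φ‖ ^ 2 := by
    rw [← Complex.ofReal_pow, Complex.ofReal_re]
  erw [h3] at h1
  rw [coe_ofFinsupp]
  linarith

theorem approximates_of_tendsto {φ : ℕ → FormCore h} {a : FormDomain h}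
    (hφ : Tendsto (fun n => (φ n : FormDomain h)) atTop (𝓝 a)) :
    G.Approximates v θ (fun n => G.ofFinsupp (FormCore.equiv h (φ n))) (domainInclusion h a) where
  mem n := G.ofFinsupp_mem_Cc _
  tendsto := by
    have := ((domainInclusion h).continuous.tendsto a).comp hφ
    simpa only [Function.comp_def, domainInclusion_coe] using this
  cauchy := by
    have h1 : Tendsto (fun p : ℕ × ℕ => ((φ p.1 - φ p.2 : FormCore h) : FormDomain h)) atTop
        (𝓝 (a - a)) := by
      simp only [UniformSpace.Completion.coe_sub]
      rw [← prod_atTop_atTop_eq]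
      exact (hφ.comp tendsto_fst).sub (hφ.comp tendsto_snd)
    rw [sub_self] at h1
    have hc : Continuous fun b : FormDomain h =>
        inner ℂ b b - l * inner ℂ (domainInclusion h b) (domainInclusion h b) := by fun_prop
    have h2 := (hc.tendsto 0).comp h1
    simp only [inner_zero_left, map_zero, mul_zero, sub_zero] at h2
    refine h2.congr fun p => ?_
    rw [Function.comp_apply, ← form_core, ← map_sub, coe_ofFinsupp, ← map_sub]

/-- Convergence in `ℓ²` together with the Cauchy property for `Q_v` is the Cauchy property for the
norm of `Q_{v+l}`; the limit therefore exists in the completion. -/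
theorem exists_tendsto_of_approximates {u : ℕ → G.ell2} {f : G.ell2}
    (hu : G.Approximates v θ u f) : ∃ (φ : ℕ → FormCore h) (a : FormDomain h),
      (∀ n, G.ofFinsupp (FormCore.equiv h (φ n)) = u n) ∧
      Tendsto (fun n => (φ n : FormDomain h)) atTop (𝓝 a) ∧ domainInclusion h a = f := by
  choose φ hφ using fun n => G.exists_ofFinsupp (hu.mem n)
  have h1 : CauchySeq fun n => ((FormCore.equiv h).symm (φ n) : FormDomain h) := by
    rw [cauchySeq_iff_tendsto_dist_atTop_0]
    have h2 : Tendsto (fun p : ℕ × ℕ => u p.1 - u p.2) atTop (𝓝 0) := by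
      rw [← prod_atTop_atTop_eq, ← sub_self f]
      exact (hu.tendsto.comp tendsto_fst).sub (hu.tendsto.comp tendsto_snd)
    have h3 : Tendsto (fun p : ℕ × ℕ => (G.form v θ ⇑(u p.1 - u p.2) ⇑(u p.1 - u p.2)
        + l * inner ℂ (u p.1 - u p.2) (u p.1 - u p.2)).re) atTop (𝓝 0) := by
      have := (Complex.continuous_re.tendsto _).comp
        (hu.cauchy.add ((h2.inner h2).const_mul (l : ℂ)))
      rwa [inner_zero_left, mul_zero, add_zero, Complex.zero_re] at this
    have h4 := (Real.continuous_sqrt.tendsto _).comp h3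
    rw [Real.sqrt_zero] at h4
    refine h4.congr fun p => ?_
    rw [Function.comp_apply, dist_eq_norm, ← UniformSpace.Completion.coe_sub,
      UniformSpace.Completion.norm_coe, ← map_sub]
    rw [← Real.sqrt_sq (norm_nonneg ((FormCore.equiv h).symm _)), FormCore.norm_sq_eq, LinearEquiv.apply_symm_apply, G.form_add_const h.magnetic, map_sub,
      hφ, hφ, ← coe_ofFinsupp, map_sub, hφ, hφ]
  obtain ⟨a, ha⟩ := cauchySeq_tendsto_of_complete h1
  refine ⟨fun n => (FormCore.equiv h).symm (φ n), a, fun n => by simp [hφ], ha, ?_⟩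
  have h5 := ((domainInclusion h).continuous.tendsto a).comp ha
  refine tendsto_nhds_unique (h5.congr fun n => ?_) hu.tendsto
  rw [Function.comp_apply, domainInclusion_coe]
  simp [hφ]

theorem mem_closureDomain (f : G.ell2) :
    f ∈ G.closureDomain v θ ↔ ∃ a, domainInclusion h a = f := by
  constructor
  · rintro ⟨u, hu⟩
    obtain ⟨φ, a, -, -, ha⟩ := exists_tendsto_of_approximates h hu
    exact ⟨a, ha⟩
  · rintro ⟨a, rfl⟩
    obtain ⟨b, hb, hb'⟩ := mem_closure_iff_seq_limit.mp
      (UniformSpace.Completion.denseRange_coe (α := FormCore h) a)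
    choose φ hφ using hb
    obtain rfl : (fun n => ((φ n : FormCore h) : FormDomain h)) = b := funext hφ
    exact ⟨_, approximates_of_tendsto h hb'⟩

variable (h0 : G.IsCoercive (fun x => v x + l) fun _ _ => 0)
include h h0

/-- Injectivity of the inclusion ensures that the limit in the completion depends only on the limit
in `ℓ²`, so the form values have a limit independent of the sequences. -/
theorem tendsto_form {u w : ℕ → G.ell2} {a b : FormDomain h}
    (hu : G.Approximates v θ u (domainInclusion h a))
    (hw : G.Approximates v θ w (domainInclusion h b)) :
    Tendsto (fun n => G.form v θ (u n) (w n)) atTop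
      (𝓝 (inner ℂ b a - l * inner ℂ (domainInclusion h b) (domainInclusion h a))) := by
  have hinj : ∀ a b : FormDomain h, domainInclusion h a = domainInclusion h b → a = b := by
    intro a b hab
    exact sub_eq_zero.mp (domainInclusion_injective h h0 _ (by rw [map_sub, hab, sub_self]))
  obtain ⟨φ, a', h1, h2, h3⟩ := exists_tendsto_of_approximates h hu
  obtain ⟨ψ, b', h4, h5, h6⟩ := exists_tendsto_of_approximates h hw
  obtain rfl := hinj _ _ h3
  obtain rfl := hinj _ _ h6
  have hc : Continuous fun p : FormDomain h × FormDomain h =>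
      inner ℂ p.2 p.1 - l * inner ℂ (domainInclusion h p.2) (domainInclusion h p.1) := by fun_prop
  refine ((hc.tendsto (a', b')).comp (h2.prodMk_nhds h5)).congr fun n => ?_
  rw [Function.comp_apply, ← form_core, ← h1, ← h4, coe_ofFinsupp, coe_ofFinsupp]

theorem isClosable_of_isCoercive : G.IsClosable v θ := by
  intro u hu
  rw [← map_zero (domainInclusion h)] at hu
  have := tendsto_form h h0 hu hu
  simpa using this

theorem closureForm_eq (a b : FormDomain h) :
    G.closureForm v θ (domainInclusion h a) (domainInclusion h b)
      = inner ℂ b a - l * inner ℂ (domainInclusion h b) (domainInclusion h a) := by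
  have h1 : domainInclusion h a ∈ G.closureDomain v θ ∧ domainInclusion h b ∈ G.closureDomain v θ :=
    ⟨(mem_closureDomain h _).mpr ⟨a, rfl⟩, (mem_closureDomain h _).mpr ⟨b, rfl⟩⟩
  rw [closureForm, dif_pos h1]
  exact (tendsto_form h h0 h1.1.choose_spec h1.2.choose_spec).limUnder_eq

omit h0 in
theorem resolventOp_apply (f : G.ell2) :
    resolventOp h f = domainInclusion h ((domainInclusion h).adjoint f) := by
  change domainInclusion h ((⊤ : Submodule ℂ (FormDomain h)).starProjection
    ((domainInclusion h).adjoint f)) = _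
  rw [Submodule.starProjection_eq_self_iff.mpr Submodule.mem_top]

/-- `J J* k = 0` forces `J* k = 0`, so `k` is orthogonal to the range of `J`, which contains the
indicators of vertices. -/
theorem resolventOp_injective (k : G.ell2) (hk : resolventOp h k = 0) : k = 0 := by
  rw [resolventOp_apply] at hk
  have h1 := domainInclusion_injective h h0 _ hk
  refine G.ell2_ext fun x => ?_
  have h2 := (domainInclusion h).adjoint_inner_right
    ((FormCore.equiv h).symm (Finsupp.single x 1) : FormDomain h) k
  rw [h1, inner_zero_right, domainInclusion_coe, LinearEquiv.apply_symm_apply,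
    G.inner_ofFinsupp _ _ (S := {x}) Finsupp.support_single_subset, Finset.sum_singleton] at h2
  have h3 : (G.m x : ℂ) ≠ 0 := by exact_mod_cast (G.m_pos x).ne'
  rw [coe_zero]
  simpa [h3] using h2.symm

/-- With `f = J a`, the weak equation reads `⟪b, a⟫ = ⟪J b, l f + k⟫` for all `b`, that is, `a = J*
(l f + k)`. -/
theorem form_representation_iff (f k : G.ell2) :
    (f ∈ G.closureDomain v θ ∧ ∀ g ∈ G.closureDomain v θ, G.closureForm v θ f g = inner ℂ g k)
      ↔ resolventOp h (l • f + k) = f := by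
  rw [resolventOp_apply]
  constructor
  · rintro ⟨hf, hg⟩
    obtain ⟨a, rfl⟩ := (mem_closureDomain h f).mp hf
    congr 1
    refine ext_inner_left ℂ fun b => ?_
    have h1 := hg _ ((mem_closureDomain h _).mpr ⟨b, rfl⟩)
    rw [closureForm_eq h h0] at h1
    rw [ContinuousLinearMap.adjoint_inner_right, inner_add_right, RCLike.real_smul_eq_coe_smul (K := ℂ),
      inner_smul_right]
    simp only [Complex.coe_algebraMap]
    linear_combination -h1
  · intro hf
    refine ⟨(mem_closureDomain h f).mpr ⟨_, hf⟩, fun g hg => ?_⟩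
    obtain ⟨b, rfl⟩ := (mem_closureDomain h g).mp hg
    have h1 := closureForm_eq h h0 ((domainInclusion h).adjoint (l • f + k)) b
    rw [hf, ContinuousLinearMap.adjoint_inner_right, inner_add_right,
      RCLike.real_smul_eq_coe_smul (K := ℂ), inner_smul_right] at h1
    rw [h1]; simp only [Complex.coe_algebraMap]; ring

omit h0 in
theorem resolventOp_isPositive : (resolventOp h).IsPositive := formResolvent_isPositive _ _

theorem isFormOperator_schrodinger : G.IsFormOperator v θ (G.schrodinger v θ) := by
  have hex : ∃ L, G.IsFormOperator v θ L := by
    obtain ⟨A, hA⟩ := exists_inverse_sub (resolventOp_injective h h0) l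
    exact ⟨A, fun f k => (hA f k).trans (form_representation_iff h h0 f k).symm⟩
  rw [schrodinger, dif_pos hex]
  exact hex.choose_spec

theorem mem_graph_schrodinger (f k : G.ell2) :
    (f, k) ∈ (G.schrodinger v θ).graph ↔ resolventOp h (l • f + k) = f := by
  rw [isFormOperator_schrodinger h h0 f k, form_representation_iff h h0]

theorem isSelfAdjoint_schrodinger : IsSelfAdjoint (G.schrodinger v θ) :=
  isSelfAdjoint_of_graph (resolventOp_isPositive h) (resolventOp_injective h h0) l
    (mem_graph_schrodinger h h0)

theorem mem_graph_neg_schrodinger (f k : G.ell2) :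
    (f, k) ∈ (-G.schrodinger v θ).graph ↔ resolventOp h (l • f - k) = f := by
  rw [sub_eq_add_neg, ← mem_graph_schrodinger h h0, LinearPMap.mem_graph_iff,
    LinearPMap.mem_graph_iff]
  simp only [LinearPMap.neg_apply, neg_eq_iff_eq_neg]
  rfl

theorem isC0Semigroup_schrodinger :
    IsC0SemigroupGeneratedBy (fun t : ℝ≥0 => Real.exp (l * t) • heatOp (resolventOp h) t)
      (-G.schrodinger v θ) :=
  isC0SemigroupGeneratedBy_heatOp (resolventOp_isPositive h) (resolventOp_injective h h0) l _
    (mem_graph_neg_schrodinger h h0)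

theorem isC0Semigroup_expNeg :
    IsC0SemigroupGeneratedBy (expNeg (G.schrodinger v θ)) (-G.schrodinger v θ) := by
  have hex : ∃ T, IsC0SemigroupGeneratedBy T (-G.schrodinger v θ) :=
    ⟨_, isC0Semigroup_schrodinger h h0⟩
  rw [expNeg, dif_pos hex]
  exact hex.choose_spec

/-- `expNeg` is a choice, so the explicit semigroup is reached through uniqueness. The generator is
bounded above by `l` because `f = R (l f - k)` with `R` positive gives `0 ≤ Re ⟪f, l f - k⟫`. -/
theorem expNeg_schrodinger (t : ℝ≥0) :
    expNeg (G.schrodinger v θ) t = Real.exp (l * t) • heatOp (resolventOp h) t := by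
  have hR := resolventOp_isPositive h
  refine congrFun ((isC0Semigroup_expNeg h h0).eq (isC0Semigroup_schrodinger h h0) l ?_ ?_) t
  · intro f k hfk
    rw [mem_graph_neg_schrodinger h h0] at hfk
    have h1 : inner ℂ f k = l * ((‖f‖ : ℂ) ^ 2) - inner ℂ f (l • f - k) := by
      rw [inner_sub_right, RCLike.real_smul_eq_coe_smul (K := ℂ), inner_smul_right, inner_self_eq_norm_sq_to_K]
      simp
    have h2 : 0 ≤ (inner ℂ f (l • f - k)).re := by
      have := hR.re_inner_nonneg_left (l • f - k)
      rwa [hfk] at this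
    rw [h1, Complex.sub_re, Complex.re_ofReal_mul, ← Complex.ofReal_pow, Complex.ofReal_re]
    linarith
  · rw [LinearPMap.neg_domain]
    exact dense_domain_of_graph hR (resolventOp_injective h h0) l (mem_graph_schrodinger h h0)

end Closure

end WeightedGraph

/-! ### Time regularity of the smoothed semigroup -/

section HeatDerivative

variable {H : Type*} [NormedAddCommGroup H] [InnerProductSpace ℂ H] [CompleteSpace H]
  {R : H →L[ℂ] H} (hR : R.IsPositive)
include hR

/-- Two factors `R` make the orbit of an arbitrary vector differentiable from the right, including
at time `0`. In finite volume both factors are removed again at the vertices. -/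
theorem hasDerivWithinAt_sq_mul_heatOp (f : H) {s : ℝ} (hs : 0 ≤ s) :
    HasDerivWithinAt (fun t => R (R (heatOp R t f))) (-R (heatOp R s f)) (Set.Ici s) s := by
  rw [hasDerivWithinAt_iff_tendsto]
  have h0 : Tendsto (fun t : ℝ => (t - s) * ‖f‖) (𝓝[≥] s) (𝓝 0) := by
    have : Continuous fun t : ℝ => (t - s) * ‖f‖ := by fun_prop
    simpa using (this.tendsto s).mono_left (nhdsWithin_le_nhds (s := Set.Ici s))
  refine squeeze_zero' (Eventually.of_forall fun t => by positivity) ?_ h0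
  filter_upwards [self_mem_nhdsWithin] with t (ht : s ≤ t)
  rcases ht.eq_or_lt with rfl | ht'
  · simp
  have h1 := norm_sq_mul_heatOp_sub_le hR hs ht
  have h2 : R (R (heatOp R t f)) - R (R (heatOp R s f)) - (t - s) • -R (heatOp R s f)
      = (R * (R * (heatOp R t - heatOp R s)) + (t - s) • (R * heatOp R s)) f := by
    simp only [mul_apply_eq_comp, _root_.add_apply, _root_.sub_apply, map_sub, smul_neg,
      sub_neg_eq_add, _root_.smul_apply]
  rw [h2, Real.norm_of_nonneg (by linarith)]
  have h3 : 0 < t - s := by linarith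
  calc _ ≤ (t - s)⁻¹ * ((t - s) ^ 2 * ‖f‖) := by
        gcongr
        exact (ContinuousLinearMap.le_opNorm _ _).trans (by gcongr)
    _ = (t - s) * ‖f‖ := by field_simp

theorem continuousOn_mul_heatOp (f : H) :
    ContinuousOn (fun t => R (heatOp R t f)) (Set.Ici 0) := by
  refine (LipschitzOnWith.of_dist_le_mul (K := ‖f‖₊) fun s hs t ht => ?_).continuousOn
  have key : ∀ s t : ℝ, 0 ≤ s → s ≤ t →
      ‖R (heatOp R t f) - R (heatOp R s f)‖ ≤ ‖f‖ * (t - s) := by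
    intro s t hs hst
    rw [← map_sub, ← _root_.sub_apply, ← mul_apply_eq_comp, mul_comm ‖f‖]
    exact (ContinuousLinearMap.le_opNorm _ _).trans
      (mul_le_mul_of_nonneg_right (norm_mul_heatOp_sub_le hR hs hst) (norm_nonneg f))
  rw [coe_nnnorm, Real.dist_eq, dist_eq_norm]
  rcases le_total s t with hst | hst
  · rw [norm_sub_rev, abs_sub_comm, abs_of_nonneg (by linarith)]
    exact key s t hs hst
  · rw [abs_of_nonneg (by linarith)]
    exact key t s ht hst

end HeatDerivative

/-! ### The Dyson expansion of a finite linear system -/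

section Dyson

variable {X : Type*}

/-- The terms of the Dyson expansion of the solution of `y' = -d y + B y`, `y 0 = f`. -/
noncomputable def dysonTerm (S : Finset X) (d : X → ℝ) (B : X → X → ℂ) (f : X → ℂ) :
    ℕ → ℝ → X → ℂ
  | 0, t, x => Real.exp (-(d x) * t) * f x
  | n + 1, t, x => Real.exp (-(d x) * t) * ∫ s in (0 : ℝ)..t, Real.exp (d x * s)
      * ∑ y ∈ S, B x y * dysonTerm S d B f n s y

variable {S : Finset X} {d : X → ℝ} {B : X → X → ℂ} {f : X → ℂ}

theorem continuous_dysonTerm (n : ℕ) (x : X) :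
    Continuous fun t => dysonTerm S d B f n t x := by
  induction n generalizing x with
  | zero => simp only [dysonTerm]; fun_prop
  | succ n ih =>
    simp only [dysonTerm]
    refine Continuous.mul (by fun_prop) ?_
    exact intervalIntegral.continuous_primitive
      (fun a b => (by fun_prop : Continuous _).intervalIntegrable a b) 0

/-- Each remainder is the integral operator applied to the previous one, so after `n` steps it is at
most `M (κ t) ^ n / n!`. -/
theorem tendsto_sum_dysonTerm {y : X → ℝ → ℂ} (hc : ∀ x ∈ S, ContinuousOn (y x) (Set.Ici 0))
    (hy : ∀ x ∈ S, ∀ t, 0 ≤ t → y x t = Real.exp (-(d x) * t) * (f x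
      + ∫ s in (0 : ℝ)..t, Real.exp (d x * s) * ∑ z ∈ S, B x z * y z s))
    {x : X} (hx : x ∈ S) {T : ℝ} (hT : 0 ≤ T) :
    Tendsto (fun n => ∑ k ∈ Finset.range n, dysonTerm S d B f k T x) atTop (𝓝 (y x T)) := by
  obtain ⟨M, hM⟩ : ∃ M, ∀ x ∈ S, ∀ t ∈ Set.Icc 0 T, ‖y x t‖ ≤ M := by
    have : ∀ x ∈ S, ∃ M, ∀ t ∈ Set.Icc 0 T, ‖y x t‖ ≤ M := fun x hx =>
      isCompact_Icc.exists_bound_of_continuousOn ((hc x hx).mono Set.Icc_subset_Ici_self)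
    choose! M hM using this
    exact ⟨∑ x ∈ S, |M x|, fun x hx t ht => (hM x hx t ht).trans ((le_abs_self _).trans
      (Finset.single_le_sum (f := fun x => |M x|) (fun _ _ => abs_nonneg _) hx))⟩
  have hM0 : 0 ≤ M := (norm_nonneg _).trans (hM x hx 0 ⟨le_rfl, hT⟩)
  -- Crude bounds suffice: `exp (c T)` for the exponential factors, where `d` may be negative, and
  -- `β` for the row sums of the matrix.
  set c := ∑ x ∈ S, |d x| with hcdef
  set β := ∑ x ∈ S, ∑ z ∈ S, ‖B x z‖ with hβ
  set κ := Real.exp (c * T) * β with hκ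
  have hβ0 : 0 ≤ β := Finset.sum_nonneg fun _ _ => Finset.sum_nonneg fun _ _ => norm_nonneg _
  have hκ0 : 0 ≤ κ := by positivity
  set r : ℕ → X → ℝ → ℂ := fun n x t => y x t - ∑ k ∈ Finset.range n, dysonTerm S d B f k t x
    with hr
  have hrc : ∀ n, ∀ x ∈ S, ContinuousOn (r n x) (Set.Ici 0) := fun n x hx =>
    (hc x hx).sub (continuous_finsetSum _ fun k _ => continuous_dysonTerm k x).continuousOn
  have hint : ∀ n x t, 0 ≤ t → IntervalIntegrable
      (fun s => (Real.exp (d x * s) : ℂ) * ∑ z ∈ S, B x z * r n z s) volume 0 t := by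
    intro n x t ht
    refine ContinuousOn.intervalIntegrable_of_Icc ht ?_
    refine ContinuousOn.mul (by fun_prop) (continuousOn_finsetSum _ fun z hz => ?_)
    exact continuousOn_const.mul ((hrc n z hz).mono Set.Icc_subset_Ici_self)
  have hrec : ∀ n, ∀ x ∈ S, ∀ t, 0 ≤ t → r (n + 1) x t = Real.exp (-(d x) * t)
      * ∫ s in (0 : ℝ)..t, Real.exp (d x * s) * ∑ z ∈ S, B x z * r n z s := by
    intro n
    induction n with
    | zero =>
      intro x hx t ht
      simp only [hr, zero_add, Finset.sum_range_one, Finset.range_zero, Finset.sum_empty, sub_zero]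
      rw [hy x hx t ht, dysonTerm]; ring
    | succ n ih =>
      intro x hx t ht
      have h1 : r (n + 2) x t = r (n + 1) x t - dysonTerm S d B f (n + 1) t x := by
        simp only [hr, Finset.sum_range_succ _ (n + 1)]; ring
      have h2 : IntervalIntegrable (fun s => (Real.exp (d x * s) : ℂ)
          * ∑ z ∈ S, B x z * dysonTerm S d B f n s z) volume 0 t := by
        have := fun z => continuous_dysonTerm (S := S) (d := d) (B := B) (f := f) n z
        exact (by fun_prop : Continuous _).intervalIntegrable 0 t
      rw [h1, ih x hx t ht, dysonTerm, ← mul_sub, ← intervalIntegral.integral_sub (hint n x t ht) h2]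
      congr 1
      refine intervalIntegral.integral_congr fun s _ => ?_
      simp only [hr, Finset.sum_range_succ _ n]
      rw [← mul_sub, ← Finset.sum_sub_distrib]
      congr 1
      exact Finset.sum_congr rfl fun z _ => by ring
  have hbound : ∀ n, ∀ x ∈ S, ∀ t ∈ Set.Icc 0 T,
      ‖r n x t‖ ≤ M * (κ ^ n * t ^ n / n.factorial) := by
    intro n
    induction n with
    | zero => intro x hx t ht; simpa [hr] using hM x hx t ht
    | succ n ih =>
      intro x hx t ht
      rw [hrec n x hx t ht.1, ← intervalIntegral.integral_const_mul]
      have h1 : ∀ s ∈ Set.Ioc 0 t, ‖(Real.exp (-(d x) * t) : ℂ) * ((Real.exp (d x * s) : ℂ)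
          * ∑ z ∈ S, B x z * r n z s)‖ ≤ κ * (M * (κ ^ n / n.factorial)) * s ^ n := by
        intro s hs
        have hsT : s ∈ Set.Icc 0 T := ⟨hs.1.le, hs.2.trans ht.2⟩
        rw [← mul_assoc, norm_mul, ← Complex.ofReal_mul, ← Real.exp_add, Complex.norm_real,
          Real.norm_of_nonneg (Real.exp_pos _).le]
        have h2 : Real.exp (-(d x) * t + d x * s) ≤ Real.exp (c * T) := by
          rw [Real.exp_le_exp]
          have h3 : |d x| ≤ c := Finset.single_le_sum (f := fun x => |d x|)
            (fun _ _ => abs_nonneg _) hx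
          calc -(d x) * t + d x * s = -(d x) * (t - s) := by ring
            _ ≤ |d x| * (t - s) :=
              mul_le_mul_of_nonneg_right (neg_le_abs _) (by linarith [hs.2])
            _ ≤ c * T := mul_le_mul h3 (by linarith [ht.2, hs.1]) (by linarith [hs.2])
              ((abs_nonneg _).trans h3)
        have h4 : ‖∑ z ∈ S, B x z * r n z s‖ ≤ β * (M * (κ ^ n * s ^ n / n.factorial)) := by
          refine (norm_sum_le _ _).trans ?_
          have h5 : ∑ z ∈ S, ‖B x z‖ ≤ β := Finset.single_le_sum
            (f := fun x => ∑ z ∈ S, ‖B x z‖)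
            (fun _ _ => Finset.sum_nonneg fun _ _ => norm_nonneg _) hx
          calc _ ≤ ∑ z ∈ S, ‖B x z‖ * (M * (κ ^ n * s ^ n / n.factorial)) := by
                refine Finset.sum_le_sum fun z hz => ?_
                rw [norm_mul]
                exact mul_le_mul_of_nonneg_left (ih z hz s hsT) (norm_nonneg _)
            _ = (∑ z ∈ S, ‖B x z‖) * (M * (κ ^ n * s ^ n / n.factorial)) := by
                rw [Finset.sum_mul]
            _ ≤ _ := by
                have := hs.1.le
                gcongr
        calc _ ≤ Real.exp (c * T) * (β * (M * (κ ^ n * s ^ n / n.factorial))) := by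
              gcongr
          _ = _ := by rw [hκ]; ring
      refine (intervalIntegral.norm_integral_le_of_norm_le ht.1 (Eventually.of_forall h1)
        ((by fun_prop : Continuous fun s : ℝ => κ * (M * (κ ^ n / n.factorial)) * s ^ n).intervalIntegrable
          0 t)).trans (le_of_eq ?_)
      rw [intervalIntegral.integral_const_mul, integral_pow, Nat.factorial_succ]
      push_cast
      field_simp
      ring
  have hlim : Tendsto (fun n => r n x T) atTop (𝓝 0) := by
    refine squeeze_zero_norm (fun n => hbound n x hx T ⟨hT, le_rfl⟩) ?_
    simp only [← mul_pow]
    simpa using (FloorSemiring.tendsto_pow_div_factorial_atTop (κ * T)).const_mul M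
  have := (tendsto_const_nhds (x := y x T)).sub hlim
  simpa [hr] using this

end Dyson

/-! ### The finite-volume semigroup as the solution of a linear system -/

namespace WeightedGraph

variable {X : Type*} {G : WeightedGraph X} [MeasurableSpace X] [DiscreteMeasurableSpace X]
  {v : X → ℝ} {θ : X → X → ℝ} {l : ℝ} (h : G.IsCoercive (fun x => v x + l) θ)

/-- The matrix of jump rates, twisted by the magnetic potential. -/
noncomputable def magneticRate (G : WeightedGraph X) (θ : X → X → ℝ) (x y : X) : ℂ :=
  (G.b x y / G.m x : ℝ) * Complex.exp (Complex.I * (θ x y : ℂ))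

theorem finiteResolvent_isPositive (S : Finset X) : (finiteResolvent h S).IsPositive :=
  formResolvent_isPositive _ _

/-- On `S` the finite-volume resolvent is undone by a finite matrix, so pointwise regularity of `R_S
u` passes to `u`. -/
theorem finiteResolvent_apply_eq {S : Finset X} {x : X} (hx : x ∈ S) (f : G.ell2) :
    f x = ((G.degM x + v x + l : ℝ) : ℂ) * finiteResolvent h S f x
      - ∑ y ∈ S, magneticRate G θ x y * finiteResolvent h S f y := by
  have h1 := finiteResolvent_equation h hx f
  have hm : G.m x ≠ 0 := (G.m_pos x).ne'
  have hm' : (G.m x : ℂ) ≠ 0 := by exact_mod_cast hm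
  have h2 : ((G.degOne x + (v x + l) * G.m x : ℝ) : ℂ)
      = G.m x * ((G.degM x + v x + l : ℝ) : ℂ) := by
    rw [← Complex.ofReal_mul]
    congr 1
    rw [degM, ← degOne]
    field_simp
    ring
  have h3 : ∑ y ∈ S, (G.b x y : ℂ) * Complex.exp (Complex.I * (θ x y : ℂ))
      * finiteResolvent h S f y
      = G.m x * ∑ y ∈ S, magneticRate G θ x y * finiteResolvent h S f y := by
    rw [Finset.mul_sum]
    refine Finset.sum_congr rfl fun y _ => ?_
    rw [magneticRate]; push_cast; field_simp
  rw [h2, h3, mul_assoc, ← mul_sub] at h1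
  exact (mul_left_cancel₀ hm' h1).symm

theorem continuousOn_finite_heatOp_apply {S : Finset X} {x : X} (hx : x ∈ S) (f : G.ell2) :
    ContinuousOn (fun t => heatOp (finiteResolvent h S) t f x) (Set.Ici 0) := by
  have h1 := fun z => (G.evalCLM z).continuous.comp_continuousOn
    (continuousOn_mul_heatOp (finiteResolvent_isPositive h S) f)
  simp only [Function.comp_def, evalCLM_apply] at h1
  simp only [fun t => finiteResolvent_apply_eq h hx (heatOp (finiteResolvent h S) t f)]
  exact (continuousOn_const.mul (h1 x)).sub
    (continuousOn_finsetSum _ fun y _ => continuousOn_const.mul (h1 y))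

theorem hasDerivWithinAt_finite_heatOp_apply {S : Finset X} {x : X} (hx : x ∈ S) (f : G.ell2)
    {s : ℝ} (hs : 0 ≤ s) :
    HasDerivWithinAt (fun t => heatOp (finiteResolvent h S) t f x)
      (-(((G.degM x + v x + l : ℝ) : ℂ) * heatOp (finiteResolvent h S) s f x
        - ∑ y ∈ S, magneticRate G θ x y * heatOp (finiteResolvent h S) s f y)) (Set.Ici s) s := by
  have h1 : ∀ z, HasDerivWithinAt (fun t => finiteResolvent h S (finiteResolvent h S
      (heatOp (finiteResolvent h S) t f)) z)
      (-finiteResolvent h S (heatOp (finiteResolvent h S) s f) z) (Set.Ici s) s := by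
    intro z
    have := (G.evalCLM z).restrictScalars ℝ |>.hasFDerivAt.comp_hasDerivWithinAt s
      (hasDerivWithinAt_sq_mul_heatOp (finiteResolvent_isPositive h S) f hs)
    simpa only [Function.comp_def, ContinuousLinearMap.coe_restrictScalars', evalCLM_apply,
      map_neg] using this
  -- Strips one factor `R_S` off a differentiable curve, at the vertices of `S`. It is used once
  -- here and once more, with the matrix written out, in `h3`.
  have step : ∀ {u : ℝ → G.ell2} {u' : G.ell2},
      (∀ z ∈ S, HasDerivWithinAt (fun t => finiteResolvent h S (u t) z)
        (-finiteResolvent h S u' z) (Set.Ici s) s) →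
      ∀ z ∈ S, HasDerivWithinAt (fun t => u t z) (-u' z) (Set.Ici s) s := by
    intro u u' hu z hz
    have h2 := ((hu z hz).const_mul ((G.degM z + v z + l : ℝ) : ℂ)).sub
      (HasDerivWithinAt.fun_sum fun y hy => (hu y hy).const_mul (magneticRate G θ z y))
    rw [finiteResolvent_apply_eq h hz u']
    simp only [fun t => finiteResolvent_apply_eq h hz (u t)]
    refine h2.congr_deriv ?_
    simp only [mul_neg, Finset.sum_neg_distrib]
    ring
  have h2 := step (u' := heatOp (finiteResolvent h S) s f) fun z _ => h1 z
  have h3 : ∀ z ∈ S, HasDerivWithinAt (fun t => heatOp (finiteResolvent h S) t f z)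
      (-(((G.degM z + v z + l : ℝ) : ℂ) * heatOp (finiteResolvent h S) s f z
        - ∑ y ∈ S, magneticRate G θ z y * heatOp (finiteResolvent h S) s f y)) (Set.Ici s) s := by
    intro z hz
    have h4 := ((h2 z hz).const_mul ((G.degM z + v z + l : ℝ) : ℂ)).sub
      (HasDerivWithinAt.fun_sum fun y hy => (h2 y hy).const_mul (magneticRate G θ z y))
    refine (h4.congr (fun t _ => finiteResolvent_apply_eq h hz _)
      (finiteResolvent_apply_eq h hz _)).congr_deriv ?_
    simp only [mul_neg, Finset.sum_neg_distrib]
    ring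
  exact h3 x hx

/-- Variation of constants for the semigroup in finite volume. -/
theorem finite_heatOp_duhamel {S : Finset X} {x : X} (hx : x ∈ S) (f : G.ell2) {t : ℝ}
    (ht : 0 ≤ t) :
    (Real.exp (l * t) : ℂ) * heatOp (finiteResolvent h S) t f x
      = Real.exp (-(G.degM x + v x) * t) * (f x + ∫ s in (0 : ℝ)..t,
        Real.exp ((G.degM x + v x) * s) * ∑ y ∈ S, magneticRate G θ x y
          * ((Real.exp (l * s) : ℂ) * heatOp (finiteResolvent h S) s f y)) := by
  obtain ⟨d, hd⟩ : ∃ d, d = G.degM x + v x := ⟨_, rfl⟩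
  rw [← hd]
  set z : X → ℝ → ℂ := fun y s => heatOp (finiteResolvent h S) s f y with hz
  have hzc : ∀ y ∈ S, ContinuousOn (z y) (Set.Ici 0) := fun y hy =>
    continuousOn_finite_heatOp_apply h hy f
  have hexp : ∀ s : ℝ, HasDerivAt (fun s : ℝ => (Real.exp ((d + l) * s) : ℂ))
      ((Real.exp ((d + l) * s) : ℂ) * ((d + l : ℝ) : ℂ)) s := by
    intro s
    have := (((hasDerivAt_id s).const_mul (d + l)).exp).ofReal_comp
    simpa using this
  -- The integrating factor `exp ((d + l) s)` cancels the diagonal; its part `l` undoes the shift of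
  -- the potential.
  have hderiv : ∀ s, 0 ≤ s → HasDerivWithinAt (fun s => (Real.exp ((d + l) * s) : ℂ) * z x s)
      ((Real.exp ((d + l) * s) : ℂ) * ∑ y ∈ S, magneticRate G θ x y * z y s) (Set.Ici s) s := by
    intro s hs
    refine ((hexp s).hasDerivWithinAt.mul
      (hasDerivWithinAt_finite_heatOp_apply h hx f hs)).congr_deriv ?_
    simp only [hz, hd]
    push_cast
    ring
  have hcont : ContinuousOn (fun s => (Real.exp ((d + l) * s) : ℂ) * z x s) (Set.Icc 0 t) :=
    ContinuousOn.mul (by fun_prop) ((hzc x hx).mono Set.Icc_subset_Ici_self)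
  have hint : IntervalIntegrable (fun s => (Real.exp ((d + l) * s) : ℂ)
      * ∑ y ∈ S, magneticRate G θ x y * z y s) volume 0 t := by
    refine ContinuousOn.intervalIntegrable_of_Icc ht ?_
    refine ContinuousOn.mul (by fun_prop) (continuousOn_finsetSum _ fun y hy => ?_)
    exact continuousOn_const.mul ((hzc y hy).mono Set.Icc_subset_Ici_self)
  have key := intervalIntegral.integral_eq_sub_of_hasDeriv_right_of_le ht hcont
    (fun s hs => (hderiv s hs.1.le).mono Set.Ioi_subset_Ici_self) hint
  have h0 : z x 0 = f x := by simp [hz, heatOp_zero (finiteResolvent_isPositive h S)]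
  have e1 : ∀ s, (Real.exp (d * s) : ℂ) * ∑ y ∈ S, magneticRate G θ x y
      * ((Real.exp (l * s) : ℂ) * z y s)
      = (Real.exp ((d + l) * s) : ℂ) * ∑ y ∈ S, magneticRate G θ x y * z y s := by
    intro s
    rw [add_mul, Real.exp_add, Finset.mul_sum, Finset.mul_sum]
    push_cast
    exact Finset.sum_congr rfl fun y _ => by ring
  have e3 : ∫ s in (0 : ℝ)..t, (Real.exp (d * s) : ℂ) * ∑ y ∈ S, magneticRate G θ x y
      * ((Real.exp (l * s) : ℂ) * z y s) = _ :=
    (intervalIntegral.integral_congr fun s _ => e1 s).trans key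
  rw [e3, h0]
  have e2 : (Real.exp (-d * t) : ℂ) * Real.exp ((d + l) * t) = Real.exp (l * t) := by
    rw [← Complex.ofReal_mul, ← Real.exp_add]; congr 2; ring
  simp only [mul_zero, Real.exp_zero, Complex.ofReal_one, one_mul, add_sub_cancel]
  rw [← mul_assoc, e2]

/-- The Dyson expansion of the semigroup in finite volume. -/
theorem tendsto_sum_dysonTerm_heatOp {S : Finset X} {x : X} (hx : x ∈ S) (f : G.ell2) {t : ℝ}
    (ht : 0 ≤ t) :
    Tendsto (fun n => ∑ k ∈ Finset.range n,
        dysonTerm S (fun x => G.degM x + v x) (magneticRate G θ) f k t x) atTop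
      (𝓝 ((Real.exp (l * t) : ℂ) * heatOp (finiteResolvent h S) t f x)) :=
  tendsto_sum_dysonTerm
    (y := fun x t => (Real.exp (l * t) : ℂ) * heatOp (finiteResolvent h S) t f x)
    (fun _ hz => ContinuousOn.mul (by fun_prop) (continuousOn_finite_heatOp_apply h hz f))
    (fun _ hz _ hs => finite_heatOp_duhamel h hz f hs) hx ht

end WeightedGraph

/-! ### Sequences of independent exponential clocks -/

section Clocks

instance isProbabilityMeasure_expMeasure_one : IsProbabilityMeasure (expMeasure 1) :=
  isProbabilityMeasure_expMeasure one_pos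

/-- The law of a sequence of independent exponential variables of parameter `1`. -/
noncomputable def clockLaw : Measure (ℕ → ℝ) := Measure.infinitePi fun _ => expMeasure 1

instance : IsProbabilityMeasure clockLaw := by unfold clockLaw; infer_instance

/-- Prepending a term to a sequence. -/
def consSeq {α : Type*} (a : α) (ξ : ℕ → α) (n : ℕ) : α := Nat.casesOn n a ξ

theorem measurable_consSeq : Measurable fun p : ℝ × (ℕ → ℝ) => consSeq p.1 p.2 := by
  refine measurable_pi_lambda _ fun n => ?_
  cases n with
  | zero => exact measurable_fst
  | succ n => exact (measurable_pi_apply n).comp measurable_snd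

/-- This allows conditioning on the first clock: the remaining clocks again have the law of the
whole sequence. -/
theorem map_consSeq_clockLaw :
    ((expMeasure 1).prod clockLaw).map (fun p => consSeq p.1 p.2) = clockLaw := by
  classical
  refine Measure.eq_infinitePi _ fun s t ht => ?_
  obtain ⟨N, hN⟩ := s.exists_nat_subset_range
  -- Filling the cylinder up with `univ` makes its index set an initial segment, which splits into
  -- the index `0` and a shifted segment.
  let t' : ℕ → Set ℝ := fun i => if i ∈ s then t i else Set.univ
  have ht' : ∀ i, MeasurableSet (t' i) := fun i => by
    simp only [t']; split_ifs
    · exact ht i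
    · exact MeasurableSet.univ
  have hs : s ⊆ Finset.range (N + 1) := hN.trans (Finset.range_mono N.le_succ)
  have h1 : (s : Set ℕ).pi t = (Finset.range (N + 1) : Set ℕ).pi t' := by
    ext x
    simp only [Set.mem_pi, t']
    constructor
    · intro h i _
      split_ifs with his
      · exact h i his
      · trivial
    · intro h i hi
      have := h i (hs hi)
      rwa [if_pos (by exact hi)] at this
  have h2 : ∏ i ∈ s, expMeasure 1 (t i) = ∏ i ∈ Finset.range (N + 1), expMeasure 1 (t' i) := by
    rw [← Finset.prod_subset hs (fun i _ hi => by simp [t', hi])]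
    exact Finset.prod_congr rfl fun i hi => by simp [t', hi]
  have h3 : (fun p : ℝ × (ℕ → ℝ) => consSeq p.1 p.2) ⁻¹' ((Finset.range (N + 1) : Set ℕ).pi t')
      = t' 0 ×ˢ (Finset.range N : Set ℕ).pi fun i => t' (i + 1) := by
    ext p
    simp only [Set.mem_preimage, Set.mem_pi, Finset.coe_range, Set.mem_Iio, Set.mem_prod]
    constructor
    · exact fun h => ⟨h 0 N.succ_pos, fun i hi => h (i + 1) (Nat.succ_lt_succ hi)⟩
    · rintro ⟨h, h'⟩ i hi
      cases i with
      | zero => exact h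
      | succ i => exact h' i (Nat.lt_of_succ_lt_succ hi)
  rw [h1, h2, Measure.map_apply measurable_consSeq
    (MeasurableSet.pi (Finset.countable_toSet _) fun i _ => ht' i), h3, Measure.prod_prod, clockLaw,
    Measure.infinitePi_pi _ fun i _ => ht' (i + 1), Finset.prod_range_succ', mul_comm]

theorem integral_expMeasure_one (g : ℝ → ℂ) :
    ∫ s, g s ∂expMeasure 1 = ∫ s in Set.Ioi (0 : ℝ), (Real.exp (-s) : ℂ) * g s := by
  have h1 : expMeasure 1 = volume.withDensity (exponentialPDF 1) := rfl
  have hm : Measurable (exponentialPDF 1) := (measurable_exponentialPDFReal 1).ennreal_ofReal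
  rw [h1, integral_withDensity_eq_integral_toReal_smul hm
    (Eventually.of_forall fun _ => ENNReal.ofReal_lt_top), ← integral_Ici_eq_integral_Ioi,
    ← integral_indicator measurableSet_Ici]
  refine integral_congr_ae (Eventually.of_forall fun s => ?_)
  simp only [exponentialPDF_eq, Set.indicator_apply, Set.mem_Ici]
  split_ifs with hs
  · rw [ENNReal.toReal_ofReal (by positivity), Complex.real_smul]; simp
  · simp

theorem ae_pos_expMeasure_one : ∀ᵐ s ∂expMeasure 1, 0 < s := by
  have h1 : expMeasure 1 = volume.withDensity (exponentialPDF 1) := rfl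
  have hm : Measurable (exponentialPDF 1) := (measurable_exponentialPDFReal 1).ennreal_ofReal
  rw [h1, ae_withDensity_iff hm]
  filter_upwards [Measure.ae_ne volume (0 : ℝ)] with s hs0 hs
  by_contra hneg
  exact hs (exponentialPDF_of_neg (lt_of_le_of_ne (not_lt.mp hneg) hs0))

theorem ae_pos_clockLaw : ∀ᵐ ξ ∂clockLaw, ∀ n, 0 < ξ n := by
  rw [ae_all_iff]
  intro n
  have h1 : clockLaw.map (fun ξ => ξ n) = expMeasure 1 :=
    Measure.infinitePi_map_eval (μ := fun _ : ℕ => expMeasure 1) n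
  have h2 := ae_pos_expMeasure_one
  rw [← h1] at h2
  exact ae_of_ae_map (measurable_pi_apply n).aemeasurable h2

end Clocks

/-! ### Weights of paths with `n` jumps and the Dyson terms -/

namespace WeightedGraph

variable {X : Type*} (G : WeightedGraph X)

theorem degM_nonneg (x : X) : 0 ≤ G.degM x :=
  mul_nonneg (one_div_nonneg.mpr (G.m_pos x).le) (tsum_nonneg (G.b_nonneg x))

theorem degM_mul_transition (x y : X) : G.degM x * G.transition x y = G.b x y / G.m x := by
  have hm := (G.m_pos x).ne'
  by_cases h : G.degOne x = 0
  · have h1 : G.b x y = 0 := by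
      have := (G.b_summable x).le_tsum y fun z _ => G.b_nonneg x z
      exact le_antisymm (this.trans (le_of_eq h)) (G.b_nonneg x y)
    rw [h1, degM, ← degOne, h]; simp
  · rw [transition, if_neg h, degM, ← degOne]
    field_simp

theorem sum_transition_le_one (x : X) (S : Finset X) : ∑ y ∈ S, G.transition x y ≤ 1 :=
  sum_le_hasSum S (fun y _ => G.transition_nonneg x y) (G.hasSum_transition x)

variable (v : X → ℝ) (θ : X → X → ℝ) (f : X → ℂ) (S : Finset X)

open Classical in
/-- The contribution to the Feynman–Kac–Itô functional, as a function of the chain `y` and the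
clocks `ξ`, of the event that exactly `n` jumps occur before time `t`, all of them into `S`. -/
noncomputable def pathWeight : ℕ → (ℕ → X) → (ℕ → ℝ) → ℝ → ℂ
  -- The condition is not written with a quotient, so that at degree zero a positive clock means no
  -- jump, whereas real division by zero would give holding time `0`.
  | 0, y, ξ, t => if ξ 0 ≤ G.degM (y 0) * t then 0 else Real.exp (-v (y 0) * t) * f (y 0)
  | n + 1, y, ξ, t =>
    if ξ 0 ≤ G.degM (y 0) * t then
      if y 1 ∈ S then
        Real.exp (-v (y 0) * (ξ 0 / G.degM (y 0))) * Complex.exp (Complex.I * (θ (y 0) (y 1) : ℂ))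
          * pathWeight n (fun k => y (k + 1)) (fun k => ξ (k + 1)) (t - ξ 0 / G.degM (y 0))
      else 0
    else 0

open Classical in
/-- The average of `pathWeight` over the Markov chain started at `x`. -/
noncomputable def meanWeight : ℕ → X → (ℕ → ℝ) → ℝ → ℂ
  | 0, x, ξ, t => if ξ 0 ≤ G.degM x * t then 0 else Real.exp (-v x * t) * f x
  | n + 1, x, ξ, t =>
    if ξ 0 ≤ G.degM x * t then
      Real.exp (-v x * (ξ 0 / G.degM x)) * ∑ y ∈ S, G.transition x y
        * Complex.exp (Complex.I * (θ x y : ℂ))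
        * meanWeight n y (fun k => ξ (k + 1)) (t - ξ 0 / G.degM x)
    else 0

section Measurability

variable [MeasurableSpace X] [DiscreteMeasurableSpace X]

theorem measurable_shift {α : Type*} [MeasurableSpace α] :
    Measurable fun (y : ℕ → α) (k : ℕ) => y (k + 1) :=
  measurable_pi_lambda _ fun k => measurable_pi_apply (k + 1)

theorem measurable_pathWeight [Countable X] (n : ℕ) :
    Measurable fun p : (ℕ → X) × (ℕ → ℝ) × ℝ => G.pathWeight v θ f S n p.1 p.2.1 p.2.2 := by
  have hy : ∀ k, Measurable fun p : (ℕ → X) × (ℕ → ℝ) × ℝ => p.1 k := fun k =>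
    (measurable_pi_apply k).comp measurable_fst
  have hξ : Measurable fun p : (ℕ → X) × (ℕ → ℝ) × ℝ => p.2.1 0 :=
    (measurable_pi_apply 0).comp (measurable_fst.comp measurable_snd)
  have ht : Measurable fun p : (ℕ → X) × (ℕ → ℝ) × ℝ => p.2.2 := measurable_snd.comp measurable_snd
  have hX : ∀ {β : Type} [MeasurableSpace β] (g : X → β) (k : ℕ),
      Measurable fun p : (ℕ → X) × (ℕ → ℝ) × ℝ => g (p.1 k) := fun g k =>
    (Measurable.of_discrete (f := g)).comp (hy k)
  have hset : MeasurableSet {p : (ℕ → X) × (ℕ → ℝ) × ℝ | p.2.1 0 ≤ G.degM (p.1 0) * p.2.2} :=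
    measurableSet_le hξ ((hX G.degM 0).mul ht)
  induction n with
  | zero =>
    simp only [pathWeight]
    refine Measurable.ite hset measurable_const ?_
    exact (Complex.measurable_ofReal.comp
      (Real.measurable_exp.comp ((hX (fun x => -v x) 0).mul ht))).mul (hX f 0)
  | succ n ih =>
    simp only [pathWeight]
    refine Measurable.ite hset (Measurable.ite ?_ ?_ measurable_const) measurable_const
    · exact hy 1 (MeasurableSet.of_discrete (s := (S : Set X)))
    · refine Measurable.mul (Measurable.mul ?_ ?_) ?_
      · exact Complex.measurable_ofReal.comp (Real.measurable_exp.comp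
          ((hX (fun x => -v x) 0).mul (hξ.div (hX G.degM 0))))
      · refine Complex.measurable_exp.comp (measurable_const.mul (Complex.measurable_ofReal.comp ?_))
        exact (Measurable.of_discrete (f := fun q : X × X => θ q.1 q.2)).comp ((hy 0).prodMk (hy 1))
      · refine ih.comp (Measurable.prodMk ?_ (Measurable.prodMk ?_ ?_))
        · exact measurable_shift.comp measurable_fst
        · exact measurable_shift.comp (measurable_fst.comp measurable_snd)
        · exact ht.sub (hξ.div (hX G.degM 0))

omit [MeasurableSpace X] [DiscreteMeasurableSpace X] in
theorem measurable_meanWeight (n : ℕ) (x : X) :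
    Measurable fun p : (ℕ → ℝ) × ℝ => G.meanWeight v θ f S n x p.1 p.2 := by
  have hξ : Measurable fun p : (ℕ → ℝ) × ℝ => p.1 0 := (measurable_pi_apply 0).comp measurable_fst
  have hset : MeasurableSet {p : (ℕ → ℝ) × ℝ | p.1 0 ≤ G.degM x * p.2} :=
    measurableSet_le hξ (measurable_snd.const_mul _)
  induction n generalizing x with
  | zero =>
    simp only [meanWeight]
    exact Measurable.ite hset measurable_const (by fun_prop)
  | succ n ih =>
    simp only [meanWeight]
    refine Measurable.ite hset (Measurable.mul (by fun_prop) ?_) measurable_const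
    refine Finset.measurable_fun_sum _ fun y _ => measurable_const.mul ?_
    refine (ih y ?_).comp ((measurable_shift.comp measurable_fst).prodMk
      (measurable_snd.sub (hξ.div_const _)))
    exact measurableSet_le hξ (measurable_snd.const_mul _)

end Measurability

section Bounds

variable {v f S} {M C : ℝ} (hM : ∀ x ∈ S, |v x| ≤ M) (hC : ∀ x ∈ S, ‖f x‖ ≤ C)
include hM hC

omit hC in
theorem norm_exp_neg_mul_le {x : X} (hx : x ∈ S) {t : ℝ} (ht : 0 ≤ t) :
    ‖(Real.exp (-v x * t) : ℂ)‖ ≤ Real.exp (M * t) := by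
  rw [Complex.norm_real, Real.norm_of_nonneg (Real.exp_pos _).le, Real.exp_le_exp]
  exact mul_le_mul_of_nonneg_right ((neg_le_abs _).trans (hM x hx)) ht

omit hM hC in
theorem div_degM_le {x : X} {s t : ℝ} (ht : 0 ≤ t) (hst : s ≤ G.degM x * t) :
    s / G.degM x ≤ t := by
  rcases (G.degM_nonneg x).eq_or_lt with h | h
  · rw [← h, div_zero]; exact ht
  · rwa [div_le_iff₀ h, mul_comm]

/-- A path confined to `S` only sees the bounds of `v` and `f` there, and the successive holding
times add up to `t`; hence the bound does not depend on `n`. -/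
theorem norm_pathWeight_le (n : ℕ) {y : ℕ → X} (hy : y 0 ∈ S) {ξ : ℕ → ℝ} (hξ : ∀ k, 0 ≤ ξ k)
    {t : ℝ} (ht : 0 ≤ t) : ‖G.pathWeight v θ f S n y ξ t‖ ≤ Real.exp (M * t) * C := by
  have hC0 : 0 ≤ C := (norm_nonneg _).trans (hC _ hy)
  induction n generalizing y ξ t with
  | zero =>
    rw [pathWeight]
    split_ifs
    · rw [norm_zero]; positivity
    · rw [norm_mul]
      exact mul_le_mul (norm_exp_neg_mul_le hM hy ht) (hC _ hy) (norm_nonneg _)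
        (Real.exp_pos _).le
  | succ n ih =>
    rw [pathWeight]
    split_ifs with h1 h2
    · have h3 := div_degM_le G ht h1
      have h4 : 0 ≤ ξ 0 / G.degM (y 0) := div_nonneg (hξ 0) (G.degM_nonneg _)
      rw [norm_mul, norm_mul, Complex.norm_exp_I_mul_ofReal, mul_one]
      calc _ ≤ Real.exp (M * (ξ 0 / G.degM (y 0)))
            * (Real.exp (M * (t - ξ 0 / G.degM (y 0))) * C) :=
            mul_le_mul (norm_exp_neg_mul_le hM hy h4)
              (ih h2 (fun k => hξ (k + 1)) (by linarith)) (norm_nonneg _) (Real.exp_pos _).le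
        _ = Real.exp (M * t) * C := by
            rw [← mul_assoc, ← Real.exp_add]; congr 2; ring
    · rw [norm_zero]; positivity
    · rw [norm_zero]; positivity

theorem norm_meanWeight_le (n : ℕ) {x : X} (hx : x ∈ S) {ξ : ℕ → ℝ} (hξ : ∀ k, 0 ≤ ξ k)
    {t : ℝ} (ht : 0 ≤ t) : ‖G.meanWeight v θ f S n x ξ t‖ ≤ Real.exp (M * t) * C := by
  have hC0 : 0 ≤ C := (norm_nonneg _).trans (hC _ hx)
  induction n generalizing x ξ t with
  | zero =>
    rw [meanWeight]
    split_ifs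
    · rw [norm_zero]; positivity
    · rw [norm_mul]
      exact mul_le_mul (norm_exp_neg_mul_le hM hx ht) (hC _ hx) (norm_nonneg _)
        (Real.exp_pos _).le
  | succ n ih =>
    rw [meanWeight]
    split_ifs with h1
    · have h3 := div_degM_le G ht h1
      have h4 : 0 ≤ ξ 0 / G.degM x := div_nonneg (hξ 0) (G.degM_nonneg _)
      have h5 : ‖∑ y ∈ S, (G.transition x y : ℂ) * Complex.exp (Complex.I * (θ x y : ℂ))
          * G.meanWeight v θ f S n y (fun k => ξ (k + 1)) (t - ξ 0 / G.degM x)‖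
          ≤ Real.exp (M * (t - ξ 0 / G.degM x)) * C := by
        refine (norm_sum_le _ _).trans ?_
        calc _ ≤ ∑ y ∈ S, G.transition x y * (Real.exp (M * (t - ξ 0 / G.degM x)) * C) := by
              refine Finset.sum_le_sum fun y hy => ?_
              rw [norm_mul, norm_mul, Complex.norm_exp_I_mul_ofReal, mul_one, Complex.norm_real,
                Real.norm_of_nonneg (G.transition_nonneg x y)]
              exact mul_le_mul_of_nonneg_left (ih hy (fun k => hξ (k + 1)) (by linarith))
                (G.transition_nonneg x y)
          _ = (∑ y ∈ S, G.transition x y) * (Real.exp (M * (t - ξ 0 / G.degM x)) * C) := by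
              rw [Finset.sum_mul]
          _ ≤ 1 * (Real.exp (M * (t - ξ 0 / G.degM x)) * C) :=
              mul_le_mul_of_nonneg_right (G.sum_transition_le_one x S) (by positivity)
          _ = _ := one_mul _
      rw [norm_mul]
      calc _ ≤ Real.exp (M * (ξ 0 / G.degM x)) * (Real.exp (M * (t - ξ 0 / G.degM x)) * C) :=
            mul_le_mul (norm_exp_neg_mul_le hM hx h4) h5 (norm_nonneg _) (Real.exp_pos _).le
        _ = Real.exp (M * t) * C := by
            rw [← mul_assoc, ← Real.exp_add]; congr 2; ring
    · rw [norm_zero]; positivity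

end Bounds

theorem exists_bound_on_finset (g : X → ℝ) : ∃ M, 0 ≤ M ∧ ∀ x ∈ S, |g x| ≤ M :=
  ⟨∑ x ∈ S, |g x|, Finset.sum_nonneg fun _ _ => abs_nonneg _, fun _ hx =>
    Finset.single_le_sum (f := fun x => |g x|) (fun _ _ => abs_nonneg _) hx⟩

theorem integrable_meanWeight (n : ℕ) {x : X} (hx : x ∈ S) {t : ℝ} (ht : 0 ≤ t) :
    Integrable (fun ξ => G.meanWeight v θ f S n x ξ t) clockLaw := by
  obtain ⟨M, -, hM⟩ := exists_bound_on_finset S v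
  obtain ⟨C, -, hC⟩ := exists_bound_on_finset S fun x => ‖f x‖
  refine Integrable.of_bound ((G.measurable_meanWeight v θ f S n x).comp
    (measurable_id.prodMk measurable_const)).aestronglyMeasurable (Real.exp (M * t) * C) ?_
  filter_upwards [ae_pos_clockLaw] with ξ hξ
  exact G.norm_meanWeight_le θ hM (fun x hx => by simpa using hC x hx) n hx
    (fun k => (hξ k).le) ht

theorem integral_meanWeight_zero (x : X) {t : ℝ} (ht : 0 ≤ t) :
    ∫ ξ, G.meanWeight v θ f S 0 x ξ t ∂clockLaw
      = Real.exp (-(G.degM x + v x) * t) * f x := by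
  have h1 : clockLaw.map (fun ξ => ξ 0) = expMeasure 1 :=
    Measure.infinitePi_map_eval (μ := fun _ : ℕ => expMeasure 1) 0
  set c : ℂ := Real.exp (-v x * t) * f x
  have hD : 0 ≤ G.degM x * t := mul_nonneg (G.degM_nonneg x) ht
  have hm : Measurable fun s : ℝ => if s ≤ G.degM x * t then (0 : ℂ) else c :=
    Measurable.ite measurableSet_Iic measurable_const measurable_const
  have h2 : ∫ ξ, G.meanWeight v θ f S 0 x ξ t ∂clockLaw
      = ∫ s, (if s ≤ G.degM x * t then (0 : ℂ) else c) ∂expMeasure 1 := by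
    rw [← h1, integral_map (measurable_pi_apply 0).aemeasurable hm.aestronglyMeasurable]
    rfl
  have h3 : ∀ s : ℝ, (Real.exp (-s) : ℂ) * (if s ≤ G.degM x * t then (0 : ℂ) else c)
      = Set.indicator (Set.Ioi (G.degM x * t)) (fun s => (Real.exp (-s) : ℂ) * c) s := by
    intro s
    by_cases hs : s ≤ G.degM x * t <;> simp [hs, Set.indicator_apply]
  rw [h2, integral_expMeasure_one]
  simp only [h3]
  rw [setIntegral_indicator measurableSet_Ioi, Set.Ioi_inter_Ioi, sup_eq_right.mpr hD,
    integral_mul_const, integral_complex_ofReal, integral_exp_neg_Ioi, ← mul_assoc,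
    ← Complex.ofReal_mul, ← Real.exp_add]
  congr 3; ring

/-- First-jump decomposition: integrate out the first clock and substitute the holding time `s / D`.
The Jacobian `D` times the transition probability is the jump rate. If `D = 0`, both sides vanish.
-/
theorem integral_meanWeight_succ (n : ℕ) {x : X} (hx : x ∈ S) {t : ℝ} (ht : 0 ≤ t) :
    ∫ ξ, G.meanWeight v θ f S (n + 1) x ξ t ∂clockLaw
      = ∫ s in (0 : ℝ)..t, (Real.exp (-(G.degM x + v x) * s) : ℂ) * ∑ y ∈ S, magneticRate G θ x y
        * ∫ ξ, G.meanWeight v θ f S n y ξ (t - s) ∂clockLaw := by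
  have hD0 := G.degM_nonneg x
  set D := G.degM x with hD
  have hmeas : Measurable fun ξ => G.meanWeight v θ f S (n + 1) x ξ t :=
    (G.measurable_meanWeight v θ f S (n + 1) x).comp (measurable_id.prodMk measurable_const)
  have hint : Integrable (fun p : ℝ × (ℕ → ℝ) =>
      G.meanWeight v θ f S (n + 1) x (consSeq p.1 p.2) t) ((expMeasure 1).prod clockLaw) := by
    have := G.integrable_meanWeight v θ f S (n + 1) hx ht
    rw [← map_consSeq_clockLaw] at this
    exact this.comp_measurable measurable_consSeq
  have h1 : ∫ ξ, G.meanWeight v θ f S (n + 1) x ξ t ∂clockLaw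
      = ∫ s, ∫ ξ, G.meanWeight v θ f S (n + 1) x (consSeq s ξ) t ∂clockLaw ∂expMeasure 1 := by
    rw [← integral_prod _ hint]
    conv_lhs => rw [← map_consSeq_clockLaw]
    exact integral_map measurable_consSeq.aemeasurable hmeas.aestronglyMeasurable
  set g : ℝ → ℂ := fun s => Real.exp (-v x * s) * ∑ y ∈ S, (G.transition x y : ℂ)
    * Complex.exp (Complex.I * (θ x y : ℂ)) * ∫ ξ, G.meanWeight v θ f S n y ξ (t - s) ∂clockLaw
    with hg
  have h2 : ∀ s, ∫ ξ, G.meanWeight v θ f S (n + 1) x (consSeq s ξ) t ∂clockLaw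
      = if s ≤ D * t then g (s / D) else 0 := by
    intro s
    have h3 : ∀ ξ, G.meanWeight v θ f S (n + 1) x (consSeq s ξ) t = if s ≤ D * t then
        Real.exp (-v x * (s / D)) * ∑ y ∈ S, (G.transition x y : ℂ)
          * Complex.exp (Complex.I * (θ x y : ℂ)) * G.meanWeight v θ f S n y ξ (t - s / D) else 0 :=
      fun ξ => rfl
    simp only [h3]
    split_ifs with hs
    · have h4 : 0 ≤ t - s / D := by
        have := div_degM_le G ht hs
        linarith
      rw [integral_const_mul, integral_finsetSum _ fun y hy =>
        (G.integrable_meanWeight v θ f S n hy h4).const_mul _]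
      simp only [integral_const_mul, hg]
    · simp
  rw [h1]
  simp only [h2]
  have h5 : ∀ s : ℝ, (Real.exp (-s) : ℂ) * (if s ≤ D * t then g (s / D) else 0)
      = Set.indicator (Set.Iic (D * t)) (fun s => (Real.exp (-s) : ℂ) * g (s / D)) s := by
    intro s
    by_cases hs : s ≤ D * t <;> simp [hs]
  rw [integral_expMeasure_one]
  simp only [h5]
  rw [setIntegral_indicator measurableSet_Iic, Set.Ioi_inter_Iic,
    ← intervalIntegral.integral_of_le (mul_nonneg hD0 ht)]
  have h6 : ∀ s, (Real.exp (-(D + v x) * s) : ℂ) * ∑ y ∈ S, magneticRate G θ x y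
        * ∫ ξ, G.meanWeight v θ f S n y ξ (t - s) ∂clockLaw
      = D * ((Real.exp (-(D * s)) : ℂ) * g s) := by
    intro s
    have h7 : Real.exp (-(D + v x) * s) = Real.exp (-(D * s)) * Real.exp (-v x * s) := by
      rw [← Real.exp_add]; congr 1; ring
    rw [h7, hg]
    push_cast
    simp only [Finset.mul_sum]
    refine Finset.sum_congr rfl fun y _ => ?_
    rw [magneticRate, ← degM_mul_transition, ← hD]
    push_cast
    ring
  simp only [h6]
  rw [intervalIntegral.integral_const_mul]
  rcases hD0.eq_or_lt with h0 | h0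
  · rw [← h0]; simp
  · have h8 := intervalIntegral.integral_comp_mul_left (a := 0) (b := t)
      (fun s => (Real.exp (-s) : ℂ) * g (s / D)) h0.ne'
    rw [mul_zero, Complex.real_smul] at h8
    have h9 : ∀ s, D * s / D = s := fun s => by field_simp
    simp only [h9] at h8
    rw [h8, Complex.ofReal_inv, ← mul_assoc, mul_inv_cancel₀ (by exact_mod_cast h0.ne'), one_mul]

/-- The bridge between probability and analysis: after reversing time by `s ↦ t - s`, the first-jump
decomposition is the Dyson recursion. -/
theorem integral_meanWeight_eq_dysonTerm (n : ℕ) {x : X} (hx : x ∈ S) {t : ℝ} (ht : 0 ≤ t) :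
    ∫ ξ, G.meanWeight v θ f S n x ξ t ∂clockLaw
      = dysonTerm S (fun x => G.degM x + v x) (magneticRate G θ) f n t x := by
  induction n generalizing x t with
  | zero => rw [integral_meanWeight_zero G v θ f S x ht, dysonTerm]
  | succ n ih =>
    rw [integral_meanWeight_succ G v θ f S n hx ht, dysonTerm,
      ← intervalIntegral.integral_const_mul]
    have h1 := intervalIntegral.integral_comp_sub_left (a := 0) (b := t) (fun s =>
      (Real.exp (-(G.degM x + v x) * (t - s)) : ℂ) * ∑ y ∈ S, magneticRate G θ x y
        * ∫ ξ, G.meanWeight v θ f S n y ξ s ∂clockLaw) t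
    simp only [sub_sub_cancel, sub_self, sub_zero] at h1
    rw [h1]
    refine intervalIntegral.integral_congr fun s hs => ?_
    rw [Set.uIcc_of_le ht] at hs
    rw [← mul_assoc, ← Complex.ofReal_mul, ← Real.exp_add]
    congr 1
    · congr 2; ring
    · exact Finset.sum_congr rfl fun y hy => by rw [ih hy hs.1]

end WeightedGraph

/-! ### Averaging over the Markov chain and the clocks -/

namespace WeightedGraph

variable {X : Type*} [MeasurableSpace X] [DiscreteMeasurableSpace X] {G : WeightedGraph X}
  {Ω : Type*} [MeasurableSpace Ω] {P : Measure Ω} {Y : ℕ → Ω → X} {ξ : ℕ → Ω → ℝ}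

namespace IsJumpData

variable (hJ : G.IsJumpData P Y ξ)
include hJ

omit [DiscreteMeasurableSpace X] in
theorem measurable_chain_shift (m : ℕ) : Measurable fun ω k => Y (m + k) ω :=
  measurable_pi_lambda _ fun k => hJ.measurable_chain (m + k)

theorem measurableSet_cylinder (m : ℕ) (z : ℕ → X) :
    MeasurableSet {ω | ∀ k ≤ m, Y k ω = z k} := by
  have h : {ω | ∀ k ≤ m, Y k ω = z k} = ⋂ k ∈ Set.Iic m, Y k ⁻¹' {z k} := by
    ext ω; simp
  rw [h]
  exact MeasurableSet.biInter (Set.to_countable _) fun k _ =>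
    hJ.measurable_chain k (MeasurableSet.of_discrete)

theorem measurableSet_initial (x : X) : MeasurableSet {ω | Y 0 ω = x} :=
  hJ.measurable_chain 0 (MeasurableSet.of_discrete (s := {x}))

omit [DiscreteMeasurableSpace X] in
theorem measure_cylinder_update (m : ℕ) (z : ℕ → X) (y : X) :
    P ({ω | ∀ k ≤ m, Y k ω = z k} ∩ {ω | Y (m + 1) ω = y})
      = P {ω | ∀ k ≤ m, Y k ω = z k} * ENNReal.ofReal (G.transition (z m) y) := by
  classical
  have h := hJ.markov m (Function.update z (m + 1) y)
  have h1 : ∀ k ≤ m, Function.update z (m + 1) y k = z k := fun k hk =>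
    Function.update_of_ne (by omega) _ _
  rw [Function.update_self, h1 m le_rfl] at h
  convert h using 2
  · ext ω
    simp only [Set.mem_inter_iff, Set.mem_ofPred_eq]
    constructor
    · rintro ⟨h2, h3⟩ k hk
      rcases Nat.le_succ_iff.mp hk with hk | rfl
      · rw [h1 k hk, h2 k hk]
      · rw [Function.update_self, h3]
    · intro h2
      refine ⟨fun k hk => by rw [h2 k (by omega), h1 k hk], ?_⟩
      rw [h2 (m + 1) le_rfl, Function.update_self]
  · congr 1
    ext ω
    simp only [Set.mem_ofPred_eq]
    exact forall₂_congr fun k hk => by rw [h1 k hk]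

/-- Averaging `pathWeight` over the chain, given its first `m` steps. -/
theorem setIntegral_pathWeight_cylinder [Countable X] [IsProbabilityMeasure P] (v : X → ℝ)
    (θ : X → X → ℝ) (f : X → ℂ) (S : Finset X) (n m : ℕ) {z : ℕ → X}
    {s : ℕ → ℝ} (hs : ∀ k, 0 ≤ s k) {t : ℝ} (ht : 0 ≤ t) :
    ∫ ω in {ω | ∀ k ≤ m, Y k ω = z k}, G.pathWeight v θ f S n (fun k => Y (m + k) ω) s t ∂P
      = P.real {ω | ∀ k ≤ m, Y k ω = z k} * G.meanWeight v θ f S n (z m) s t := by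
  classical
  -- The Markov property is given only for cylinders starting at time `0`. Hence the whole past up
  -- to `m` is carried along, and each jump lengthens the cylinder by one.
  induction n generalizing m z s t with
  | zero =>
    rw [setIntegral_congr_fun (g := fun _ => G.meanWeight v θ f S 0 (z m) s t)
      (hJ.measurableSet_cylinder m z)]
    · rw [setIntegral_const, Complex.real_smul]
    · intro ω hω
      simp only [pathWeight, meanWeight, add_zero, hω m le_rfl]
  | succ n ih =>
    by_cases h0 : s 0 ≤ G.degM (z m) * t
    swap
    · rw [setIntegral_congr_fun (g := fun _ => 0) (hJ.measurableSet_cylinder m z)]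
      · rw [meanWeight, if_neg h0]; simp
      · intro ω hω
        simp only [pathWeight, add_zero, hω m le_rfl, if_neg h0]
    obtain ⟨M, -, hM⟩ := exists_bound_on_finset S v
    obtain ⟨C, hC0, hC⟩ := exists_bound_on_finset S fun x => ‖f x‖
    have hC' : ∀ x ∈ S, ‖f x‖ ≤ C := fun x hx => by simpa using hC x hx
    have ht' : 0 ≤ t - s 0 / G.degM (z m) := sub_nonneg.mpr (div_degM_le G ht h0)
    set r := t - s 0 / G.degM (z m)
    have hB : ∀ y, MeasurableSet {ω | Y (m + 1) ω = y} := fun y =>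
      hJ.measurable_chain (m + 1) (MeasurableSet.of_discrete (s := {y}))
    set F : Ω → ℂ := fun ω => G.pathWeight v θ f S n (fun k => Y (m + 1 + k) ω)
      (fun k => s (k + 1)) r with hF
    have hFm : Measurable F := (G.measurable_pathWeight v θ f S n).comp
      ((hJ.measurable_chain_shift (m + 1)).prodMk (measurable_const.prodMk measurable_const))
    have hFi : ∀ y ∈ S, Integrable ({ω | Y (m + 1) ω = y}.indicator F)
        (P.restrict {ω | ∀ k ≤ m, Y k ω = z k}) := by
      intro y hy
      refine Integrable.of_bound (hFm.indicator (hB y)).aestronglyMeasurable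
        (Real.exp (M * r) * C) (Eventually.of_forall fun ω => ?_)
      rw [Set.indicator_apply]
      split_ifs with hω
      · exact G.norm_pathWeight_le θ hM hC' n (y := fun k => Y (m + 1 + k) ω)
          (by rw [add_zero, show Y (m + 1) ω = y from hω]; exact hy) (fun k => hs (k + 1)) ht'
      · rw [norm_zero]; positivity
    have h1 : ∀ y ∈ S, ∫ ω in {ω | ∀ k ≤ m, Y k ω = z k}, {ω | Y (m + 1) ω = y}.indicator F ω ∂P
        = P.real {ω | ∀ k ≤ m, Y k ω = z k} * (G.transition (z m) y
          * G.meanWeight v θ f S n y (fun k => s (k + 1)) r) := by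
      intro y _
      have h2 : {ω | ∀ k ≤ m, Y k ω = z k} ∩ {ω | Y (m + 1) ω = y}
          = {ω | ∀ k ≤ m + 1, Y k ω = Function.update z (m + 1) y k} := by
        ext ω
        simp only [Set.mem_inter_iff, Set.mem_ofPred_eq]
        constructor
        · rintro ⟨h2, h3⟩ k hk
          rcases Nat.le_succ_iff.mp hk with hk | rfl
          · rw [Function.update_of_ne (by omega), h2 k hk]
          · rw [Function.update_self, h3]
        · intro h2
          refine ⟨fun k hk => by rw [h2 k (by omega), Function.update_of_ne (by omega)], ?_⟩
          rw [h2 (m + 1) le_rfl, Function.update_self]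
      rw [setIntegral_indicator (hB y), h2, ih (m + 1) (fun k => hs (k + 1)) ht', ← h2,
        Function.update_self, measureReal_def, hJ.measure_cylinder_update, ENNReal.toReal_mul,
        ENNReal.toReal_ofReal (G.transition_nonneg _ _), measureReal_def]
      push_cast
      ring
    rw [setIntegral_congr_fun (g := fun ω => Real.exp (-v (z m) * (s 0 / G.degM (z m)))
      * ∑ y ∈ S, Complex.exp (Complex.I * (θ (z m) y : ℂ)) * {ω | Y (m + 1) ω = y}.indicator F ω)
      (hJ.measurableSet_cylinder m z)]
    · rw [integral_const_mul, integral_finsetSum _ fun y hy => (hFi y hy).const_mul _,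
        meanWeight, if_pos h0, mul_left_comm, Finset.mul_sum (a := ((P.real _ : ℝ) : ℂ))]
      congr 1
      refine Finset.sum_congr rfl fun y hy => ?_
      rw [integral_const_mul, h1 y hy]
      ring
    · intro ω hω
      have h3 : (fun k => Y (m + (k + 1)) ω) = fun k => Y (m + 1 + k) ω :=
        funext fun k => by rw [add_assoc m 1 k, add_comm 1 k]
      simp only [pathWeight, add_zero, hω m le_rfl, if_pos h0, Set.indicator_apply,
        Set.mem_ofPred_eq, mul_ite, mul_zero, h3]
      rw [Finset.sum_ite_eq]
      split_ifs
      · rw [mul_assoc]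
      · rw [mul_zero]

omit [DiscreteMeasurableSpace X] in
-- The holding time in state `Y k` uses the clock with index `k + 1`, so the clock with index `0` is
-- discarded.
theorem map_clock_shift [IsProbabilityMeasure P] :
    P.map (fun ω k => ξ (k + 1) ω) = clockLaw := by
  have h1 := hJ.clock_indep.precomp (g := fun k : ℕ => k + 1) (fun i j h => by simpa using h)
  have h2 := (iIndepFun_iff_map_fun_eq_infinitePi_map
    (fun k => hJ.measurable_clock (k + 1))).mp h1
  simp only [hJ.clock_law] at h2
  exact h2

omit [DiscreteMeasurableSpace X] in
theorem ae_pos_clock [IsProbabilityMeasure P] : ∀ᵐ ω ∂P, ∀ k, 0 < ξ (k + 1) ω := by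
  have h := ae_pos_clockLaw
  rw [← hJ.map_clock_shift] at h
  exact ae_of_ae_map (measurable_pi_lambda _ fun k => hJ.measurable_clock (k + 1)).aemeasurable h

omit [DiscreteMeasurableSpace X] in
theorem map_chain_clock [IsProbabilityMeasure P] :
    P.map (fun ω => ((fun k => Y k ω), fun k => ξ (k + 1) ω))
      = (P.map fun ω k => Y k ω).prod clockLaw := by
  have h1 : IndepFun (fun ω k => Y k ω) (fun ω k => ξ (k + 1) ω) P :=
    hJ.chain_indep_clock.comp measurable_id measurable_shift
  rw [← hJ.map_clock_shift]
  exact (indepFun_iff_map_prod_eq_prod_map_map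
    (measurable_pi_lambda _ hJ.measurable_chain).aemeasurable
    (measurable_pi_lambda _ fun k => hJ.measurable_clock (k + 1)).aemeasurable).mp h1

/-- Chain and clocks are independent, so Fubini applies: the inner integral averages over the chain
with frozen clocks, and the outer one produces the Dyson term. -/
theorem setIntegral_pathWeight [Countable X] [IsProbabilityMeasure P] (v : X → ℝ)
    (θ : X → X → ℝ) (f : X → ℂ) {S : Finset X} (n : ℕ) {x : X} (hx : x ∈ S) {t : ℝ} (ht : 0 ≤ t) :
    ∫ ω in {ω | Y 0 ω = x}, G.pathWeight v θ f S n (fun k => Y k ω) (fun k => ξ (k + 1) ω) t ∂P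
      = P.real {ω | Y 0 ω = x}
        * dysonTerm S (fun x => G.degM x + v x) (magneticRate G θ) f n t x := by
  classical
  obtain ⟨M, -, hM⟩ := exists_bound_on_finset S v
  obtain ⟨C, hC0, hC⟩ := exists_bound_on_finset S fun x => ‖f x‖
  have hC' : ∀ x ∈ S, ‖f x‖ ≤ C := fun x hx => by simpa using hC x hx
  have hYm : Measurable fun ω k => Y k ω := measurable_pi_lambda _ hJ.measurable_chain
  have hξm : Measurable fun ω k => ξ (k + 1) ω :=
    measurable_pi_lambda _ fun k => hJ.measurable_clock (k + 1)
  have : IsProbabilityMeasure (P.map fun ω k => Y k ω) :=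
    Measure.isProbabilityMeasure_map hYm.aemeasurable
  have hA : MeasurableSet {y : ℕ → X | y 0 = x} :=
    measurable_pi_apply (X := fun _ : ℕ => X) 0 (MeasurableSet.of_discrete (s := {x}))
  set g : (ℕ → X) × (ℕ → ℝ) → ℂ := fun p =>
    {y : ℕ → X | y 0 = x}.indicator (fun y => G.pathWeight v θ f S n y p.2 t) p.1 with hg
  have hgm : Measurable g := by
    have h1 : g = (Prod.fst ⁻¹' {y : ℕ → X | y 0 = x}).indicator
        fun p : (ℕ → X) × (ℕ → ℝ) => G.pathWeight v θ f S n p.1 p.2 t := rfl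
    rw [h1]
    exact ((G.measurable_pathWeight v θ f S n).comp (measurable_fst.prodMk
      (measurable_snd.prodMk measurable_const))).indicator (measurable_fst hA)
  have hgi : Integrable g ((P.map fun ω k => Y k ω).prod clockLaw) := by
    refine Integrable.of_bound hgm.aestronglyMeasurable (Real.exp (M * t) * C) ?_
    have h2 : ∀ᵐ p ∂(P.map fun ω k => Y k ω).prod clockLaw, ∀ n, 0 < p.2 n :=
      Measure.quasiMeasurePreserving_snd.ae ae_pos_clockLaw
    filter_upwards [h2] with p hp
    simp only [hg, Set.indicator_apply, Set.mem_ofPred_eq]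
    split_ifs with h3
    · exact G.norm_pathWeight_le θ hM hC' n (by rw [h3]; exact hx) (fun k => (hp k).le) ht
    · rw [norm_zero]; positivity
  calc ∫ ω in {ω | Y 0 ω = x}, G.pathWeight v θ f S n (fun k => Y k ω) (fun k => ξ (k + 1) ω) t ∂P
      = ∫ ω, g ((fun k => Y k ω), fun k => ξ (k + 1) ω) ∂P := by
        rw [← integral_indicator (hJ.measurableSet_initial x)]
        rfl
    _ = ∫ p, g p ∂(P.map fun ω k => Y k ω).prod clockLaw := by
        rw [← hJ.map_chain_clock, integral_map (hYm.prodMk hξm).aemeasurable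
          hgm.aestronglyMeasurable]
    _ = ∫ s, ∫ y, g (y, s) ∂(P.map fun ω k => Y k ω) ∂clockLaw := integral_prod_symm _ hgi
    _ = ∫ s, P.real {ω | Y 0 ω = x} * G.meanWeight v θ f S n x s t ∂clockLaw := by
        refine integral_congr_ae ?_
        filter_upwards [ae_pos_clockLaw] with s hs
        have h4 := hJ.setIntegral_pathWeight_cylinder v θ f S n 0 (z := fun _ => x)
          (fun k => (hs k).le) ht
        have h5 : {ω | ∀ k ≤ 0, Y k ω = x} = {ω | Y 0 ω = x} := by ext ω; simp
        rw [h5] at h4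
        have h6 : Measurable fun y => g (y, s) := hgm.comp measurable_prodMk_right
        rw [← h4, integral_map hYm.aemeasurable h6.aestronglyMeasurable,
          ← integral_indicator (hJ.measurableSet_initial x)]
        simp only [zero_add]
        rfl
    _ = _ := by rw [integral_const_mul, integral_meanWeight_eq_dysonTerm G v θ f S n hx ht]

end IsJumpData

end WeightedGraph

/-! ### Jump times and the functional along a single path -/

namespace WeightedGraph

section Arrival

variable {X : Type*} (G : WeightedGraph X)

/-- The time of the `n`-th jump as a function of the chain `y` and the clocks `s`. -/
noncomputable def arrival (n : ℕ) (y : ℕ → X) (s : ℕ → ℝ) : ℝ≥0∞ :=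
  ∑ k ∈ Finset.range n, ENNReal.ofReal (s k) / ENNReal.ofReal (G.degM (y k))

theorem arrival_zero (y : ℕ → X) (s : ℕ → ℝ) : G.arrival 0 y s = 0 := Finset.sum_range_zero _

theorem arrival_succ (n : ℕ) (y : ℕ → X) (s : ℕ → ℝ) :
    G.arrival (n + 1) y s
      = G.arrival n y s + ENNReal.ofReal (s n) / ENNReal.ofReal (G.degM (y n)) :=
  Finset.sum_range_succ _ _

theorem arrival_succ' (n : ℕ) (y : ℕ → X) (s : ℕ → ℝ) :
    G.arrival (n + 1) y s = G.arrival n (fun k => y (k + 1)) (fun k => s (k + 1))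
      + ENNReal.ofReal (s 0) / ENNReal.ofReal (G.degM (y 0)) :=
  Finset.sum_range_succ' _ _

theorem degM_pos_of_le {x : X} {s t : ℝ} (hs : 0 < s) (h : s ≤ G.degM x * t) :
    0 < G.degM x := by
  rcases (G.degM_nonneg x).eq_or_lt with h0 | h0
  · rw [← h0, zero_mul] at h; exact absurd h (not_le.mpr hs)
  · exact h0

/-- Valid at degree zero as well, where the extended quotient is `∞` for a positive clock. -/
theorem ofReal_div_degM_le_iff {x : X} {s t : ℝ} (ht : 0 ≤ t) :
    ENNReal.ofReal s / ENNReal.ofReal (G.degM x) ≤ ENNReal.ofReal t ↔ s ≤ G.degM x * t := by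
  have hD := G.degM_nonneg x
  rw [ENNReal.div_le_iff_le_mul (Or.inr ENNReal.ofReal_ne_top)
      (Or.inl ENNReal.ofReal_ne_top), ← ENNReal.ofReal_mul ht,
    ENNReal.ofReal_le_ofReal_iff (mul_nonneg ht hD), mul_comm]

variable (v : X → ℝ) (θ : X → X → ℝ) (f : X → ℂ) (S : Finset X)

/-- The value of the Feynman–Kac–Itô functional if exactly `n` jumps occur before time `t`. -/
noncomputable def jumpWeight (n : ℕ) (y : ℕ → X) (s : ℕ → ℝ) (t : ℝ) : ℂ :=
  Complex.exp (Complex.I * ((∑ k ∈ Finset.range n, θ (y k) (y (k + 1)) : ℝ) : ℂ)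
    - ((∑ k ∈ Finset.range n, s k / G.degM (y k) * v (y k)
      + (t - ∑ k ∈ Finset.range n, s k / G.degM (y k)) * v (y n) : ℝ) : ℂ)) * f (y n)

open Classical in
-- Unrolls the recursion: shifting time by the first holding time turns the event of `n + 1` jumps
-- into that of `n` jumps for the shifted path, and the weights multiply.
theorem pathWeight_eq (n : ℕ) (y : ℕ → X) {s : ℕ → ℝ} (hs : ∀ k, 0 < s k) {t : ℝ} (ht : 0 ≤ t) :
    G.pathWeight v θ f S n y s t
      = if (G.arrival n y s ≤ ENNReal.ofReal t ∧ ENNReal.ofReal t < G.arrival (n + 1) y s)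
          ∧ ∀ k < n, y (k + 1) ∈ S then G.jumpWeight v θ f n y s t else 0 := by
  induction n generalizing y s t with
  | zero =>
    have h1 : ENNReal.ofReal t < G.arrival 1 y s ↔ ¬ s 0 ≤ G.degM (y 0) * t := by
      rw [← ofReal_div_degM_le_iff G ht, not_le, arrival_succ, arrival_zero, zero_add]
    rw [pathWeight]
    simp only [arrival_zero, zero_le, true_and, zero_add, h1, Nat.not_lt_zero, false_imp_iff,
      implies_true, and_true]
    by_cases h : s 0 ≤ G.degM (y 0) * t
    · simp [h]
    · simp only [h, if_false, not_false_eq_true, if_true, jumpWeight, Finset.sum_range_zero]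
      push_cast
      congr 2
      ring
  | succ n ih =>
    rw [pathWeight]
    by_cases h : s 0 ≤ G.degM (y 0) * t
    · have hD := G.degM_pos_of_le (hs 0) h
      have ht' : 0 ≤ t - s 0 / G.degM (y 0) := sub_nonneg.mpr (div_degM_le G ht h)
      have hr : 0 ≤ s 0 / G.degM (y 0) := (div_pos (hs 0) hD).le
      have h1 : ENNReal.ofReal t = ENNReal.ofReal (t - s 0 / G.degM (y 0))
          + ENNReal.ofReal (s 0) / ENNReal.ofReal (G.degM (y 0)) := by
        rw [← ENNReal.ofReal_div_of_pos hD, ← ENNReal.ofReal_add ht' hr, sub_add_cancel]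
      have h2 : ENNReal.ofReal (s 0) / ENNReal.ofReal (G.degM (y 0)) ≠ ⊤ := by
        rw [← ENNReal.ofReal_div_of_pos hD]; exact ENNReal.ofReal_ne_top
      have h3 : (∀ k < n + 1, y (k + 1) ∈ S) ↔ y 1 ∈ S ∧ ∀ k < n, y (k + 1 + 1) ∈ S := by
        constructor
        · exact fun h => ⟨h 0 n.succ_pos, fun k hk => h (k + 1) (by omega)⟩
        · rintro ⟨h, h'⟩ k hk
          cases k with
          | zero => exact h
          | succ k => exact h' k (by omega)
      have h4 : G.jumpWeight v θ f (n + 1) y s t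
          = Real.exp (-v (y 0) * (s 0 / G.degM (y 0)))
            * Complex.exp (Complex.I * (θ (y 0) (y 1) : ℂ))
            * G.jumpWeight v θ f n (fun k => y (k + 1)) (fun k => s (k + 1))
              (t - s 0 / G.degM (y 0)) := by
        simp only [jumpWeight, Finset.sum_range_succ']
        rw [Complex.ofReal_exp, ← Complex.exp_add, ← mul_assoc, ← Complex.exp_add]
        congr 2
        push_cast
        ring
      have h5 : ((G.arrival (n + 1) y s ≤ ENNReal.ofReal t ∧
          ENNReal.ofReal t < G.arrival (n + 1 + 1) y s) ∧ ∀ k < n + 1, y (k + 1) ∈ S) ↔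
          y 1 ∈ S ∧ (G.arrival n (fun k => y (k + 1)) (fun k => s (k + 1))
            ≤ ENNReal.ofReal (t - s 0 / G.degM (y 0)) ∧ ENNReal.ofReal (t - s 0 / G.degM (y 0))
            < G.arrival (n + 1) (fun k => y (k + 1)) (fun k => s (k + 1)))
            ∧ ∀ k < n, y (k + 1 + 1) ∈ S := by
        rw [h1, arrival_succ' G n y, arrival_succ' G (n + 1) y, h3,
          ENNReal.add_le_add_iff_right h2, ENNReal.add_lt_add_iff_right h2]
        tauto
      rw [if_pos h, ih (fun k => y (k + 1)) (fun k => hs (k + 1)) ht', h4]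
      simp only [h5]
      by_cases h6 : y 1 ∈ S
      · simp only [h6, if_true, true_and, mul_ite, mul_zero]
      · simp only [h6, if_false, false_and]
    · rw [if_neg h, if_neg]
      rintro ⟨⟨h1, -⟩, -⟩
      rw [← ofReal_div_degM_le_iff G ht] at h
      rw [arrival_succ'] at h1
      exact h (le_add_self.trans h1)

end Arrival

section Pathwise

variable {X Ω : Type*} {G : WeightedGraph X} {Y : ℕ → Ω → X} {ξ : ℕ → Ω → ℝ} {ω : Ω}

theorem jumpTime_eq_arrival (n : ℕ) :
    G.jumpTime Y ξ n ω = G.arrival n (fun k => Y k ω) fun k => ξ (k + 1) ω := by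
  induction n with
  | zero => simp [jumpTime, arrival]
  | succ n ih =>
    rw [arrival_succ, ← ih, jumpTime, Finset.sum_Icc_succ_top (by omega), jumpTime]
    simp

theorem exists_jumpTime_le_lt {t : ℝ≥0∞} (h : t < G.explosionTime Y ξ ω) :
    ∃ n, G.jumpTime Y ξ n ω ≤ t ∧ t < G.jumpTime Y ξ (n + 1) ω := by
  classical
  have h1 : ∃ n, t < G.jumpTime Y ξ n ω := lt_iSup_iff.mp h
  obtain ⟨n, hn⟩ : ∃ n, Nat.find h1 = n + 1 := by
    refine Nat.exists_eq_succ_of_ne_zero fun h0 => ?_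
    have := Nat.find_spec h1
    rw [h0] at this
    simp [jumpTime] at this
  refine ⟨n, not_lt.mp (Nat.find_min h1 (by omega)), ?_⟩
  rw [← hn]
  exact Nat.find_spec h1

theorem jumpCount_eq {n : ℕ} {t : ℝ≥0∞} (h₁ : G.jumpTime Y ξ n ω ≤ t)
    (h₂ : t < G.jumpTime Y ξ (n + 1) ω) : G.jumpCount Y ξ t ω = n := by
  have hmono : Monotone fun k => G.jumpTime Y ξ k ω := fun i j hij =>
    Finset.sum_le_sum_of_subset (Finset.Icc_subset_Icc_right hij)
  have hs : {k | G.jumpTime Y ξ k ω ≤ t} = Set.Iic n := by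
    ext k
    simp only [Set.mem_ofPred_eq, Set.mem_Iic]
    refine ⟨fun hk => ?_, fun hk => (hmono hk).trans h₁⟩
    by_contra hlt
    exact absurd (((hmono (Nat.succ_le_of_lt (not_le.mp hlt))).trans hk).trans_lt h₂)
      (lt_irrefl _)
  rw [jumpCount, hs, csSup_Iic]

section

variable (hpos : ∀ k, 0 < ξ (k + 1) ω)
include hpos

/-- Positive clocks make finite jump times strictly increasing, so the process at the `n`-th jump
time is in state `n` and not in a later one. -/
theorem process_jumpTime {n : ℕ} (h : G.jumpTime Y ξ n ω ≠ ⊤) :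
    G.process Y ξ (G.jumpTime Y ξ n ω) ω = Y n ω := by
  refine G.process_eq Y ξ le_rfl ?_
  rw [jumpTime_eq_arrival] at h
  rw [jumpTime_eq_arrival, jumpTime_eq_arrival, arrival_succ]
  exact ENNReal.lt_add_right h (ENNReal.div_pos (by simpa using hpos n) ENNReal.ofReal_ne_top).ne'

theorem degM_pos_of_jumpTime_ne_top {n : ℕ} (h : G.jumpTime Y ξ n ω ≠ ⊤) {k : ℕ} (hk : k < n) :
    0 < G.degM (Y k ω) := by
  refine lt_of_le_of_ne (G.degM_nonneg _) fun h0 => h ?_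
  rw [jumpTime_eq_arrival, arrival, ENNReal.sum_eq_top]
  refine ⟨k, Finset.mem_range.mpr hk, ?_⟩
  rw [← h0, ENNReal.ofReal_zero, ENNReal.div_zero (by simpa using hpos k)]

theorem jumpTime_eq_ofReal {n : ℕ} (h : G.jumpTime Y ξ n ω ≠ ⊤) :
    G.jumpTime Y ξ n ω
      = ENNReal.ofReal (∑ k ∈ Finset.range n, ξ (k + 1) ω / G.degM (Y k ω)) := by
  rw [ENNReal.ofReal_sum_of_nonneg fun k _ => div_nonneg (hpos k).le (G.degM_nonneg _),
    jumpTime_eq_arrival]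
  refine Finset.sum_congr rfl fun k hk => ?_
  rw [ENNReal.ofReal_div_of_pos (degM_pos_of_jumpTime_ne_top hpos h (Finset.mem_range.mp hk))]

omit hpos in
theorem integral_process_between (v : X → ℝ) {n : ℕ} {c d : ℝ} (hc : 0 ≤ c) (hcd : c ≤ d)
    (h₁ : G.jumpTime Y ξ n ω ≤ ENNReal.ofReal c)
    (h₂ : ENNReal.ofReal d ≤ G.jumpTime Y ξ (n + 1) ω) :
    IntervalIntegrable (fun u => v (G.process Y ξ (ENNReal.ofReal u) ω)) volume c d ∧
      ∫ u in c..d, v (G.process Y ξ (ENNReal.ofReal u) ω) = (d - c) * v (Y n ω) := by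
  have h : Set.EqOn (fun _ => v (Y n ω)) (fun u => v (G.process Y ξ (ENNReal.ofReal u) ω))
      (Set.Ioo c d) := by
    intro u hu
    simp only
    rw [G.process_eq Y ξ (h₁.trans (ENNReal.ofReal_le_ofReal hu.1.le))
      (lt_of_lt_of_le ((ENNReal.ofReal_lt_ofReal_iff (hc.trans_lt (hu.1.trans hu.2))).mpr hu.2) h₂)]
  constructor
  · refine (intervalIntegrable_const (c := v (Y n ω))).congr_uIoo ?_
    rw [Set.uIoo_of_le hcd]
    exact h
  · rw [← intervalIntegral.integral_congr_Ioo_of_le hcd h, intervalIntegral.integral_const,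
      smul_eq_mul]

theorem integral_process_jumpTime (v : X → ℝ) {n : ℕ} (h : G.jumpTime Y ξ n ω ≠ ⊤) :
    IntervalIntegrable (fun u => v (G.process Y ξ (ENNReal.ofReal u) ω)) volume 0
        (∑ k ∈ Finset.range n, ξ (k + 1) ω / G.degM (Y k ω)) ∧
      ∫ u in 0..(∑ k ∈ Finset.range n, ξ (k + 1) ω / G.degM (Y k ω)),
          v (G.process Y ξ (ENNReal.ofReal u) ω)
        = ∑ k ∈ Finset.range n, ξ (k + 1) ω / G.degM (Y k ω) * v (Y k ω) := by
  induction n with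
  | zero => simp
  | succ n ih =>
    have h0 : ∀ k, 0 ≤ ξ (k + 1) ω / G.degM (Y k ω) := fun k =>
      div_nonneg (hpos k).le (G.degM_nonneg _)
    have h1 : G.jumpTime Y ξ n ω ≠ ⊤ := ne_top_of_le_ne_top h
      (Finset.sum_le_sum_of_subset (Finset.Icc_subset_Icc_right n.le_succ))
    have h2 := integral_process_between v (Finset.sum_nonneg fun k _ => h0 k)
      (Finset.sum_le_sum_of_subset_of_nonneg (Finset.range_mono n.le_succ) fun k _ _ => h0 k)
      (jumpTime_eq_ofReal hpos h1).le (jumpTime_eq_ofReal hpos h).ge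
    refine ⟨(ih h1).1.trans h2.1, ?_⟩
    rw [← intervalIntegral.integral_add_adjacent_intervals (ih h1).1 h2.1, (ih h1).2, h2.2,
      Finset.sum_range_succ, Finset.sum_range_succ, add_sub_cancel_left]

/-- The path is constant between jumps, so the action is a sum over the completed holding times plus
the residual time in the current state. -/
theorem feynmanKacIto_eq_jumpWeight (v : X → ℝ) (θ : X → X → ℝ) (f : X → ℂ) {n : ℕ} {t : ℝ≥0}
    (h₁ : G.jumpTime Y ξ n ω ≤ t) (h₂ : t < G.jumpTime Y ξ (n + 1) ω) :
    G.feynmanKacIto Y ξ v θ f t ω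
      = G.jumpWeight v θ f n (fun k => Y k ω) (fun k => ξ (k + 1) ω) t := by
  have hexp : (t : ℝ≥0∞) < G.explosionTime Y ξ ω := lt_of_lt_of_le h₂
    (le_iSup (fun n => G.jumpTime Y ξ n ω) (n + 1))
  have hne : ∀ k ≤ n, G.jumpTime Y ξ k ω ≠ ⊤ := fun k hk =>
    ne_top_of_le_ne_top (ne_top_of_le_ne_top ENNReal.coe_ne_top h₁)
      (Finset.sum_le_sum_of_subset (Finset.Icc_subset_Icc_right hk))
  have hline : G.lineIntegral Y ξ θ t ω = ∑ k ∈ Finset.range n, θ (Y k ω) (Y (k + 1) ω) := by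
    have h3 : ∀ g : ℕ → ℝ, ∑ k ∈ Finset.Icc 1 n, g k = ∑ k ∈ Finset.range n, g (k + 1) := by
      intro g
      rw [Finset.range_eq_Ico, Finset.sum_Ico_add' g 0 n 1, zero_add]
      rfl
    rw [lineIntegral, jumpCount_eq h₁ h₂, h3]
    refine Finset.sum_congr rfl fun k hk => ?_
    have hk := Finset.mem_range.mp hk
    rw [process_jumpTime hpos (hne (k + 1) hk), Nat.add_sub_cancel,
      process_jumpTime hpos (hne k hk.le)]
  have hpot : ∫ u in (0 : ℝ)..t, v (G.process Y ξ (ENNReal.ofReal u) ω)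
      = ∑ k ∈ Finset.range n, ξ (k + 1) ω / G.degM (Y k ω) * v (Y k ω)
        + (t - ∑ k ∈ Finset.range n, ξ (k + 1) ω / G.degM (Y k ω)) * v (Y n ω) := by
    have h3 := jumpTime_eq_ofReal hpos (hne n le_rfl)
    have h4 : ∑ k ∈ Finset.range n, ξ (k + 1) ω / G.degM (Y k ω) ≤ t := by
      rw [h3, ← ENNReal.ofReal_coe_nnreal] at h₁
      exact (ENNReal.ofReal_le_ofReal_iff t.2).mp h₁
    have h5 := integral_process_jumpTime hpos v (hne n le_rfl)
    have h6 := integral_process_between v (Finset.sum_nonneg fun k _ =>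
      div_nonneg (hpos k).le (G.degM_nonneg (Y k ω))) h4 h3.le
      (by rw [ENNReal.ofReal_coe_nnreal]; exact h₂.le)
    rw [← intervalIntegral.integral_add_adjacent_intervals h5.1 h6.1, h5.2, h6.2]
  rw [feynmanKacIto, Set.indicator_of_mem (by exact hexp), action, hline, hpot, jumpWeight,
    G.process_eq Y ξ h₁ h₂]

end

/-- The event that the process has not exploded at time `t` and that all its jumps before time `t`
lead into `S`. -/
def confinedEvent (G : WeightedGraph X) (Y : ℕ → Ω → X) (ξ : ℕ → Ω → ℝ) (S : Finset X) (t : ℝ≥0) :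
    Set Ω :=
  {ω | ∃ n, (G.jumpTime Y ξ n ω ≤ t ∧ t < G.jumpTime Y ξ (n + 1) ω) ∧ ∀ k < n, Y (k + 1) ω ∈ S}

theorem pathWeight_eq_ite (hpos : ∀ k, 0 < ξ (k + 1) ω) (v : X → ℝ) (θ : X → X → ℝ) (f : X → ℂ)
    (S : Finset X) (n : ℕ) (t : ℝ≥0) [Decidable ((G.jumpTime Y ξ n ω ≤ t ∧
      t < G.jumpTime Y ξ (n + 1) ω) ∧ ∀ k < n, Y (k + 1) ω ∈ S)] :
    G.pathWeight v θ f S n (fun k => Y k ω) (fun k => ξ (k + 1) ω) t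
      = if (G.jumpTime Y ξ n ω ≤ t ∧ t < G.jumpTime Y ξ (n + 1) ω) ∧ ∀ k < n, Y (k + 1) ω ∈ S
        then G.feynmanKacIto Y ξ v θ f t ω else 0 := by
  classical
  rw [pathWeight_eq G v θ f S n (fun k => Y k ω) hpos t.coe_nonneg]
  simp only [ENNReal.ofReal_coe_nnreal, jumpTime_eq_arrival]
  split_ifs with h
  · exact (feynmanKacIto_eq_jumpWeight hpos v θ f (by rw [jumpTime_eq_arrival]; exact h.1.1)
      (by rw [jumpTime_eq_arrival]; exact h.1.2)).symm
  · rfl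

theorem eq_of_jumpTime {t : ℝ≥0∞} {i j : ℕ}
    (hi : G.jumpTime Y ξ i ω ≤ t ∧ t < G.jumpTime Y ξ (i + 1) ω)
    (hj : G.jumpTime Y ξ j ω ≤ t ∧ t < G.jumpTime Y ξ (j + 1) ω) : i = j := by
  rw [← jumpCount_eq hi.1 hi.2, jumpCount_eq hj.1 hj.2]

/-- The events of exactly `n` jumps are disjoint, so at most one term is non-zero. -/
theorem hasSum_pathWeight (hpos : ∀ k, 0 < ξ (k + 1) ω) (v : X → ℝ) (θ : X → X → ℝ) (f : X → ℂ)
    (S : Finset X) (t : ℝ≥0) :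
    HasSum (fun n => G.pathWeight v θ f S n (fun k => Y k ω) (fun k => ξ (k + 1) ω) t)
      ((G.confinedEvent Y ξ S t).indicator (G.feynmanKacIto Y ξ v θ f t) ω) := by
  classical
  simp only [pathWeight_eq_ite hpos]
  by_cases h : ω ∈ G.confinedEvent Y ξ S t
  · obtain ⟨n, hn⟩ := id h
    rw [Set.indicator_of_mem h]
    have h1 := hasSum_single (f := fun n => if (G.jumpTime Y ξ n ω ≤ t ∧
      t < G.jumpTime Y ξ (n + 1) ω) ∧ ∀ k < n, Y (k + 1) ω ∈ S
        then G.feynmanKacIto Y ξ v θ f t ω else 0) n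
      (fun m hm => if_neg fun h2 => hm (eq_of_jumpTime h2.1 hn.1))
    simpa only [if_pos hn] using h1
  · rw [Set.indicator_of_notMem h]
    have h1 : ∀ n, ¬ ((G.jumpTime Y ξ n ω ≤ t ∧ t < G.jumpTime Y ξ (n + 1) ω) ∧
      ∀ k < n, Y (k + 1) ω ∈ S) := fun n hn => h ⟨n, hn⟩
    simp only [h1, if_false]
    exact hasSum_zero

/-- By the same disjointness, a partial sum obeys the bound of a single term; this is the dominating
constant when the Dyson series is summed. -/
theorem norm_sum_pathWeight_le (hpos : ∀ k, 0 < ξ (k + 1) ω) {v : X → ℝ} (θ : X → X → ℝ)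
    {f : X → ℂ} {S : Finset X} (t : ℝ≥0) {M C : ℝ} (hM : ∀ x ∈ S, |v x| ≤ M)
    (hC : ∀ x ∈ S, ‖f x‖ ≤ C) (hY : Y 0 ω ∈ S) (N : ℕ) :
    ‖∑ n ∈ Finset.range N, G.pathWeight v θ f S n (fun k => Y k ω) (fun k => ξ (k + 1) ω) t‖
      ≤ Real.exp (M * t) * C := by
  classical
  have hC0 : 0 ≤ C := (norm_nonneg _).trans (hC _ hY)
  by_cases h : ∃ n ∈ Finset.range N,
    G.pathWeight v θ f S n (fun k => Y k ω) (fun k => ξ (k + 1) ω) t ≠ 0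
  · obtain ⟨n, hnN, hn⟩ := h
    rw [Finset.sum_eq_single_of_mem n hnN]
    · exact G.norm_pathWeight_le θ hM hC n hY (fun k => (hpos k).le) t.2
    · intro m _ hm
      rw [pathWeight_eq_ite hpos] at hn ⊢
      have h1 := (ite_ne_right_iff.mp hn).1
      exact if_neg fun h2 => hm (eq_of_jumpTime h2.1 h1.1)
  · push Not at h
    rw [Finset.sum_eq_zero h, norm_zero]
    positivity

theorem eventually_mem_confinedEvent {t : ℝ≥0} (h : t < G.explosionTime Y ξ ω) :
    ∀ᶠ S in atTop, ω ∈ G.confinedEvent Y ξ S t := by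
  classical
  obtain ⟨n, hn⟩ := exists_jumpTime_le_lt h
  filter_upwards [eventually_ge_atTop ((Finset.range n).image fun k => Y (k + 1) ω)] with S hS
  exact ⟨n, hn, fun k hk => hS (Finset.mem_image_of_mem _ (Finset.mem_range.mpr hk))⟩

theorem tendsto_indicator_feynmanKacIto (v : X → ℝ) (θ : X → X → ℝ) (f : X → ℂ) (t : ℝ≥0) (ω : Ω) :
    Tendsto (fun S => (G.confinedEvent Y ξ S t).indicator (G.feynmanKacIto Y ξ v θ f t) ω) atTop
      (𝓝 (G.feynmanKacIto Y ξ v θ f t ω)) := by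
  refine tendsto_const_nhds.congr' ?_
  by_cases h : t < G.explosionTime Y ξ ω
  · filter_upwards [eventually_mem_confinedEvent h] with S hS
    rw [Set.indicator_of_mem hS]
  · have h1 : G.feynmanKacIto Y ξ v θ f t ω = 0 := Set.indicator_of_notMem (by exact h) _
    filter_upwards with S
    rw [Set.indicator_apply_eq_zero.mpr fun _ => h1, h1]

/-- The magnetic potential contributes only a phase. This is what reduces integrability to zero
field. -/
theorem norm_feynmanKacIto (v : X → ℝ) (θ : X → X → ℝ) (f : X → ℂ) (t : ℝ≥0) (ω : Ω) :
    (‖G.feynmanKacIto Y ξ v θ f t ω‖ : ℂ)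
      = G.feynmanKacIto Y ξ v (fun _ _ => 0) (fun x => (‖f x‖ : ℂ)) t ω := by
  by_cases h : (t : ℝ≥0∞) < G.explosionTime Y ξ ω
  · simp only [feynmanKacIto]
    rw [Set.indicator_of_mem (by exact h), Set.indicator_of_mem (by exact h), norm_mul,
      Complex.norm_exp, Complex.ofReal_mul, Complex.ofReal_exp]
    congr 2
    simp [action, lineIntegral]
  · simp only [feynmanKacIto]
    rw [Set.indicator_of_notMem (by exact h), Set.indicator_of_notMem (by exact h)]
    simp

end Pathwise

end WeightedGraph

/-! ### From finite sets to the whole graph -/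

namespace WeightedGraph

section Formula

variable {X : Type*} [Countable X] [MeasurableSpace X] [DiscreteMeasurableSpace X]
  {G : WeightedGraph X} {v : X → ℝ} {θ : X → X → ℝ} {l : ℝ}
  (h : G.IsCoercive (fun x => v x + l) θ)

include h

omit [Countable X] in
theorem tendsto_heatOp_finiteResolvent (f : G.ell2) {t : ℝ} (ht : 0 ≤ t) (x : X) :
    Tendsto (fun S => heatOp (finiteResolvent h S) t f x) atTop
      (𝓝 (heatOp (resolventOp h) t f x)) :=
  tendsto_apply (tendsto_heatOp_apply (resolventOp_isPositive h)
    (norm_formResolvent_le _ _ (norm_domainInclusion_le h)) (finiteResolvent_isPositive h)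
    (fun _ => norm_formResolvent_le _ _ (norm_domainInclusion_le h))
    (tendsto_finiteResolvent h) ht f) x

variable {Ω : Type*} [MeasurableSpace Ω] {P : Measure Ω} [IsProbabilityMeasure P]
  {Y : ℕ → Ω → X} {ξ : ℕ → Ω → ℝ} (hJ : G.IsJumpData P Y ξ)
include hJ

/-- The Feynman–Kac–Itô formula for the process confined to a finite set. -/
theorem integrable_and_integral_confined {S : Finset X} {x : X} (hx : x ∈ S) (f : G.ell2)
    (t : ℝ≥0) :
    Integrable ((G.confinedEvent Y ξ S t).indicator (G.feynmanKacIto Y ξ v θ f t))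
        (P.restrict {ω | Y 0 ω = x}) ∧
      ∫ ω in {ω | Y 0 ω = x},
          (G.confinedEvent Y ξ S t).indicator (G.feynmanKacIto Y ξ v θ f t) ω ∂P
        = P.real {ω | Y 0 ω = x} * (Real.exp (l * t) * heatOp (finiteResolvent h S) t f x) := by
  obtain ⟨M, -, hM⟩ := exists_bound_on_finset S v
  obtain ⟨C, -, hC⟩ := exists_bound_on_finset S fun x => ‖f x‖
  have hC' : ∀ x ∈ S, ‖f x‖ ≤ C := fun x hx => by simpa using hC x hx
  set μ := P.restrict {ω | Y 0 ω = x} with hμ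
  set p : ℕ → Ω → ℂ := fun n ω =>
    G.pathWeight v θ f S n (fun k => Y k ω) (fun k => ξ (k + 1) ω) t with hp
  have hpm : ∀ n, Measurable (p n) := fun n => (G.measurable_pathWeight v θ f S n).comp
    ((measurable_pi_lambda _ hJ.measurable_chain).prodMk
      ((measurable_pi_lambda _ fun k => hJ.measurable_clock (k + 1)).prodMk measurable_const))
  have hpos : ∀ᵐ ω ∂μ, ∀ k, 0 < ξ (k + 1) ω := ae_restrict_of_ae hJ.ae_pos_clock
  have hstart : ∀ᵐ ω ∂μ, Y 0 ω = x := ae_restrict_mem (hJ.measurableSet_initial x)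
  have hsm : ∀ N, AEStronglyMeasurable (fun ω => ∑ n ∈ Finset.range N, p n ω) μ := fun N =>
    (Finset.measurable_fun_sum _ fun n _ => hpm n).aestronglyMeasurable
  have hlim : ∀ᵐ ω ∂μ, Tendsto (fun N => ∑ n ∈ Finset.range N, p n ω) atTop
      (𝓝 ((G.confinedEvent Y ξ S t).indicator (G.feynmanKacIto Y ξ v θ f t) ω)) := by
    filter_upwards [hpos] with ω hω
    exact (hasSum_pathWeight hω v θ f S t).tendsto_sum_nat
  have hbound : ∀ N, ∀ᵐ ω ∂μ, ‖∑ n ∈ Finset.range N, p n ω‖ ≤ Real.exp (M * t) * C := by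
    intro N
    filter_upwards [hpos, hstart] with ω hω hω'
    exact norm_sum_pathWeight_le hω θ t hM hC' (by rw [hω']; exact hx) N
  have hpi : ∀ n, Integrable (p n) μ := by
    intro n
    refine Integrable.of_bound (hpm n).aestronglyMeasurable (Real.exp (M * t) * C) ?_
    filter_upwards [hpos, hstart] with ω hω hω'
    exact G.norm_pathWeight_le θ hM hC' n (by rw [hω']; exact hx) (fun k => (hω k).le)
      t.coe_nonneg
  constructor
  · refine Integrable.of_bound (aestronglyMeasurable_of_tendsto_ae _ hsm hlim)
      (Real.exp (M * t) * C) ?_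
    filter_upwards [hlim, ae_all_iff.mpr hbound] with ω h1 h2
    exact le_of_tendsto h1.norm (Eventually.of_forall h2)
  -- The integrals of the partial sums converge to the confined expectation by domination; term by
  -- term they are the Dyson sums, which converge to the finite-volume semigroup.
  · have h1 := tendsto_integral_of_dominated_convergence _ hsm
      (integrable_const (Real.exp (M * t) * C)) hbound hlim
    refine tendsto_nhds_unique h1 ?_
    have h2 := (tendsto_sum_dysonTerm_heatOp h hx f t.coe_nonneg).const_mul
      (P.real {ω | Y 0 ω = x} : ℂ)
    refine h2.congr fun N => ?_
    rw [integral_finsetSum _ fun n _ => hpi n, Finset.mul_sum]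
    exact Finset.sum_congr rfl fun n _ =>
      (hJ.setIntegral_pathWeight v θ f n hx t.coe_nonneg).symm

/-- The confined absolute moments are values of the zero-field finite-volume semigroups at `|f|`,
which converge to a finite limit; Fatou's lemma concludes. -/
theorem integrable_feynmanKacIto (h0 : G.IsCoercive (fun x => v x + l) fun _ _ => 0) (x : X)
    (f : G.ell2) (t : ℝ≥0) :
    Integrable (G.feynmanKacIto Y ξ v θ f t) (P.restrict {ω | Y 0 ω = x}) := by
  classical
  have hmem : MemLp (fun y => (‖f y‖ : ℂ)) 2 G.measure := (Lp.memLp f).norm.ofReal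
  obtain ⟨g, hg⟩ : ∃ g : G.ell2, (g : X → ℂ) = fun y => (‖f y‖ : ℂ) :=
    ⟨hmem.toLp _, G.eq_of_ae_eq hmem.coeFn_toLp⟩
  -- Countability of `X` provides an exhausting sequence of finite sets, as the integral limit
  -- theorems require. Inserting `x` keeps the starting point inside every set.
  obtain ⟨S, hS⟩ := exists_seq_tendsto (atTop : Filter (Finset X))
  let T : ℕ → Finset X := fun n => insert x (S n)
  have hT : Tendsto T atTop atTop := tendsto_atTop_mono (fun n => Finset.subset_insert x (S n)) hS
  have hxT : ∀ n, x ∈ T n := fun n => Finset.mem_insert_self _ _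
  set μ := P.restrict {ω | Y 0 ω = x} with hμ
  let F : ℕ → Ω → ℂ := fun n =>
    (G.confinedEvent Y ξ (T n) t).indicator (G.feynmanKacIto Y ξ v θ f t)
  have hFi : ∀ n, Integrable (F n) μ := fun n =>
    (integrable_and_integral_confined h hJ (hxT n) f t).1
  have hlim : ∀ᵐ ω ∂μ, Tendsto (fun n => F n ω) atTop (𝓝 (G.feynmanKacIto Y ξ v θ f t ω)) :=
    Eventually.of_forall fun ω => (tendsto_indicator_feynmanKacIto v θ f t ω).comp hT
  have hnorm : ∀ n, ((∫ ω, ‖F n ω‖ ∂μ : ℝ) : ℂ)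
      = P.real {ω | Y 0 ω = x} * (Real.exp (l * t) * heatOp (finiteResolvent h0 (T n)) t g x) := by
    intro n
    rw [← (integrable_and_integral_confined h0 hJ (hxT n) g t).2, ← integral_complex_ofReal]
    refine integral_congr_ae (Eventually.of_forall fun ω => ?_)
    simp only [F, Set.indicator_apply]
    split_ifs
    · rw [norm_feynmanKacIto, hg]
    · simp
  have hconv : Tendsto (fun n => ∫ ω, ‖F n ω‖ ∂μ) atTop (𝓝 (P.real {ω | Y 0 ω = x}
      * (Real.exp (l * t) * heatOp (resolventOp h0) t g x) : ℂ).re) := by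
    have h1 := (((tendsto_heatOp_finiteResolvent h0 g t.coe_nonneg x).comp hT).const_mul
      (Real.exp (l * t) : ℂ)).const_mul (P.real {ω | Y 0 ω = x} : ℂ)
    refine ((Complex.continuous_re.tendsto _).comp h1).congr fun n => ?_
    simp only [Function.comp_apply]
    rw [← hnorm n, Complex.ofReal_re]
  refine ⟨aestronglyMeasurable_of_tendsto_ae _ (fun n => (hFi n).aestronglyMeasurable) hlim, ?_⟩
  have h2 : ∫⁻ ω, ‖G.feynmanKacIto Y ξ v θ f t ω‖ₑ ∂μ
      ≤ liminf (fun n => ∫⁻ ω, ‖F n ω‖ₑ ∂μ) atTop := by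
    refine le_trans (le_of_eq ?_)
      (lintegral_liminf_le' fun n => (hFi n).aestronglyMeasurable.enorm)
    refine lintegral_congr_ae ?_
    filter_upwards [hlim] with ω hω
    exact hω.enorm.liminf_eq.symm
  have h3 : Tendsto (fun n => ∫⁻ ω, ‖F n ω‖ₑ ∂μ) atTop _ :=
    (ENNReal.tendsto_ofReal hconv).congr fun n => ofReal_integral_norm_eq_lintegral_enorm (hFi n)
  rw [h3.liminf_eq] at h2
  exact h2.trans_lt ENNReal.ofReal_lt_top

/-- The confined functionals are dominated by the unconfined one, already known to be integrable, so
both sides of the finite-volume formula pass to the limit. -/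
theorem setIntegral_feynmanKacIto (h0 : G.IsCoercive (fun x => v x + l) fun _ _ => 0) (x : X)
    (f : G.ell2) (t : ℝ≥0) :
    ∫ ω in {ω | Y 0 ω = x}, G.feynmanKacIto Y ξ v θ f t ω ∂P
      = P.real {ω | Y 0 ω = x} * expNeg (G.schrodinger v θ) t f x := by
  classical
  obtain ⟨S, hS⟩ := exists_seq_tendsto (atTop : Filter (Finset X))
  let T : ℕ → Finset X := fun n => insert x (S n)
  have hT : Tendsto T atTop atTop := tendsto_atTop_mono (fun n => Finset.subset_insert x (S n)) hS
  have hxT : ∀ n, x ∈ T n := fun n => Finset.mem_insert_self _ _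
  have h1 := tendsto_integral_of_dominated_convergence _
    (fun n => (integrable_and_integral_confined h hJ (hxT n) f t).1.aestronglyMeasurable)
    (integrable_feynmanKacIto h hJ h0 x f t).norm
    (fun n => Eventually.of_forall fun ω => norm_indicator_le_norm_self _ _)
    (Eventually.of_forall fun ω => (tendsto_indicator_feynmanKacIto v θ f t ω).comp hT)
  refine tendsto_nhds_unique h1 ?_
  have h2 := (((tendsto_heatOp_finiteResolvent h f t.coe_nonneg x).comp hT).const_mul
    (Real.exp (l * t) : ℂ)).const_mul (P.real {ω | Y 0 ω = x} : ℂ)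
  rw [expNeg_schrodinger h h0, _root_.smul_apply, RCLike.real_smul_eq_coe_smul (K := ℂ),
    coe_smul]
  exact h2.congr fun n => (integrable_and_integral_confined h hJ (hxT n) f t).2.symm

end Formula

end WeightedGraph

theorem theorem4p1 {X : Type*} [Countable X] [MeasurableSpace X] [DiscreteMeasurableSpace X]
    (G : WeightedGraph X) (θ : X → X → ℝ) (hθ : IsMagneticPotential θ)
    (v : X → ℝ) (hv : v ∈ G.admissible (fun _ _ => 0)) :
    -- the form is semi-bounded and closable, so that the operator and its semigroup make sense
    G.IsSemibounded v θ ∧ G.IsClosable v θ ∧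
    G.IsFormOperator v θ (G.schrodinger v θ) ∧ IsSelfAdjoint (G.schrodinger v θ) ∧
    IsC0SemigroupGeneratedBy (expNeg (G.schrodinger v θ)) (-G.schrodinger v θ) ∧
    -- the Feynman-Kac-Itô formula
    ∀ {Ω : Type*} [MeasurableSpace Ω] (P : Measure Ω) [IsProbabilityMeasure P]
      (Y : ℕ → Ω → X) (ξ : ℕ → Ω → ℝ), G.IsJumpData P Y ξ →
      ∀ (f : G.ell2) (t : ℝ≥0) (x : X), P {ω | Y 0 ω = x} ≠ 0 →
        Integrable (G.feynmanKacIto Y ξ v θ f t) (P[|{ω | Y 0 ω = x}]) ∧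
        expNeg (G.schrodinger v θ) t f x
          = ∫ ω, G.feynmanKacIto Y ξ v θ f t ω ∂(P[|{ω | Y 0 ω = x}]) := by
  -- One shift `l` serves both `θ` and the zero field, which enters through the superharmonic
  -- function and through integrability.
  obtain ⟨l, hl⟩ := WeightedGraph.exists_isCoercive hv
  have h := hl θ hθ
  have h0 := hl _ isMagneticPotential_zero
  refine ⟨WeightedGraph.isSemibounded_of_isCoercive h, WeightedGraph.isClosable_of_isCoercive h h0,
    WeightedGraph.isFormOperator_schrodinger h h0, WeightedGraph.isSelfAdjoint_schrodinger h h0,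
    WeightedGraph.isC0Semigroup_expNeg h h0, ?_⟩
  intro Ω _ P _ Y ξ hJ f t x hx
  have hint := WeightedGraph.integrable_feynmanKacIto h hJ h0 x f t
  have hreal : (P.real {ω | Y 0 ω = x} : ℂ) ≠ 0 := by
    rw [Complex.ofReal_ne_zero, measureReal_ne_zero_iff]
    exact hx
  refine ⟨?_, ?_⟩
  · rw [ProbabilityTheory.cond]
    exact hint.smul_measure (ENNReal.inv_ne_top.mpr hx)
  · rw [ProbabilityTheory.cond, integral_smul_measure,
      WeightedGraph.setIntegral_feynmanKacIto h hJ h0, ENNReal.toReal_inv, Complex.real_smul,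
      Complex.ofReal_inv, ← measureReal_def, ← mul_assoc, inv_mul_cancel₀ hreal, one_mul]
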